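/- Let $G$ be a simple graph with a finite vertex set. Let $D=\bigsqcup_v D_v$ be a set of darts, where $|D_v|=\deg(v)$ for each vertex $v$. Let $\mathcal R(G)$ be the set of permutations $R$ of $D$ whose cycles (fixed points counted as cycles) are supported exactly on the sets $D_v$, with one cycle for each $v$. Let $\mathcal E(G)$ be the set of fixed-point-free involutions $E$ of $D$ such that for each edge $uv$ of $G$ there is exactly one 2-cycle of $E$ consisting of a dart of $D_u$ and a dart of $D_v$. A random embedding of $G$ is a triple $m=(D,R,E)$ with $(R,E)$ chosen uniformly at random from $\mathcal M(G)=\mathcal R(G)\times\mathcal E(G)$. Let $\omega_v(m)\in S_{D_v}$ be the permutation induced on $D_v$ by the face permutation $R\cdot E$ (permutations are multiplied from left to right), that is, the permutation obtained from the disjoint cycle notation of $R\cdot E$ by deleting all symbols not in $D_v$ and then any empty cycles. The local face distribution $L_v$ is the distribution of $\omega_v(m)$ on $S_{D_v}$ for a random embedding $m$ of $G$. For a finite set $X$ and $p\in[0,1]$, let $U_{X,p}$ be the distribution on $S_X$ that takes the value $\frac{2p}{|X|!}$ at each odd permutation and $\frac{2(1-p)}{|X|!}$ at each even permutation. For distributions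 $P,Q$ on a finite set $\Omega$, write $\|P-Q\|=\frac12\sum_{x\in\Omega}|P(x)-Q(x)|$. **Corollary.** There is an $n_0$ such that for all $n\ge n_0$ and every vertex $v$ of the complete graph $G=K_n$, with $p=\Pr[\omega_v(m)\text{ is odd}]$ for a random embedding $m$ of $K_n$, $$\|L_v-U_{D_v,p}\|^2\le\frac{8\ln(n-1)}{\sqrt{n-2}}.$$ Moreover, $\frac{8\ln(n-1)}{\sqrt{n-2}}\to 0$ as $n\to\infty$. -/

import Mathlib

open Filter Topology Equiv

namespace RandomEmbedding

/-! ### Induced permutations -/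

section Induced

variable {X : Type*} [Finite X]

theorem exists_return (α : Perm X) (Y : Set X) (y : Y) :
    ∃ k : ℕ, 0 < k ∧ (α ^ k) (y : X) ∈ Y :=
  ⟨orderOf α, orderOf_pos α, by simp [pow_orderOf_eq_one]⟩

open Classical in
/-- The least `k ≥ 1` such that `α ^ k` takes `y ∈ Y` back into `Y`. -/
noncomputable def returnTime (α : Perm X) (Y : Set X) (y : Y) : ℕ :=
  Nat.find (exists_return α Y y)

theorem returnTime_pos (α : Perm X) (Y : Set X) (y : Y) : 0 < returnTime α Y y := by
  classical
  exact (Nat.find_spec (exists_return α Y y)).1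

theorem returnTime_mem (α : Perm X) (Y : Set X) (y : Y) :
    (α ^ returnTime α Y y) (y : X) ∈ Y := by
  classical
  exact (Nat.find_spec (exists_return α Y y)).2

theorem returnTime_le (α : Perm X) (Y : Set X) (y : Y) {k : ℕ} (hk : 0 < k)
    (h : (α ^ k) (y : X) ∈ Y) : returnTime α Y y ≤ k := by
  classical
  exact Nat.find_min' (exists_return α Y y) ⟨hk, h⟩

/-- The next element of `Y` after `y` on the cycle of `α` through `y`. -/
noncomputable def firstReturn (α : Perm X) (Y : Set X) (y : Y) : Y :=
  ⟨(α ^ returnTime α Y y) (y : X), returnTime_mem α Y y⟩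

theorem returnTime_le_of_firstReturn_eq (α : Perm X) (Y : Set X) {y z : Y}
    (h : firstReturn α Y y = firstReturn α Y z) :
    returnTime α Y z ≤ returnTime α Y y := by
  by_contra hlt
  have hlt : returnTime α Y y < returnTime α Y z := not_le.mp hlt
  have e : (α ^ returnTime α Y y) (y : X) = (α ^ returnTime α Y z) (z : X) :=
    congrArg Subtype.val h
  obtain ⟨k, hk⟩ := Nat.exists_eq_add_of_lt hlt
  rw [hk, add_assoc, pow_add, Perm.mul_apply] at e
  have e' := (α ^ returnTime α Y y).injective e
  have := returnTime_le α Y z (Nat.succ_pos k) (by rw [← e']; exact y.2)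
  have := returnTime_pos α Y y
  omega

theorem firstReturn_injective (α : Perm X) (Y : Set X) :
    Function.Injective (firstReturn α Y) := by
  intro y z h
  have ht := le_antisymm (returnTime_le_of_firstReturn_eq α Y h.symm)
    (returnTime_le_of_firstReturn_eq α Y h)
  have e : (α ^ returnTime α Y y) (y : X) = (α ^ returnTime α Y z) (z : X) :=
    congrArg Subtype.val h
  rw [ht] at e
  exact Subtype.ext ((α ^ returnTime α Y z).injective e)

/-- The induced permutation of `α` on `Y`: all symbols outside `Y` are deleted from the disjoint
cycle notation of `α`, that is, `y ∈ Y` is sent to the next element of `Y` on its cycle. -/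
noncomputable def inducedPerm (α : Perm X) (Y : Set X) : Perm Y :=
  Equiv.ofBijective (firstReturn α Y) (Finite.injective_iff_bijective.mp (firstReturn_injective α Y))

end Induced

/-! ### Maps and random embeddings of a graph -/

section Graph

variable {V : Type*} [Fintype V] [DecidableEq V] (G : SimpleGraph V) [DecidableRel G.Adj]

/-- The set `D(G)` of darts: a disjoint union of sets `D_v(G)` with `|D_v(G)| = deg v`. -/
abbrev DartSet : Type _ := Σ v : V, Fin (G.degree v)

/-- The set `D_v(G)` of darts at the vertex `v`. -/
abbrev dartsAt (v : V) : Set (DartSet G) := {x | x.1 = v}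

/-- The local rotations: the permutations of the darts whose cycles (1-cycles included) are
supported exactly on the sets `D_v(G)`, one cycle for each `v`. -/
def localRotations : Set (Perm (DartSet G)) :=
  {R | ∀ x y : DartSet G, R.SameCycle x y ↔ x.1 = y.1}

/-- The edge schemes: the fixed point free involutions of the darts such that for each edge `uv`
exactly one 2-cycle `(x, E x)` consists of a dart at `u` and a dart at `v`. -/
def edgeSchemes : Set (Perm (DartSet G)) :=
  {E | (∀ x, E (E x) = x) ∧ (∀ x, E x ≠ x) ∧
    ∀ u v : V, G.Adj u v → ∃! x : DartSet G, x.1 = u ∧ (E x).1 = v}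

open Classical in
/-- The set `M(G)` of all maps `(D, R, E)` with `R` a local rotation and `E` an edge scheme. -/
noncomputable def maps : Finset (Perm (DartSet G) × Perm (DartSet G)) :=
  Finset.univ.filter fun m => m.1 ∈ localRotations G ∧ m.2 ∈ edgeSchemes G

open Classical in
/-- The probability of an event for a map chosen uniformly at random from `M(G)`. -/
noncomputable def prob (A : Perm (DartSet G) × Perm (DartSet G) → Prop) : ℝ :=
  (((maps G).filter A).card : ℝ) / ((maps G).card : ℝ)

variable {G}

/-- The face permutation `R · E` of `m = (D, R, E)`. Permutations are multiplied from left to right,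
so `R` is applied first; in Mathlib's convention this is `E * R`. -/
def facePerm (m : Perm (DartSet G) × Perm (DartSet G)) : Perm (DartSet G) := m.2 * m.1

/-- `ω_v(m)`: the permutation of `D_v` induced by the face permutation. -/
noncomputable def localFacePerm (v : V) (m : Perm (DartSet G) × Perm (DartSet G)) :
    Perm (dartsAt G v) :=
  inducedPerm (facePerm m) (dartsAt G v)

variable (G)

/-- The local face distribution `L_v(G)`, the law of `ω_v(m)` for a random embedding `m`. -/
noncomputable def localFaceDist (v : V) (τ : Perm (dartsAt G v)) : ℝ :=
  prob G fun m => localFacePerm v m = τ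

/-- The probability that `ω_v(m)` is odd for a random embedding `m`. -/
noncomputable def oddProb (v : V) : ℝ :=
  prob G fun m => Perm.sign (localFacePerm v m) = -1

end Graph

/-! ### Distributions -/

/-- `U_{X,p}`: mass `2p/|X|!` at each odd and `2(1-p)/|X|!` at each even permutation of `X`. -/
noncomputable def parityUniform (X : Type*) [Fintype X] [DecidableEq X] (p : ℝ) (τ : Perm X) : ℝ :=
  if Perm.sign τ = -1 then 2 * p / ((Fintype.card X).factorial : ℝ)
  else 2 * (1 - p) / ((Fintype.card X).factorial : ℝ)

/-- Total variation distance of two distributions on a finite set, given by their mass functions. -/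
noncomputable def tvDist {Ω : Type*} [Fintype Ω] (P Q : Ω → ℝ) : ℝ :=
  (1 / 2) * ∑ x, |P x - Q x|

end RandomEmbedding

open RandomEmbedding

/-! Write d = n - 1 for the number of darts at v. The local face permutation factors as ω_v = σ * C,
where C is the full cycle induced by R on D_v and σ = `returnPerm v m` depends only on E and on the
rotations at the other vertices (`localFacePerm_eq`). Conjugating C alone, or the whole map, by a
permutation of D_v preserves the uniform law. Hence L_v is the average over m of `mixDist σ`, the
law of a random conjugate of σ times a random full cycle (`card_filter_localFacePerm_eq`).

Let χ_k be the character of Λ^k of the standard representation. The alternating sum of the χ_k for k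
< d is d times the indicator of the full cycles, so `mixDist σ` expands in the χ_k alone, with
coefficients given by χ_k(σ⁻¹) / χ_k(1). The terms k = 0 and k = d - 1 are the trivial and the sign
character, and their average over m is U_{D_v,p}. By Cauchy–Schwarz and orthogonality the L¹ norm of
the rest is at most the square root of the sum of the squares of the remaining ratios
(`sum_abs_mixDist_sub_parityDist_sq_le`).

The ratios are small when σ has few fixed points, because |χ_k(σ)| is bounded by the number of
σ-invariant sets of size at most k, or of size less than d - k (`sum_sq_ratio_le`).

A fixed point of σ is a face walk that leaves v and comes back by the same dart without another
visit to v. Resampling the rotation at a neighbour shows that such walks are rarely short there, and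
long ones use up many of the few face cycles at the other vertices. So the expected number of fixed
points is of order √(d log d) (`sum_maps_fixCount_le`, `expectation_bound`). Markov's inequality
with threshold 3 d^(3/4) finishes the proof (`tvDist_le`, `tvDist_complete_sq_le`). -/

namespace RandomEmbedding

set_option linter.unusedSectionVars false

/-! ### Sums of principal minors and the Cauchy–Binet formula -/

section Minors

open Finset Matrix

variable {X : Type*} [Fintype X] [DecidableEq X]

theorem card_injective_tuples_image_eq {k : ℕ} {A : Finset X} (hA : A.card = k) :
    (univ.filter fun a : Fin k → X => Function.Injective a ∧ univ.image a = A).card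
      = k.factorial := by
  have hcard : Fintype.card (Fin k) = Fintype.card A := by simp [hA]
  have e₀ : Fin k ≃ A := Fintype.equivOfCardEq hcard
  have h := Fintype.card_equiv e₀
  rw [Fintype.card_fin] at h
  rw [← h, ← Finset.card_univ]
  symm
  refine Finset.card_bij (fun e _ i => ((e i : A) : X)) ?_ ?_ ?_
  · intro e _
    refine mem_filter.mpr ⟨mem_univ _, Subtype.val_injective.comp e.injective, ?_⟩
    ext x
    simp only [mem_image, mem_univ, true_and]
    constructor
    · rintro ⟨i, rfl⟩
      exact (e i).2
    · intro hx
      exact ⟨e.symm ⟨x, hx⟩, by simp⟩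
  · intro e _ e' _ h
    ext i
    exact congrFun h i
  · intro a ha
    obtain ⟨-, hinj, himg⟩ := mem_filter.mp ha
    have hmem : ∀ i, a i ∈ A := fun i => himg ▸ mem_image_of_mem a (mem_univ i)
    refine ⟨Equiv.ofBijective (fun i => (⟨a i, hmem i⟩ : A)) ⟨?_, ?_⟩, mem_univ _, ?_⟩
    · intro i j hij
      exact hinj (congrArg Subtype.val hij)
    · rintro ⟨x, hx⟩
      rw [← himg] at hx
      obtain ⟨i, -, hi⟩ := mem_image.mp hx
      exact ⟨i, Subtype.ext hi⟩
    · rfl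

/-- A sum over tuples that vanishes on tuples with repetitions and otherwise depends only on the
set of entries. -/
theorem sum_tuples_eq {k : ℕ} (F : (Fin k → X) → ℝ) (H : Finset X → ℝ)
    (h0 : ∀ a, ¬ Function.Injective a → F a = 0)
    (h1 : ∀ a, Function.Injective a → F a = H (univ.image a)) :
    ∑ a, F a = (k.factorial : ℝ) * ∑ A ∈ univ.powersetCard k, H A := by
  classical
  have e1 : ∑ a, F a = ∑ a ∈ univ.filter (fun a : Fin k → X => Function.Injective a), F a := by
    refine (sum_subset (filter_subset _ _) fun a _ ha => h0 a fun hinj => ha ?_).symm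
    exact mem_filter.mpr ⟨mem_univ _, hinj⟩
  rw [e1, ← sum_fiberwise_of_maps_to (t := univ.powersetCard k) (g := fun a => univ.image a),
    mul_sum]
  · refine sum_congr rfl fun A hA => ?_
    have hA' := (mem_powersetCard.mp hA).2
    rw [sum_congr rfl (g := fun _ => H A), sum_const, filter_filter,
      card_injective_tuples_image_eq hA', nsmul_eq_mul]
    intro a ha
    obtain ⟨ha1, ha2⟩ := mem_filter.mp ha
    rw [h1 a (mem_filter.mp ha1).2, ha2]
  · intro a ha
    refine mem_powersetCard.mpr ⟨subset_univ _, ?_⟩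
    rw [card_image_of_injective _ (mem_filter.mp ha).2, card_univ, Fintype.card_fin]

/-- The sum of the principal `k × k` minors of a matrix, which is the trace of its `k`-th
compound. -/
noncomputable def minorSum (M : Matrix X X ℝ) (k : ℕ) : ℝ :=
  ∑ s ∈ univ.powersetCard k, (M.submatrix (Subtype.val : s → X) (Subtype.val : s → X)).det

theorem det_submatrix_comp_perm {k : ℕ} (M : Matrix X X ℝ) (a b : Fin k → X) (s : Perm (Fin k)) :
    (M.submatrix a (b ∘ s)).det = (Perm.sign s : ℤ) * (M.submatrix a b).det := by
  have := det_permute' s (M.submatrix a b)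
  rw [← this]
  rfl

/-- Each principal minor is counted k! times. Tuples are preferred to sets because relabellings then
become plain reindexings of functions. -/
theorem sum_principal_minors (M : Matrix X X ℝ) (k : ℕ) :
    ∑ a : Fin k → X, (M.submatrix a a).det = (k.factorial : ℝ) * minorSum M k := by
  refine sum_tuples_eq _ _ ?_ ?_
  · intro a ha
    simp only [Function.Injective, not_forall] at ha
    obtain ⟨i, j, hij, hne⟩ := ha
    exact det_zero_of_row_eq hne (by ext l; simp [hij])
  · intro a ha
    let e' : Fin k ≃ (univ.image a : Finset X) :=
      Equiv.ofBijective (fun i => ⟨a i, mem_image_of_mem a (mem_univ i)⟩)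
        ⟨fun i j hij => ha (congrArg Subtype.val hij), by
          rintro ⟨x, hx⟩
          obtain ⟨i, -, hi⟩ := mem_image.mp hx
          exact ⟨i, Subtype.ext hi⟩⟩
    rw [← det_submatrix_equiv_self e' (M.submatrix Subtype.val Subtype.val)]
    rfl

/-- The Cauchy–Binet formula, with a sum over all tuples. -/
theorem sum_minor_mul_minor {k : ℕ} (M N : Matrix X X ℝ) (a c : Fin k → X) :
    ∑ b : Fin k → X, (M.submatrix a b).det * (N.submatrix b c).det
      = (k.factorial : ℝ) * ((M * N).submatrix a c).det := by
  have expand : ((M * N).submatrix a c).det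
      = ∑ b : Fin k → X, (M.submatrix a b).det * ∏ i, N (b i) (c i) := by
    simp only [det_apply', submatrix_apply, mul_apply, prod_univ_sum, Fintype.piFinset_univ,
      mul_sum, sum_mul]
    rw [sum_comm]
    refine sum_congr rfl fun b _ => sum_congr rfl fun s _ => ?_
    rw [prod_mul_distrib]
    ring
  -- Reindexing b by s, with the sign absorbed by the first minor, makes all terms of the Leibniz
  -- expansion of the second minor contribute equally; this is the factor k!.
  have key : ∀ s : Perm (Fin k), ∑ b : Fin k → X, (M.submatrix a b).det *
      ((Perm.sign s : ℤ) * ∏ i, N (b (s i)) (c i)) = ((M * N).submatrix a c).det := by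
    intro s
    rw [expand]
    refine Fintype.sum_equiv (Equiv.arrowCongr s.symm (Equiv.refl X)) _ _ fun b => ?_
    have : (Equiv.arrowCongr s.symm (Equiv.refl X)) b = b ∘ s := by
      ext i; simp [Equiv.arrowCongr]
    rw [this, det_submatrix_comp_perm]
    simp only [Function.comp_apply]
    ring
  calc _ = ∑ b : Fin k → X, ∑ s : Perm (Fin k), (M.submatrix a b).det *
        ((Perm.sign s : ℤ) * ∏ i, N (b (s i)) (c i)) := by
        refine sum_congr rfl fun b _ => ?_
        rw [det_apply' (N.submatrix b c), mul_sum]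
        rfl
    _ = ∑ s : Perm (Fin k), ((M * N).submatrix a c).det := by
        rw [sum_comm]
        exact sum_congr rfl fun s _ => key s
    _ = _ := by
        rw [sum_const, card_univ, Fintype.card_perm, Fintype.card_fin, nsmul_eq_mul]

end Minors

/-! ### Invariant alternating kernels, in the role of Schur's lemma -/

section Kernel

open Finset

variable {X : Type*} [Fintype X] [DecidableEq X] {k l : ℕ}

theorem eq_zero_of_alternating (T : (Fin k → X) → (Fin l → X) → ℝ)
    (alt : ∀ a b (s : Perm (Fin l)), T a (b ∘ s) = (Perm.sign s : ℤ) * T a b)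
    (a : Fin k → X) (b : Fin l → X) (hb : ¬ Function.Injective b) : T a b = 0 := by
  simp only [Function.Injective, not_forall] at hb
  obtain ⟨i, j, hij, hne⟩ := hb
  have h := alt a b (swap i j)
  have hc : b ∘ swap i j = b := by
    ext m
    simp only [Function.comp_apply, swap_apply_def]
    split_ifs with h1 h2
    · rw [h1, hij]
    · rw [h2, hij]
    · rfl
  rw [hc, Perm.sign_swap hne] at h
  push_cast at h
  linarith

/-- A kernel on tuples that is alternating, invariant under permutations and killed by summation
over an entry is determined by its values at the pairs `(a, b)` with `range b ⊆ range a`. -/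
theorem kernel_eq_zero (T : (Fin k → X) → (Fin l → X) → ℝ)
    (alt : ∀ a b (s : Perm (Fin l)), T a (b ∘ s) = (Perm.sign s : ℤ) * T a b)
    (inv : ∀ a b (g : Perm X), T (g ∘ a) (g ∘ b) = T a b)
    (hsum : ∀ a b (i : Fin l), ∑ x, T a (Function.update b i x) = 0)
    (h0 : ∀ a b, Function.Injective b → (∀ i, b i ∈ Set.range a) → T a b = 0)
    (a : Fin k → X) (b : Fin l → X) : T a b = 0 := by
  classical
  by_cases hb : Function.Injective b
  swap
  · exact eq_zero_of_alternating T alt a b hb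
  by_cases hr : ∀ i, b i ∈ Set.range a
  · exact h0 a b hb hr
  push Not at hr
  obtain ⟨i, hi⟩ := hr
  have fixa : ∀ x y, x ∉ Set.range a → y ∉ Set.range a → ⇑(swap x y) ∘ a = a := by
    intro x y hx hy
    ext m
    exact swap_apply_of_ne_of_ne (fun h => hx ⟨m, h⟩) (fun h => hy ⟨m, h⟩)
  -- If two entries of b lie outside the range of a, exchanging them fixes a and reverses the sign
  -- of `T a b`.
  by_cases hj : ∃ j, j ≠ i ∧ b j ∉ Set.range a
  · obtain ⟨j, hji, hj⟩ := hj
    have h1 := inv a b (swap (b i) (b j))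
    have hc : ⇑(swap (b i) (b j)) ∘ b = b ∘ ⇑(swap i j) := by
      ext m
      simp only [Function.comp_apply, swap_apply_def, hb.eq_iff]
      split_ifs <;> rfl
    rw [fixa _ _ hi hj, hc, alt, Perm.sign_swap (Ne.symm hji)] at h1
    push_cast at h1
    linarith
  · push Not at hj
    have hs := hsum a b i
    -- Now only entry i lies outside. Moving it into the range of a gives zero and moving it
    -- elsewhere gives `T a b` by invariance, so the vanishing sum is a positive multiple of `T a
    -- b`.
    have hterm : ∀ x, T a (Function.update b i x) = if x ∈ Set.range a then 0 else T a b := by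
      intro x
      split_ifs with hx
      · by_cases hu : Function.Injective (Function.update b i x)
        · refine h0 _ _ hu fun m => ?_
          by_cases hm : m = i
          · subst hm; simpa using hx
          · rw [Function.update_of_ne hm]; exact hj m hm
        · exact eq_zero_of_alternating T alt _ _ hu
      · have h1 := inv a b (swap (b i) x)
        rw [fixa _ _ hi hx] at h1
        rw [← h1]
        congr 1
        ext m
        by_cases hm : m = i
        · subst hm; simp
        · rw [Function.update_of_ne hm, Function.comp_apply, swap_apply_of_ne_of_ne]
          · exact fun h => hm (hb h)
          · intro h
            exact hx (h ▸ hj m hm)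
    simp only [hterm] at hs
    rw [sum_ite, sum_const_zero, zero_add, sum_const, nsmul_eq_mul] at hs
    rcases mul_eq_zero.mp hs with h | h
    · exfalso
      have : b i ∈ univ.filter fun x => x ∉ Set.range a := mem_filter.mpr ⟨mem_univ _, hi⟩
      rw [Nat.cast_eq_zero, card_eq_zero] at h
      rw [h] at this
      exact notMem_empty _ this
    · exact h

theorem exists_perm_comp_eq {a b : Fin k → X} (ha : Function.Injective a)
    (hb : Function.Injective b) : ∃ g : Perm X, g ∘ a = b := by
  classical
  let e : {x // x ∈ Set.range a} ≃ {x // x ∈ Set.range b} :=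
    (Equiv.ofInjective a ha).symm.trans (Equiv.ofInjective b hb)
  refine ⟨e.extendSubtype, ?_⟩
  ext i
  have := e.extendSubtype_apply_of_mem (a i) ⟨i, rfl⟩
  rw [Function.comp_apply, this]
  have h2 : (Equiv.ofInjective a ha).symm ⟨a i, ⟨i, rfl⟩⟩ = i := by
    rw [Equiv.symm_apply_eq]; rfl
  change ((Equiv.ofInjective b hb) ((Equiv.ofInjective a ha).symm ⟨a i, _⟩) : X) = b i
  rw [h2]
  rfl

/-- A square kernel as in `kernel_eq_zero` with trace zero vanishes. -/
theorem kernel_eq_zero_of_trace (T : (Fin k → X) → (Fin k → X) → ℝ)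
    (alt : ∀ a b (s : Perm (Fin k)), T a (b ∘ s) = (Perm.sign s : ℤ) * T a b)
    (inv : ∀ a b (g : Perm X), T (g ∘ a) (g ∘ b) = T a b)
    (hsum : ∀ a b (i : Fin k), ∑ x, T a (Function.update b i x) = 0)
    (htr : ∑ a, T a a = 0) (a b : Fin k → X) : T a b = 0 := by
  classical
  -- The injective tuples form one orbit, so the trace is a positive multiple of each diagonal
  -- value.
  have diag : ∀ c : Fin k → X, Function.Injective c → T c c = 0 := by
    intro c hc
    have hterm : ∀ a, T a a = if Function.Injective a then T c c else 0 := by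
      intro a
      split_ifs with ha
      · obtain ⟨g, rfl⟩ := exists_perm_comp_eq hc ha
        exact inv c c g
      · exact eq_zero_of_alternating T alt a a ha
    rw [sum_congr rfl fun a _ => hterm a, ← sum_filter, sum_const, nsmul_eq_mul] at htr
    rcases mul_eq_zero.mp htr with h | h
    · exfalso
      have : c ∈ univ.filter fun a : Fin k → X => Function.Injective a :=
        mem_filter.mpr ⟨mem_univ _, hc⟩
      rw [Nat.cast_eq_zero, card_eq_zero] at h
      rw [h] at this
      exact notMem_empty _ this
    · exact h
  refine kernel_eq_zero T alt inv hsum (fun a b hb hr => ?_) a b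
  -- Since the tuples have equal length, b is a rearrangement of a, and `T a b` is a diagonal value
  -- up to sign.
  choose s hs using hr
  have hsi : Function.Injective s := fun i j hij => hb (by rw [← hs i, ← hs j, hij])
  let s' : Perm (Fin k) := Equiv.ofBijective s (Finite.injective_iff_bijective.mp hsi)
  have hb' : b = a ∘ s' := by
    ext i; exact (hs i).symm
  have ha : Function.Injective a := by
    intro i j hij
    obtain ⟨i', rfl⟩ := s'.surjective i
    obtain ⟨j', rfl⟩ := s'.surjective j
    have : b i' = b j' := by rw [hb']; exact hij
    rw [hb this]
  rw [hb', alt, diag a ha, mul_zero]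

end Kernel

/-! ### Hook characters: convolution and orthogonality -/

section HookChar

open Finset Matrix

variable {X : Type*} [Fintype X] [DecidableEq X]

/-- The determinant is linear in its column i, and the columns of M add up to zero. -/
theorem sum_det_submatrix_update {k : ℕ} (M : Matrix X X ℝ) (hM : ∀ i, ∑ j, M i j = 0)
    (a b : Fin k → X) (i : Fin k) :
    ∑ x, (M.submatrix a (Function.update b i x)).det = 0 := by
  have h : ∀ x, (M.submatrix a (Function.update b i x)).det
      = (cramer (M.submatrix a b)) (fun r => M (a r) x) i := by
    intro x
    rw [cramer_apply]
    congr 1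
    ext r c
    by_cases hc : c = i
    · subst hc; simp
    · simp [updateCol_ne hc, Function.update_of_ne hc]
  rw [sum_congr rfl fun x _ => h x, ← Finset.sum_apply, ← map_sum]
  have : (∑ x, fun r => M (a r) x) = 0 := by
    ext r
    simp [hM]
  rw [this, map_zero]
  rfl

/-- The permutation matrix of `σ`, composed with the projection to the vectors of sum zero. -/
noncomputable def stdMat (σ : Perm X) : Matrix X X ℝ :=
  Matrix.of fun i j => (if i = σ j then 1 else 0) - 1 / (Fintype.card X : ℝ)

theorem stdMat_apply (σ : Perm X) (i j : X) :
    stdMat σ i j = (if i = σ j then 1 else 0) - 1 / (Fintype.card X : ℝ) := rfl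

theorem sum_stdMat_col (σ : Perm X) (j : X) : ∑ i, stdMat σ i j = 0 := by
  have : (Fintype.card X : ℝ) ≠ 0 := by
    have : 0 < Fintype.card X := Fintype.card_pos_iff.mpr ⟨j⟩
    positivity
  simp only [stdMat_apply, sum_sub_distrib, sum_ite_eq', sum_const, mem_univ, if_true, card_univ,
    nsmul_eq_mul]
  field_simp
  simp

theorem sum_stdMat_row (σ : Perm X) (i : X) : ∑ j, stdMat σ i j = 0 := by
  have h : ∀ j, stdMat σ i j = stdMat σ⁻¹ j i := by
    intro j
    simp only [stdMat_apply, Perm.eq_inv_iff_eq]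
    congr 1
    exact if_congr eq_comm rfl rfl
  rw [sum_congr rfl fun j _ => h j, sum_stdMat_col]

/-- The constant part of the second factor is killed by the vanishing row sums of the first. In
particular `stdMat 1` is the projection to the vectors of sum zero, not the identity matrix. -/
theorem stdMat_mul (σ τ : Perm X) : stdMat σ * stdMat τ = stdMat (σ * τ) := by
  ext i l
  have h : ∀ j, stdMat σ i j * stdMat τ j l
      = (if j = τ l then stdMat σ i j else 0) - stdMat σ i j * (1 / (Fintype.card X : ℝ)) := by
    intro j
    rw [stdMat_apply τ]
    split_ifs <;> ring
  rw [mul_apply, sum_congr rfl fun j _ => h j, sum_sub_distrib, ← sum_mul, sum_stdMat_row,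
    sum_ite_eq']
  simp only [mem_univ, if_true, zero_mul, sub_zero, stdMat_apply, Perm.mul_apply]
  congr

theorem stdMat_mul_left_apply (h g : Perm X) (i j : X) :
    stdMat (h * g) (h i) j = stdMat g i j := by
  simp [stdMat_apply]

theorem stdMat_conj_apply (g σ : Perm X) (i j : X) :
    stdMat (g * σ * g⁻¹) (g i) (g j) = stdMat σ i j := by
  simp [stdMat_apply]

/-- The character of the exterior power `Λ^k` of the standard representation of `Perm X`. -/
noncomputable def hookChar (k : ℕ) (σ : Perm X) : ℝ := minorSum (stdMat σ) k

theorem sum_det_stdMat (k : ℕ) (σ : Perm X) :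
    ∑ a : Fin k → X, ((stdMat σ).submatrix a a).det = (k.factorial : ℝ) * hookChar k σ :=
  sum_principal_minors _ _

theorem hookChar_conj (k : ℕ) (g σ : Perm X) : hookChar k (g * σ * g⁻¹) = hookChar k σ := by
  have h : (k.factorial : ℝ) * hookChar k (g * σ * g⁻¹) = (k.factorial : ℝ) * hookChar k σ := by
    rw [← sum_det_stdMat, ← sum_det_stdMat]
    refine (Fintype.sum_equiv (Equiv.arrowCongr (Equiv.refl _) g) _ _ fun a => ?_).symm
    congr 1
    ext i j
    exact (stdMat_conj_apply g σ (a i) (a j)).symm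
  exact mul_left_cancel₀ (by positivity) h

/-- Schur's lemma: averaging over a conjugacy class gives a scalar on Λ^k of the standard
representation, where `stdMat 1` acts as the identity; the trace identifies the scalar. The factor
`hookChar k 1` is not divided out because it vanishes for large k. -/
theorem sum_conj_det_stdMat (k : ℕ) (σ : Perm X) (a b : Fin k → X) :
    hookChar k (1 : Perm X) * ∑ g : Perm X, ((stdMat (g * σ * g⁻¹)).submatrix a b).det
      = (Fintype.card (Perm X) : ℝ) * hookChar k σ * ((stdMat 1).submatrix a b).det := by
  rw [← sub_eq_zero]
  refine kernel_eq_zero_of_trace (fun a b => hookChar k (1 : Perm X) *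
    ∑ g : Perm X, ((stdMat (g * σ * g⁻¹)).submatrix a b).det -
      (Fintype.card (Perm X) : ℝ) * hookChar k σ * ((stdMat 1).submatrix a b).det)
    ?_ ?_ ?_ ?_ a b
  · intro a b s
    simp only [det_submatrix_comp_perm, ← mul_sum]
    ring
  · intro a b h
    have e1 : ∑ g : Perm X, ((stdMat (g * σ * g⁻¹)).submatrix (h ∘ a) (h ∘ b)).det
        = ∑ g : Perm X, ((stdMat (g * σ * g⁻¹)).submatrix a b).det := by
      refine (Fintype.sum_equiv (Equiv.mulLeft h) _ _ fun g => ?_).symm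
      congr 1
      ext i j
      have := stdMat_conj_apply h (g * σ * g⁻¹) (a i) (b j)
      rw [submatrix_apply, submatrix_apply, ← this, Equiv.coe_mulLeft]
      simp only [Function.comp_apply, _root_.mul_inv_rev, mul_assoc]
    have e2 : (stdMat (1 : Perm X)).submatrix (h ∘ a) (h ∘ b) = (stdMat 1).submatrix a b := by
      ext i j
      have := stdMat_conj_apply h 1 (a i) (b j)
      rw [mul_one, mul_inv_cancel] at this
      exact this
    simp only [e1, e2]
  · intro a b i
    rw [sum_sub_distrib, ← mul_sum, ← mul_sum, sum_comm,
      sum_det_submatrix_update _ (sum_stdMat_row _),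
      sum_congr rfl fun g _ => sum_det_submatrix_update _ (sum_stdMat_row _) _ _ _]
    simp
  · rw [sum_sub_distrib, ← mul_sum, ← mul_sum, sum_comm, sum_det_stdMat,
      sum_congr rfl fun g _ => sum_det_stdMat k (g * σ * g⁻¹),
      sum_congr rfl fun g _ => by rw [hookChar_conj], sum_const, card_univ, nsmul_eq_mul]
    ring

/-- Cauchy–Binet writes the character of a product as a trace of a product of compound matrices, and
`sum_conj_det_stdMat` averages the second factor. -/
theorem sum_hookChar_mul_conj (k : ℕ) (π σ : Perm X) :
    hookChar k (1 : Perm X) * ∑ g : Perm X, hookChar k (π * (g * σ * g⁻¹))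
      = (Fintype.card (Perm X) : ℝ) * hookChar k π * hookChar k σ := by
  have hfac : ((k.factorial : ℝ) * (k.factorial : ℝ)) ≠ 0 := by positivity
  have expand : ∀ ρ : Perm X, (k.factorial : ℝ) * (k.factorial : ℝ) * hookChar k (π * ρ)
      = ∑ a : Fin k → X, ∑ b : Fin k → X,
        ((stdMat π).submatrix a b).det * ((stdMat ρ).submatrix b a).det := by
    intro ρ
    rw [mul_assoc, ← sum_det_stdMat, mul_sum]
    refine sum_congr rfl fun a _ => ?_
    rw [sum_minor_mul_minor, stdMat_mul]
  apply mul_left_cancel₀ hfac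
  calc _ = ∑ a : Fin k → X, ∑ b : Fin k → X, ((stdMat π).submatrix a b).det *
        (hookChar k (1 : Perm X) *
          ∑ g : Perm X, ((stdMat (g * σ * g⁻¹)).submatrix b a).det) := by
        rw [mul_left_comm, mul_sum _ _ ((k.factorial : ℝ) * (k.factorial : ℝ)),
          sum_congr rfl fun g _ => expand (g * σ * g⁻¹), sum_comm, mul_sum]
        refine sum_congr rfl fun a _ => ?_
        rw [sum_comm, mul_sum]
        refine sum_congr rfl fun b _ => ?_
        rw [← mul_sum]
        ring
    _ = (Fintype.card (Perm X) : ℝ) * hookChar k σ * ∑ a : Fin k → X, ∑ b : Fin k → X,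
        ((stdMat π).submatrix a b).det * ((stdMat 1).submatrix b a).det := by
        rw [mul_sum]
        refine sum_congr rfl fun a _ => ?_
        rw [mul_sum]
        refine sum_congr rfl fun b _ => ?_
        rw [sum_conj_det_stdMat]
        ring
    _ = _ := by
        rw [← expand, mul_one]
        ring

/-- Orthogonality already holds for matrix coefficients: they form an invariant kernel, and l
distinct entries cannot lie in the range of a k-tuple, so the base case of `kernel_eq_zero` is
empty. -/
theorem sum_hookChar_mul_hookChar_of_lt {k l : ℕ} (hkl : k < l) :
    ∑ g : Perm X, hookChar k g * hookChar l g = 0 := by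
  -- The transpose puts b in the column position, where left multiplication of g acts on both a and
  -- b and minors alternate in b.
  have key : ∀ (c : Fin k → X) (c' : Fin l → X) (a : Fin k → X) (b : Fin l → X),
      ∑ g : Perm X, ((stdMat g).submatrix a c).det * ((stdMat g)ᵀ.submatrix c' b).det = 0 := by
    intro c c'
    refine kernel_eq_zero _ ?_ ?_ ?_ ?_
    · intro a b s
      simp only [det_submatrix_comp_perm, mul_sum]
      refine sum_congr rfl fun g _ => by ring
    · intro a b h
      refine (Fintype.sum_equiv (Equiv.mulLeft h) _ _ fun g => ?_).symm
      congr 2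
      · ext i j
        exact (stdMat_mul_left_apply h g (a i) (c j)).symm
      · ext i j
        exact (stdMat_mul_left_apply h g (b j) (c' i)).symm
    · intro a b i
      rw [sum_comm]
      refine sum_eq_zero fun g _ => ?_
      rw [← mul_sum, sum_det_submatrix_update (stdMat g)ᵀ (fun i => sum_stdMat_col g i), mul_zero]
    · intro a b hb hr
      exfalso
      choose s hs using hr
      have hsi : Function.Injective s := fun i j hij => hb (by rw [← hs i, ← hs j, hij])
      have := Fintype.card_le_of_injective s hsi
      simp only [Fintype.card_fin] at this
      omega
  have hfac : ((k.factorial : ℝ) * (l.factorial : ℝ)) ≠ 0 := by positivity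
  apply mul_left_cancel₀ hfac
  calc _ = ∑ g : Perm X, (∑ a : Fin k → X, ((stdMat g).submatrix a a).det) *
        ∑ b : Fin l → X, ((stdMat g).submatrix b b).det := by
        rw [mul_sum]
        refine sum_congr rfl fun g _ => ?_
        rw [sum_det_stdMat, sum_det_stdMat]
        ring
    _ = ∑ a : Fin k → X, ∑ b : Fin l → X, ∑ g : Perm X,
        ((stdMat g).submatrix a a).det * ((stdMat g).submatrix b b).det := by
        simp only [sum_mul_sum]
        rw [sum_comm]
        refine sum_congr rfl fun a _ => ?_
        rw [sum_comm]
    _ = ((k.factorial : ℝ) * (l.factorial : ℝ)) * 0 := by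
        rw [mul_zero]
        refine sum_eq_zero fun a _ => sum_eq_zero fun b _ => ?_
        rw [← key a b a b]
        refine sum_congr rfl fun g _ => ?_
        rw [← det_transpose ((stdMat g).submatrix b b)]
        rfl

end HookChar

/-! ### Hook characters through the permutation representation and invariant sets -/

section PermChar

open Finset Matrix Polynomial

variable {X : Type*} [Fintype X] [DecidableEq X]

/-- The permutation matrix of `σ`, sending the basis vector at `j` to that at `σ j`. -/
noncomputable def permMat (σ : Perm X) : Matrix X X ℝ :=
  Matrix.of fun i j => if i = σ j then 1 else 0

theorem det_permMat (σ : Perm X) : (permMat σ).det = (Perm.sign σ : ℤ) := by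
  have : permMat σ = σ⁻¹.permMatrix ℝ := by
    ext i j
    simp only [permMat, of_apply, PEquiv.toMatrix_apply, toPEquiv_apply, Option.mem_some_iff,
      Perm.inv_eq_iff_eq]
  rw [this, det_permutation, Perm.sign_inv]

/-- The character of the exterior power `Λ^k` of the permutation representation of `Perm X`. -/
noncomputable def permChar (k : ℕ) (σ : Perm X) : ℝ := minorSum (permMat σ) k

/-- The number of invariant sets of size `k`. -/
def invCount (k : ℕ) (σ : Perm X) : ℕ :=
  ((univ.powersetCard k).filter fun s : Finset X => ∀ x ∈ s, σ x ∈ s).card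

/-- On an invariant set the submatrix is again a permutation matrix; otherwise a point that leaves
the set gives a zero column. -/
theorem abs_det_permMat_submatrix_le (σ : Perm X) (s : Finset X) :
    |((permMat σ).submatrix (Subtype.val : s → X) (Subtype.val : s → X)).det|
      ≤ if ∀ x ∈ s, σ x ∈ s then 1 else 0 := by
  split_ifs with h
  · let f : s → s := fun x => ⟨σ x, h x x.2⟩
    have hf : Function.Injective f := fun x y hxy =>
      Subtype.ext (σ.injective (congrArg Subtype.val hxy))
    let ρ : Perm s := Equiv.ofBijective f (Finite.injective_iff_bijective.mp hf)
    have : (permMat σ).submatrix (Subtype.val : s → X) (Subtype.val : s → X) = permMat ρ := by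
      ext i j
      simp only [permMat, submatrix_apply, of_apply, Subtype.ext_iff]
      rfl
    rw [this, det_permMat]
    rcases Int.units_eq_one_or (Perm.sign ρ) with h | h <;> simp [h]
  · push Not at h
    obtain ⟨x, hx, hσ⟩ := h
    rw [det_eq_zero_of_column_eq_zero ⟨x, hx⟩, abs_zero]
    intro i
    have : (i : X) ≠ σ x := fun h => hσ (h ▸ i.2)
    simp [permMat, this]

theorem abs_permChar_le (k : ℕ) (σ : Perm X) : |permChar k σ| ≤ invCount k σ := by
  refine (abs_sum_le_sum_abs _ _).trans ((sum_le_sum fun s _ =>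
    abs_det_permMat_submatrix_le σ s).trans ?_)
  rw [sum_boole, invCount]

theorem minorSum_zero (M : Matrix X X ℝ) : minorSum M 0 = 1 := by
  simp [minorSum]

theorem minorSum_eq_zero {M : Matrix X X ℝ} {k : ℕ} (h : Fintype.card X < k) :
    minorSum M k = 0 := by
  rw [minorSum, powersetCard_eq_empty.mpr (by simpa using h), sum_empty]

theorem minorSum_card (M : Matrix X X ℝ) : minorSum M (Fintype.card X) = M.det := by
  rw [minorSum, ← card_univ, powersetCard_self, sum_singleton]
  exact det_submatrix_equiv_self (Equiv.subtypeUnivEquiv mem_univ) M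

/-- The permutation representation is the standard one plus the trivial one. With J the averaging
matrix, `permMat σ = stdMat σ + J` and `stdMat σ * J = 0`, so the matrix factors, and the rank-one J
contributes 1 + X. -/
theorem det_one_add_X_permMat [Nonempty X] (σ : Perm X) :
    det (1 + (Polynomial.X : ℝ[X]) • (permMat σ).map C)
      = (1 + (Polynomial.X : ℝ[X])) * det (1 + (Polynomial.X : ℝ[X]) • (stdMat σ).map C) := by
  have hd : (Fintype.card X : ℝ) ≠ 0 := by positivity
  let J : Matrix X X ℝ := Matrix.of fun _ _ => 1 / (Fintype.card X : ℝ)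
  have h1 : permMat σ = stdMat σ + J := by
    ext i j
    simp only [permMat, J, Matrix.add_apply, of_apply, stdMat_apply]
    ring
  have h2 : stdMat σ * J = 0 := by
    ext i j
    rw [mul_apply]
    simp only [J, of_apply]
    rw [← sum_mul, sum_stdMat_row, zero_mul]
    rfl
  have h3 : (1 + (Polynomial.X : ℝ[X]) • (stdMat σ).map C) * (1 + (Polynomial.X : ℝ[X]) • J.map C)
      = 1 + (Polynomial.X : ℝ[X]) • (permMat σ).map C := by
    have h4 : (stdMat σ).map C * J.map C = (0 : Matrix X X ℝ[X]) := by
      rw [← Matrix.map_mul, h2]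
      ext i j
      simp
    have h5 : (permMat σ).map C = (stdMat σ).map C + J.map C := by
      rw [h1]
      ext i j
      simp
    rw [h5, mul_add, add_mul, add_mul, smul_mul_smul_comm, h4]
    simp only [one_mul, mul_one, smul_zero, add_zero, smul_add]
    abel
  have h6 : det (1 + (Polynomial.X : ℝ[X]) • J.map C) = 1 + (Polynomial.X : ℝ[X]) := by
    have h7 : (Polynomial.X : ℝ[X]) • J.map C = replicateCol Unit (fun _ : X => (Polynomial.X : ℝ[X])) *
        replicateRow Unit (fun _ : X => C (1 / (Fintype.card X : ℝ))) := by
      ext1 i j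
      simp [mul_apply, J]
    rw [h7, det_one_add_replicateCol_mul_replicateRow]
    simp only [dotProduct, sum_const, card_univ, nsmul_eq_mul]
    congr 1
    rw [← mul_assoc, ← C_eq_natCast, ← C_mul, mul_one_div_cancel hd, C_1, one_mul]
  rw [← h3, det_mul, h6, mul_comm]

theorem hookChar_zero (σ : Perm X) : hookChar 0 σ = 1 := minorSum_zero _

theorem permChar_zero (σ : Perm X) : permChar 0 σ = 1 := minorSum_zero _

/-- Comparison of coefficients, the character form of Λ^(k+1)(V ⊕ 1) = Λ^(k+1) V ⊕ Λ^k V. -/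
theorem permChar_succ [Nonempty X] (k : ℕ) (σ : Perm X) :
    permChar (k + 1) σ = hookChar (k + 1) σ + hookChar k σ := by
  have h := congrArg (fun p => p.coeff (k + 1)) (det_one_add_X_permMat σ)
  simp only [add_mul, one_mul, coeff_add, coeff_X_mul,
    coeff_det_one_add_X_smul_eq_sum_minors] at h
  exact h

theorem hookChar_eq_zero [Nonempty X] {k : ℕ} (σ : Perm X) (hk : Fintype.card X ≤ k) :
    hookChar k σ = 0 := by
  have h := permChar_succ k σ
  rw [permChar, hookChar, minorSum_eq_zero (by omega), minorSum_eq_zero (by omega)] at h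
  linarith

theorem hookChar_card_sub_one [Nonempty X] (σ : Perm X) :
    hookChar (Fintype.card X - 1) σ = (Perm.sign σ : ℤ) := by
  have hd : 0 < Fintype.card X := Fintype.card_pos
  have h := permChar_succ (Fintype.card X - 1) σ
  rw [Nat.sub_add_cancel hd, hookChar_eq_zero σ le_rfl, permChar, minorSum_card, det_permMat] at h
  linarith

theorem permChar_one (k : ℕ) : permChar k (1 : Perm X) = ((Fintype.card X).choose k : ℝ) := by
  have h : permMat (1 : Perm X) = 1 := by
    ext i j
    simp only [permMat, of_apply, Perm.one_apply, one_apply]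
    congr
  rw [permChar, h, minorSum, sum_congr rfl (g := fun _ => (1 : ℝ)), sum_const,
    card_powersetCard, card_univ, nsmul_eq_mul, mul_one]
  intro s _
  rw [submatrix_one _ Subtype.val_injective, det_one]

theorem hookChar_one [Nonempty X] (k : ℕ) :
    hookChar k (1 : Perm X) = ((Fintype.card X - 1).choose k : ℝ) := by
  have hd : 0 < Fintype.card X := Fintype.card_pos
  induction k with
  | zero => simp [hookChar_zero]
  | succ k ih =>
    have h := permChar_succ k (1 : Perm X)
    have hp := Nat.choose_succ_succ (Fintype.card X - 1) k
    rw [Nat.succ_eq_add_one, Nat.sub_add_cancel hd, Nat.succ_eq_add_one] at hp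
    rw [permChar_one, ih, hp] at h
    push_cast at h
    linarith

/-- Unrolling `permChar_succ` makes `hookChar k` an alternating sum of the `permChar j` with j ≤ k.
-/
theorem abs_hookChar_le [Nonempty X] (k : ℕ) (σ : Perm X) :
    |hookChar k σ| ≤ ∑ j ∈ range (k + 1), (invCount j σ : ℝ) := by
  induction k with
  | zero =>
    rw [hookChar_zero, ← permChar_zero σ]
    simpa using abs_permChar_le 0 σ
  | succ k ih =>
    rw [sum_range_succ, eq_sub_of_add_eq (permChar_succ k σ).symm]
    have h1 := abs_permChar_le (k + 1) σ
    have h2 := abs_sub (permChar (k + 1) σ) (hookChar k σ)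
    linarith

theorem invCount_compl {j k : ℕ} (h : j + k = Fintype.card X) (σ : Perm X) :
    invCount j σ = invCount k σ := by
  have hle : ∀ {j k : ℕ}, j + k = Fintype.card X → invCount j σ ≤ invCount k σ := by
    intro j k h
    refine card_le_card_of_injOn (fun s => sᶜ) ?_ (fun s _ t _ hst => compl_injective hst)
    intro s hs
    have hs := mem_coe.mp hs
    rw [mem_filter, mem_powersetCard] at hs
    refine mem_coe.mpr (mem_filter.mpr ⟨mem_powersetCard.mpr ⟨subset_univ _, ?_⟩, ?_⟩)
    · rw [card_compl, hs.1.2]; omega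
    · intro x hx
      rw [mem_compl] at hx ⊢
      intro hσ
      have himg : s.image σ = s := by
        refine eq_of_subset_of_card_le ?_ ?_
        · intro y hy
          obtain ⟨z, hz, rfl⟩ := mem_image.mp hy
          exact hs.2 z hz
        · rw [card_image_of_injective _ σ.injective]
      rw [← himg] at hσ
      obtain ⟨z, hz, hzx⟩ := mem_image.mp hσ
      exact hx (σ.injective hzx ▸ hz)
  exact le_antisymm (hle h) (hle (by omega))

/-- The same recursion run downwards from k = |X|, where the hook character vanishes, with invariant
sets replaced by their complements. This is the useful bound for k above |X| / 2. -/
theorem abs_hookChar_le' [Nonempty X] (i : ℕ) (hi : i ≤ Fintype.card X) (σ : Perm X) :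
    |hookChar (Fintype.card X - i) σ| ≤ ∑ j ∈ range i, (invCount j σ : ℝ) := by
  induction i with
  | zero => simp [hookChar_eq_zero σ le_rfl]
  | succ i ih =>
    have ih := ih (by omega)
    have h := permChar_succ (Fintype.card X - (i + 1)) σ
    rw [show Fintype.card X - (i + 1) + 1 = Fintype.card X - i by omega] at h
    rw [sum_range_succ, eq_sub_of_add_eq' h.symm]
    have h1 := abs_permChar_le (Fintype.card X - i) σ
    rw [invCount_compl (k := i) (by omega)] at h1
    have h2 := abs_sub (permChar (Fintype.card X - i) σ) (hookChar (Fintype.card X - i) σ)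
    linarith

/-- A permutation with a single cycle, whose support is everything. -/
def IsFullCycle (R : Perm X) : Prop := ∀ x y, R.SameCycle x y

theorem sameCycle_mem_of_invariant {σ : Perm X} {s : Finset X} (hs : ∀ x ∈ s, σ x ∈ s) {x y : X}
    (h : σ.SameCycle x y) (hx : x ∈ s) : y ∈ s := by
  obtain ⟨k, -, -, rfl⟩ := Perm.SameCycle.exists_pow_eq'' h
  induction k with
  | zero => exact hx
  | succ k ih => rw [pow_succ', Perm.mul_apply]; exact hs _ (ih ⟨k, by simp⟩)

theorem invCount_of_isFullCycle {R : Perm X} (hR : IsFullCycle R) {k : ℕ} (h0 : 0 < k)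
    (hk : k < Fintype.card X) : invCount k R = 0 := by
  rw [invCount, card_eq_zero, filter_eq_empty_iff]
  intro s hs hinv
  have hc := (mem_powersetCard.mp hs).2
  obtain ⟨x, hx⟩ := card_pos.mp (hc ▸ h0)
  have : s = univ := eq_univ_of_forall fun y => sameCycle_mem_of_invariant hinv (hR x y) hx
  rw [this, card_univ] at hc
  omega

/-- A full cycle has no proper nonempty invariant set, so `permChar` vanishes in between and
consecutive hook characters are opposite. -/
theorem hookChar_of_isFullCycle [Nonempty X] {R : Perm X} (hR : IsFullCycle R) {k : ℕ}
    (hk : k < Fintype.card X) : hookChar k R = (-1) ^ k := by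
  induction k with
  | zero => simp [hookChar_zero]
  | succ k ih =>
    have h1 := permChar_succ k R
    have h2 := abs_permChar_le (k + 1) R
    rw [invCount_of_isFullCycle hR (Nat.succ_pos k) hk, Nat.cast_zero] at h2
    rw [abs_nonpos_iff.mp h2, ih (by omega)] at h1
    rw [pow_succ]
    linarith

/-- The hook characters are the coefficients of det (1 + X • stdMat σ), which is evaluated at -1. -/
theorem alternating_sum_hookChar_eq_det [Nonempty X] (σ : Perm X) :
    ∑ k ∈ range (Fintype.card X), (-1) ^ k * hookChar k σ = det (1 - stdMat σ) := by
  let p : ℝ[X] := det (1 + (Polynomial.X : ℝ[X]) • (stdMat σ).map C)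
  have hc : ∀ k, p.coeff k = hookChar k σ := fun k =>
    coeff_det_one_add_X_smul_eq_sum_minors _ _
  have hdeg : p.natDegree < Fintype.card X := by
    by_contra h
    push Not at h
    have h0 : p.coeff p.natDegree = 0 := by rw [hc, hookChar_eq_zero σ h]
    have hp : p = 0 := by simpa using h0
    have h1 : p.coeff 0 = 1 := by rw [hc, hookChar_zero]
    rw [hp] at h1
    simp at h1
  have he : p.eval (-1) = det (1 - stdMat σ) := by
    change evalRingHom (-1 : ℝ) p = _
    rw [RingHom.map_det]
    congr 1
    ext i j
    simp [one_apply, sub_eq_add_neg]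
    split_ifs <;> simp
  rw [← he, eval_eq_sum_range' hdeg]
  refine sum_congr rfl fun k _ => ?_
  rw [hc, mul_comm]

/-- If σ has more than one cycle, the centred indicator of one of them is a nonzero fixed vector of
sum zero, so the determinant vanishes. Thus the indicator of the full cycles involves hook
characters only. -/
theorem alternating_sum_hookChar [Nonempty X] (σ : Perm X) [Decidable (IsFullCycle σ)] :
    ∑ k ∈ range (Fintype.card X), (-1) ^ k * hookChar k σ
      = if IsFullCycle σ then (Fintype.card X : ℝ) else 0 := by
  classical
  split_ifs with h
  · rw [sum_congr rfl (g := fun _ => (1 : ℝ))]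
    · simp
    · intro k hk
      rw [hookChar_of_isFullCycle h (mem_range.mp hk), ← mul_pow]
      simp
  · rw [alternating_sum_hookChar_eq_det]
    simp only [IsFullCycle, not_forall] at h
    obtain ⟨x, y, hxy⟩ := h
    have hd : (Fintype.card X : ℝ) ≠ 0 := by positivity
    let t : ℝ := (univ.filter fun z => σ.SameCycle x z).card
    let u : X → ℝ := fun z => (if σ.SameCycle x z then 1 else 0) - t / Fintype.card X
    have hu : ∑ z, u z = 0 := by
      simp only [u, sum_sub_distrib, sum_boole, sum_const, card_univ, nsmul_eq_mul, t]
      field_simp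
      simp
    rw [← exists_mulVec_eq_zero_iff]
    refine ⟨u, fun h0 => ?_, ?_⟩
    · have hx := congrFun h0 x
      have hy := congrFun h0 y
      simp only [u, Perm.SameCycle.refl, if_true, if_neg hxy, Pi.zero_apply] at hx hy
      linarith
    · ext i
      rw [sub_mulVec, one_mulVec, Pi.sub_apply, Pi.zero_apply, sub_eq_zero, mulVec, dotProduct]
      simp only [stdMat_apply, sub_mul, sum_sub_distrib, ← mul_sum, hu, mul_zero, sub_zero]
      rw [sum_eq_single (σ⁻¹ i)]
      · simp [u]
      · intro j _ hj
        rw [if_neg, zero_mul]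
        rintro rfl
        simp at hj
      · simp

end PermChar

/-! ### Products with a random full cycle and their L² distance from uniform -/

section Mixing

open Finset

variable {X : Type*} [Fintype X] [DecidableEq X]

theorem IsFullCycle.conj {R : Perm X} (hR : IsFullCycle R) (g : Perm X) :
    IsFullCycle (g * R * g⁻¹) := fun x y => by
  rw [Perm.sameCycle_conj]
  exact hR _ _

theorem IsFullCycle.apply_ne [Nontrivial X] {R : Perm X} (hR : IsFullCycle R) (x : X) :
    R x ≠ x := by
  intro h
  obtain ⟨y, hy⟩ := exists_ne x
  exact hy ((hR x y).eq_of_left h).symm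

theorem IsFullCycle.isCycle [Nontrivial X] {R : Perm X} (hR : IsFullCycle R) : R.IsCycle := by
  obtain ⟨x⟩ := (inferInstance : Nonempty X)
  exact ⟨x, hR.apply_ne x, fun y _ => hR x y⟩

theorem IsFullCycle.support_eq [Nontrivial X] {R : Perm X} (hR : IsFullCycle R) :
    R.support = univ := by
  ext x
  simp [hR.apply_ne x]

theorem IsFullCycle.sign_eq [Nontrivial X] {R : Perm X} (hR : IsFullCycle R) :
    ((Perm.sign R : ℤ) : ℝ) = (-1) ^ (Fintype.card X - 1) := by
  rw [hR.isCycle.sign, hR.support_eq, card_univ]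
  have : Fintype.card X = Fintype.card X - 1 + 1 := (Nat.sub_add_cancel Fintype.card_pos).symm
  rw [this, pow_succ]
  simp

theorem IsFullCycle.exists_conj_eq [Nontrivial X] {R R' : Perm X} (hR : IsFullCycle R)
    (hR' : IsFullCycle R') : ∃ g : Perm X, g * R * g⁻¹ = R' :=
  isConj_iff.mp (hR.isCycle.isConj hR'.isCycle (by rw [hR.support_eq, hR'.support_eq]))

theorem sum_hookChar_mul_hookChar_of_ne {k l : ℕ} (hkl : k ≠ l) :
    ∑ g : Perm X, hookChar k g * hookChar l g = 0 := by
  rcases lt_or_gt_of_ne hkl with h | h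
  · exact sum_hookChar_mul_hookChar_of_lt h
  · rw [← sum_hookChar_mul_hookChar_of_lt (X := X) h]
    exact sum_congr rfl fun g _ => mul_comm _ _

/-- `|X|` times the indicator function of the full cycles. -/
noncomputable def cycleWeight (π : Perm X) : ℝ :=
  ∑ k ∈ range (Fintype.card X), (-1) ^ k * hookChar k π

open Classical in
theorem cycleWeight_eq [Nonempty X] (π : Perm X) :
    cycleWeight π = if IsFullCycle π then (Fintype.card X : ℝ) else 0 :=
  alternating_sum_hookChar π

theorem sum_cycleWeight_mul_hookChar {k : ℕ} (hk : k < Fintype.card X) :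
    ∑ π : Perm X, cycleWeight π * hookChar k π
      = (-1) ^ k * ∑ π : Perm X, hookChar k π * hookChar k π := by
  simp only [cycleWeight, sum_mul]
  rw [sum_comm, sum_eq_single k]
  · rw [mul_sum]
    exact sum_congr rfl fun π _ => by ring
  · intro j _ hj
    rw [← mul_zero ((-1 : ℝ) ^ j), ← sum_hookChar_mul_hookChar_of_ne (X := X) hj, mul_sum]
    exact sum_congr rfl fun π _ => by ring
  · intro h
    exact absurd (mem_range.mpr hk) h

theorem sum_cycleWeight [Nonempty X] :
    ∑ π : Perm X, cycleWeight π = (Fintype.card (Perm X) : ℝ) := by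
  have h := sum_cycleWeight_mul_hookChar (X := X) (k := 0) Fintype.card_pos
  simpa [hookChar_zero] using h

/-- The inner product of `cycleWeight` with `hookChar k` is computed twice: by orthogonality it is
(-1)^k times the norm, and by the values on full cycles it is (-1)^k times the group order. -/
theorem sum_hookChar_sq [Nonempty X] {k : ℕ} (hk : k < Fintype.card X) :
    ∑ π : Perm X, hookChar k π * hookChar k π = (Fintype.card (Perm X) : ℝ) := by
  classical
  have h1 := sum_cycleWeight_mul_hookChar hk
  have h2 : ∑ π : Perm X, cycleWeight π * hookChar k π
      = ∑ π : Perm X, (-1) ^ k * cycleWeight π := by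
    refine sum_congr rfl fun π _ => ?_
    by_cases hπ : IsFullCycle π
    · rw [hookChar_of_isFullCycle hπ hk, mul_comm]
    · simp [cycleWeight_eq, hπ]
  rw [h2, ← mul_sum, sum_cycleWeight] at h1
  exact (mul_left_cancel₀ (pow_ne_zero k (by norm_num)) h1).symm

open Classical in
/-- Averaging over the conjugates of a full cycle is averaging over all full cycles. -/
theorem card_mul_sum_conj [Nontrivial X] {R : Perm X} (hR : IsFullCycle R) (F : Perm X → ℝ) :
    ((univ.filter fun C : Perm X => IsFullCycle C).card : ℝ) * ∑ h : Perm X, F (h * R * h⁻¹)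
      = (Fintype.card (Perm X) : ℝ) * ∑ C ∈ univ.filter (fun C : Perm X => IsFullCycle C), F C := by
  have h1 : ∀ C ∈ univ.filter (fun C : Perm X => IsFullCycle C),
      ∑ h : Perm X, F (h * C * h⁻¹) = ∑ h : Perm X, F (h * R * h⁻¹) := by
    intro C hC
    obtain ⟨g, rfl⟩ := hR.exists_conj_eq (mem_filter.mp hC).2
    refine Fintype.sum_equiv (Equiv.mulRight g) _ _ fun h => ?_
    simp only [Equiv.coe_mulRight]
    group
  have h2 : ∀ h : Perm X, ∑ C ∈ univ.filter (fun C : Perm X => IsFullCycle C), F (h * C * h⁻¹)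
      = ∑ C ∈ univ.filter (fun C : Perm X => IsFullCycle C), F C := by
    intro h
    refine sum_bij (fun C _ => h * C * h⁻¹) ?_ ?_ ?_ ?_
    · intro C hC
      exact mem_filter.mpr ⟨mem_univ _, (mem_filter.mp hC).2.conj h⟩
    · intro C _ C' _ hCC
      exact mul_left_cancel (mul_right_cancel hCC)
    · intro C hC
      refine ⟨h⁻¹ * C * h⁻¹⁻¹, mem_filter.mpr ⟨mem_univ _, (mem_filter.mp hC).2.conj _⟩, ?_⟩
      group
    · intro C _
      rfl
  calc _ = ∑ C ∈ univ.filter (fun C : Perm X => IsFullCycle C), ∑ h : Perm X, F (h * C * h⁻¹) := by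
        rw [sum_congr rfl h1, sum_const, nsmul_eq_mul]
    _ = ∑ h : Perm X, ∑ C ∈ univ.filter (fun C : Perm X => IsFullCycle C), F C := by
        rw [sum_comm, sum_congr rfl fun h _ => h2 h]
    _ = _ := by rw [sum_const, card_univ, nsmul_eq_mul]

/-- The full cycles form one conjugacy class, and |X| times its size is the group order. -/
theorem sum_conj_fullCycle [Nontrivial X] {R : Perm X} (hR : IsFullCycle R) (F : Perm X → ℝ) :
    ∑ h : Perm X, F (h * R * h⁻¹) = ∑ π : Perm X, cycleWeight π * F π := by
  classical
  have h1 := card_mul_sum_conj hR F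
  have h2 : ∑ π : Perm X, cycleWeight π * F π
      = (Fintype.card X : ℝ) * ∑ C ∈ univ.filter (fun C : Perm X => IsFullCycle C), F C := by
    rw [sum_filter, mul_sum]
    refine sum_congr rfl fun π _ => ?_
    rw [cycleWeight_eq]
    split_ifs <;> simp
  have h3 : (Fintype.card (Perm X) : ℝ)
      = (Fintype.card X : ℝ) * ((univ.filter fun C : Perm X => IsFullCycle C).card : ℝ) := by
    rw [← sum_cycleWeight, sum_congr rfl fun π _ => cycleWeight_eq π, ← sum_filter, sum_const,
      nsmul_eq_mul, mul_comm]
  have h4 : ((univ.filter fun C : Perm X => IsFullCycle C).card : ℝ) ≠ 0 := by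
    have : R ∈ univ.filter fun C : Perm X => IsFullCycle C := mem_filter.mpr ⟨mem_univ _, hR⟩
    exact_mod_cast (card_pos.mpr ⟨R, this⟩).ne'
  rw [h2]
  apply mul_left_cancel₀ h4
  rw [h1, h3]
  ring

/-- The law of a product of a random conjugate of `σ` and a random full cycle. -/
noncomputable def mixDist (σ τ : Perm X) : ℝ :=
  (1 / (Fintype.card (Perm X) : ℝ)) * ∑ k ∈ range (Fintype.card X),
    (-1) ^ k * (hookChar k σ⁻¹ / ((Fintype.card X - 1).choose k : ℝ)) * hookChar k τ

/-- For fixed g the sum over h is `cycleWeight (σ⁻¹ * (g * τ * g⁻¹))`. Averaging over g then splits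
each hook character by `sum_hookChar_mul_conj`. -/
theorem sum_sum_indicator_eq_mixDist [Nontrivial X] {R : Perm X} (hR : IsFullCycle R)
    (σ τ : Perm X) :
    ∑ g : Perm X, ∑ h : Perm X, (if σ * (h * R * h⁻¹) = g * τ * g⁻¹ then (1 : ℝ) else 0)
      = (Fintype.card (Perm X) : ℝ) ^ 2 * mixDist σ τ := by
  have h1 : ∀ g : Perm X,
      ∑ h : Perm X, (if σ * (h * R * h⁻¹) = g * τ * g⁻¹ then (1 : ℝ) else 0)
        = cycleWeight (σ⁻¹ * (g * τ * g⁻¹)) := by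
    intro g
    rw [sum_conj_fullCycle hR fun π => if σ * π = g * τ * g⁻¹ then (1 : ℝ) else 0,
      sum_eq_single (σ⁻¹ * (g * τ * g⁻¹))]
    · simp
    · intro π _ hπ
      rw [if_neg, mul_zero]
      intro h
      exact hπ (by rw [← h]; simp)
    · simp
  have hN : (Fintype.card (Perm X) : ℝ) ≠ 0 := by positivity
  rw [sum_congr rfl fun g _ => h1 g]
  simp only [cycleWeight, mixDist]
  rw [sum_comm, pow_two, ← mul_assoc, mul_assoc _ _ (1 / _), mul_one_div_cancel hN, mul_one,
    mul_sum]
  refine sum_congr rfl fun k hk => ?_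
  have hk' := mem_range.mp hk
  have hc : ((Fintype.card X - 1).choose k : ℝ) ≠ 0 := by
    exact_mod_cast (Nat.choose_pos (by omega)).ne'
  have h2 := sum_hookChar_mul_conj k σ⁻¹ τ
  rw [hookChar_one] at h2
  rw [← mul_sum]
  field_simp
  rw [mul_comm, h2]

theorem mixDist_nonneg [Nontrivial X] {R : Perm X} (hR : IsFullCycle R) (σ τ : Perm X) :
    0 ≤ mixDist σ τ := by
  have h := sum_sum_indicator_eq_mixDist hR σ τ
  have h0 : 0 ≤ (Fintype.card (Perm X) : ℝ) ^ 2 * mixDist σ τ := by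
    rw [← h]
    exact sum_nonneg fun g _ => sum_nonneg fun h _ => by split_ifs <;> simp
  exact nonneg_of_mul_nonneg_right h0 (by positivity)

theorem sum_mixDist [Nontrivial X] {R : Perm X} (hR : IsFullCycle R) (σ : Perm X) :
    ∑ τ, mixDist σ τ = 1 := by
  have hN : (Fintype.card (Perm X) : ℝ) ^ 2 ≠ 0 := by positivity
  apply mul_left_cancel₀ hN
  rw [mul_sum, sum_congr rfl fun τ _ => (sum_sum_indicator_eq_mixDist hR σ τ).symm, sum_comm]
  have h1 : ∀ g : Perm X, ∑ τ : Perm X, ∑ h : Perm X,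
      (if σ * (h * R * h⁻¹) = g * τ * g⁻¹ then (1 : ℝ) else 0) = Fintype.card (Perm X) := by
    intro g
    rw [sum_comm, sum_congr rfl (g := fun _ => (1 : ℝ))]
    · simp
    · intro h _
      rw [sum_eq_single (g⁻¹ * (σ * (h * R * h⁻¹)) * g)]
      · rw [if_pos]; group
      · intro τ _ hτ
        rw [if_neg]
        intro h'
        apply hτ
        rw [h']
        group
      · simp
  rw [sum_congr rfl fun g _ => h1 g, sum_const, card_univ, nsmul_eq_mul]
  ring

/-- The uniform distribution on the permutations with the parity of a product of `σ` and a full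
cycle. -/
noncomputable def parityDist (σ τ : Perm X) : ℝ :=
  (1 / (Fintype.card (Perm X) : ℝ)) *
    (1 + (-1) ^ (Fintype.card X - 1) * (Perm.sign σ : ℤ) * (Perm.sign τ : ℤ))

/-- The extreme terms k = 0 and k = |X| - 1, the trivial and the sign character, make up
`parityDist`. -/
theorem mixDist_sub_parityDist [Nontrivial X] (σ τ : Perm X) :
    mixDist σ τ - parityDist σ τ = (1 / (Fintype.card (Perm X) : ℝ)) *
      ∑ k ∈ Ico 1 (Fintype.card X - 1),
        (-1) ^ k * (hookChar k σ⁻¹ / ((Fintype.card X - 1).choose k : ℝ)) * hookChar k τ := by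
  have hd : 1 < Fintype.card X := Fintype.one_lt_card
  obtain ⟨m, hm⟩ : ∃ m, Fintype.card X = m + 1 + 1 := ⟨Fintype.card X - 2, by omega⟩
  have h1 : (hookChar (m + 1) σ⁻¹ : ℝ) = (Perm.sign σ : ℤ) := by
    have := hookChar_card_sub_one σ⁻¹
    rwa [hm, Perm.sign_inv] at this
  have h2 : (hookChar (m + 1) τ : ℝ) = (Perm.sign τ : ℤ) := by
    have := hookChar_card_sub_one τ
    rwa [hm] at this
  have h3 : m + 1 + 1 - 1 = m + 1 := rfl
  rw [mixDist, parityDist, hm, h3, ← mul_sub, sum_range_succ, h1, h2, range_eq_Ico,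
    sum_eq_sum_Ico_succ_bot (Nat.succ_pos m)]
  simp [hookChar_zero]

/-- Cauchy–Schwarz over the group, then Parseval for the orthogonal hook characters of equal norm.
-/
theorem sum_abs_mixDist_sub_parityDist_sq_le [Nontrivial X] (σ : Perm X) :
    (∑ τ, |mixDist σ τ - parityDist σ τ|) ^ 2
      ≤ ∑ k ∈ Ico 1 (Fintype.card X - 1),
        (hookChar k σ⁻¹ / ((Fintype.card X - 1).choose k : ℝ)) ^ 2 := by
  have hN : (Fintype.card (Perm X) : ℝ) ≠ 0 := by positivity
  let c : ℕ → ℝ := fun k =>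
    (-1) ^ k * (hookChar k σ⁻¹ / ((Fintype.card X - 1).choose k : ℝ))
  have hc : ∀ k, c k ^ 2 = (hookChar k σ⁻¹ / ((Fintype.card X - 1).choose k : ℝ)) ^ 2 := by
    intro k
    rw [mul_pow, ← pow_mul, mul_comm k 2, pow_mul]
    norm_num
  have hortho : ∑ τ : Perm X, (∑ k ∈ Ico 1 (Fintype.card X - 1), c k * hookChar k τ) ^ 2
      = (Fintype.card (Perm X) : ℝ) * ∑ k ∈ Ico 1 (Fintype.card X - 1), c k ^ 2 := by
    simp only [pow_two, sum_mul_sum]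
    rw [sum_comm, mul_sum]
    refine sum_congr rfl fun k hk => ?_
    rw [sum_comm, sum_eq_single k]
    · rw [← sum_hookChar_sq (k := k) (by have := (mem_Ico.mp hk).2; omega), sum_mul]
      exact sum_congr rfl fun τ _ => by ring
    · intro l _ hl
      rw [← mul_zero (c k * c l), ← sum_hookChar_mul_hookChar_of_ne (X := X) hl.symm, mul_sum]
      exact sum_congr rfl fun τ _ => by ring
    · intro h
      exact absurd hk h
  have hcs := sq_sum_le_card_mul_sum_sq (s := (univ : Finset (Perm X)))
    (f := fun τ => |mixDist σ τ - parityDist σ τ|)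
  refine hcs.trans (le_of_eq ?_)
  simp only [sq_abs, mixDist_sub_parityDist, mul_pow]
  rw [← mul_sum]
  change _ * (_ * ∑ τ : Perm X, (∑ k ∈ Ico 1 (Fintype.card X - 1), c k * hookChar k τ) ^ 2) = _
  rw [hortho, card_univ, sum_congr rfl fun k _ => hc k]
  field_simp

theorem sum_sign [Nontrivial X] : ∑ τ : Perm X, ((Perm.sign τ : ℤ) : ℝ) = 0 := by
  have h := sum_hookChar_mul_hookChar_of_lt (X := X) (k := 0) (l := Fintype.card X - 1)
    (by have := Fintype.one_lt_card (α := X); omega)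
  simpa [hookChar_zero, hookChar_card_sub_one] using h

/-- Both are probability distributions. This trivial bound serves the maps whose return permutation
has many fixed points. -/
theorem sum_abs_mixDist_sub_parityDist_le_two [Nontrivial X] {R : Perm X} (hR : IsFullCycle R)
    (σ : Perm X) : ∑ τ, |mixDist σ τ - parityDist σ τ| ≤ 2 := by
  have hN : (Fintype.card (Perm X) : ℝ) ≠ 0 := by positivity
  have h0 : ∀ τ, 0 ≤ parityDist σ τ := by
    intro τ
    refine mul_nonneg (by positivity) ?_
    rcases neg_one_pow_eq_or ℝ (Fintype.card X - 1) with h | h <;>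
    rcases Int.units_eq_one_or (Perm.sign σ) with h' | h' <;>
    rcases Int.units_eq_one_or (Perm.sign τ) with h'' | h'' <;>
    simp [h, h', h'']
  have h1 : ∑ τ, parityDist σ τ = 1 := by
    simp only [parityDist]
    rw [← mul_sum, sum_add_distrib, ← mul_sum, sum_sign]
    simp [hN]
  calc _ ≤ ∑ τ, (mixDist σ τ + parityDist σ τ) := by
        refine sum_le_sum fun τ _ => ?_
        have := mixDist_nonneg hR σ τ
        have := h0 τ
        rw [abs_le]
        constructor <;> linarith
    _ = 2 := by
        rw [sum_add_distrib, sum_mixDist hR, h1]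
        norm_num

end Mixing

/-! ### Exposing a random cycle point by point -/

section Closing

open Finset

variable {X : Type*} [Fintype X] [DecidableEq X]

/-- `swap x (π x) * π` is π with x cut out of its cycle: x becomes fixed and its predecessor is sent
to `π x`. -/
theorem sameCycle_of_sameCycle_swap_mul {π : Perm X} {x a b : X} (ha : a ≠ x)
    (h : (swap x (π x) * π).SameCycle a b) : π.SameCycle a b := by
  obtain ⟨k, rfl⟩ := h.exists_nat_pow_eq
  have key : ∀ k : ℕ, π.SameCycle a (((swap x (π x) * π) ^ k) a) ∧
      ((swap x (π x) * π) ^ k) a ≠ x := by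
    intro k
    induction k with
    | zero => exact ⟨Perm.SameCycle.refl _ _, ha⟩
    | succ k ih =>
      rw [pow_succ', Perm.mul_apply]
      set c := ((swap x (π x) * π) ^ k) a
      have hc : π c ≠ π x := fun h => ih.2 (π.injective h)
      rw [Perm.mul_apply]
      by_cases hx : π c = x
      · rw [hx, swap_apply_left]
        refine ⟨?_, fun h => hc (hx.trans h.symm)⟩
        have : π x = π (π c) := by rw [hx]
        rw [this, Perm.sameCycle_apply_right, Perm.sameCycle_apply_right]
        exact ih.1
      · rw [swap_apply_of_ne_of_ne hx hc, Perm.sameCycle_apply_right]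
        exact ⟨ih.1, hx⟩
  exact (key k).1

theorem sameCycle_swap_mul_of_sameCycle {π : Perm X} {x a b : X} (ha : a ≠ x) (hb : b ≠ x)
    (h : π.SameCycle a b) : (swap x (π x) * π).SameCycle a b := by
  obtain ⟨k, hk⟩ := h.exists_nat_pow_eq
  induction k using Nat.strong_induction_on generalizing a with
  | _ k ih =>
    rcases k with _ | k
    · rw [pow_zero, Perm.one_apply] at hk
      rw [hk]
    · rw [pow_succ, Perm.mul_apply] at hk
      have hc : π a ≠ π x := fun h => ha (π.injective h)
      -- When a precedes x, one step of the shortened cycle covers two steps of π.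
      by_cases hx : π a = x
      · rcases k with _ | k
        · exact absurd (hk.symm.trans hx) hb
        · rw [pow_succ, Perm.mul_apply, hx] at hk
          have hstep : (swap x (π x) * π) a = π x := by
            rw [Perm.mul_apply, hx, swap_apply_left]
          rw [← Perm.sameCycle_apply_left, hstep]
          exact ih k (by omega) (fun h => hc (hx.trans h.symm)) ⟨k, by exact_mod_cast hk⟩ hk
      · have hstep : (swap x (π x) * π) a = π a := by
          rw [Perm.mul_apply, swap_apply_of_ne_of_ne hx hc]
        rw [← Perm.sameCycle_apply_left, hstep]
        exact ih k (by omega) hx ⟨k, by exact_mod_cast hk⟩ hk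

open Classical in
/-- The length of the cycle of `ω` through `x`. -/
noncomputable def cycleCard (ω : Perm X) (x : X) : ℕ :=
  (univ.filter fun y => ω.SameCycle x y).card

theorem cycleCard_pos (ω : Perm X) (x : X) : 0 < cycleCard ω x :=
  card_pos.mpr ⟨x, mem_filter.mpr ⟨mem_univ _, Perm.SameCycle.refl _ _⟩⟩

theorem cycleCard_eq_one {ω : Perm X} {x : X} : cycleCard ω x = 1 ↔ ω x = x := by
  classical
  constructor
  · intro h
    obtain ⟨z, hz⟩ := card_eq_one.mp h
    have h1 : x ∈ univ.filter fun y => ω.SameCycle x y :=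
      mem_filter.mpr ⟨mem_univ _, Perm.SameCycle.refl _ _⟩
    have h2 : ω x ∈ univ.filter fun y => ω.SameCycle x y :=
      mem_filter.mpr ⟨mem_univ _, Perm.sameCycle_apply_right.mpr (Perm.SameCycle.refl _ _)⟩
    rw [hz, mem_singleton] at h1 h2
    rw [h2, ← h1]
  · intro h
    refine card_eq_one.mpr ⟨x, ?_⟩
    ext y
    simp only [mem_filter, mem_univ, true_and, mem_singleton]
    exact ⟨fun hy => (hy.eq_of_left h).symm, fun hy => hy ▸ Perm.SameCycle.refl _ _⟩

theorem cycleCard_eq_succ {π : Perm X} {x : X} (hx : π x ≠ x) :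
    cycleCard π x = cycleCard (swap x (π x) * π) (π x) + 1 := by
  classical
  have : (univ.filter fun y => π.SameCycle x y)
      = insert x (univ.filter fun y => (swap x (π x) * π).SameCycle (π x) y) := by
    ext y
    simp only [mem_filter, mem_univ, true_and, mem_insert]
    by_cases hy : y = x
    · simp [hy, Perm.SameCycle.refl]
    · simp only [hy, false_or]
      constructor
      · intro h
        exact sameCycle_swap_mul_of_sameCycle hx hy (Perm.sameCycle_apply_left.mpr h)
      · intro h
        exact Perm.sameCycle_apply_left.mp (sameCycle_of_sameCycle_swap_mul hx h)
  rw [cycleCard, this, card_insert_of_notMem, cycleCard]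
  intro h
  have h := (mem_filter.mp h).2
  have hfix : (swap x (π x) * π) x = x := by simp
  exact hx (h.symm.eq_of_left hfix).symm

open Classical in
/-- The permutations that consist of a single cycle on the set `S`. -/
noncomputable def cyclesOn (S : Finset X) : Finset (Perm X) :=
  univ.filter fun R => (∀ z ∉ S, R z = z) ∧ ∀ a ∈ S, ∀ b ∈ S, R.SameCycle a b

theorem mem_cyclesOn {S : Finset X} {R : Perm X} :
    R ∈ cyclesOn S ↔ (∀ z ∉ S, R z = z) ∧ ∀ a ∈ S, ∀ b ∈ S, R.SameCycle a b := by
  simp [cyclesOn]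

theorem apply_mem_of_fixes {S : Finset X} {R : Perm X} (h : ∀ z ∉ S, R z = z) {x : X}
    (hx : x ∈ S) : R x ∈ S := by
  by_contra hn
  have := R.injective (h _ hn)
  rw [this] at hn
  exact hn hx

/-- A cycle on S is a cycle on `S.erase x` with x inserted just before y. This exposes the single
value R x = y and leaves a uniform cycle on the other points. -/
theorem card_filter_cyclesOn {S : Finset X} (hS : 2 ≤ S.card) {x : X} (hx : x ∈ S)
    (Q : Perm X → Prop) [DecidablePred Q] :
    ((cyclesOn S).filter Q).card
      = ∑ y ∈ S.erase x, ((cyclesOn (S.erase x)).filter fun R => Q (swap x y * R)).card := by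
  have hne : ∀ R ∈ cyclesOn S, R x ≠ x := by
    intro R hR h
    have hR := mem_cyclesOn.mp hR
    obtain ⟨b, hb, hbx⟩ := exists_mem_ne (by omega : 1 < S.card) x
    exact hbx ((hR.2 x hx b hb).eq_of_left h).symm
  rw [card_eq_sum_card_fiberwise (f := fun R => R x) (t := S.erase x)]
  · refine sum_congr rfl fun y hy => ?_
    obtain ⟨hyx, hyS⟩ := mem_erase.mp hy
    refine card_bij' (fun R _ => swap x y * R) (fun R _ => swap x y * R) ?_ ?_ ?_ ?_
    · intro R hR
      obtain ⟨hR, hRx⟩ := mem_filter.mp hR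
      obtain ⟨hR, hQ⟩ := mem_filter.mp hR
      have hR' := mem_cyclesOn.mp hR
      refine mem_filter.mpr ⟨mem_cyclesOn.mpr ⟨?_, ?_⟩, ?_⟩
      · intro z hz
        by_cases hzx : z = x
        · subst hzx
          rw [Perm.mul_apply, hRx, swap_apply_right]
        · have hzS : z ∉ S := fun h => hz (mem_erase.mpr ⟨hzx, h⟩)
          rw [Perm.mul_apply, hR'.1 z hzS, swap_apply_of_ne_of_ne hzx]
          rintro rfl
          exact hzS hyS
      · intro a ha b hb
        rw [mem_erase] at ha hb
        have := sameCycle_swap_mul_of_sameCycle ha.1 hb.1 (hR'.2 a ha.2 b hb.2)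
        rwa [hRx] at this
      · rwa [← mul_assoc, swap_mul_self, one_mul]
    · intro R hR
      obtain ⟨hR, hQ⟩ := mem_filter.mp hR
      have hR' := mem_cyclesOn.mp hR
      have hRx : R x = x := hR'.1 x (notMem_erase x S)
      have hax : (swap x y * R) x = y := by rw [Perm.mul_apply, hRx, swap_apply_left]
      refine mem_filter.mpr ⟨mem_filter.mpr ⟨mem_cyclesOn.mpr ⟨?_, ?_⟩, hQ⟩, hax⟩
      · intro z hz
        have hzx : z ≠ x := fun h => hz (h ▸ hx)
        rw [Perm.mul_apply, hR'.1 z (fun h => hz (mem_of_mem_erase h)),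
          swap_apply_of_ne_of_ne hzx]
        rintro rfl
        exact hz hyS
      · have hback : swap x ((swap x y * R) x) * (swap x y * R) = R := by
          rw [hax, ← mul_assoc, swap_mul_self, one_mul]
        have hy1 : ∀ a ∈ S, (swap x y * R).SameCycle y a := by
          intro a ha
          by_cases hax' : a = x
          · rw [hax']
            have := Perm.sameCycle_apply_left.mpr (Perm.SameCycle.refl (swap x y * R) x)
            rwa [hax] at this
          · refine sameCycle_of_sameCycle_swap_mul hyx ?_
            rw [hback]
            exact hR'.2 y hy a (mem_erase.mpr ⟨hax', ha⟩)
        intro a ha b hb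
        exact (hy1 a ha).symm.trans (hy1 b hb)
    · intro R _
      rw [← mul_assoc, swap_mul_self, one_mul]
    · intro R _
      rw [← mul_assoc, swap_mul_self, one_mul]
  · intro R hR
    have hR := (mem_filter.mp (mem_coe.mp hR)).1
    exact mem_coe.mpr (mem_erase.mpr ⟨hne R hR, apply_mem_of_fixes (mem_cyclesOn.mp hR).1 hx⟩)

theorem card_cyclesOn {S : Finset X} (hS : 2 ≤ S.card) {x : X} (hx : x ∈ S) :
    (cyclesOn S).card = (S.card - 1) * (cyclesOn (S.erase x)).card := by
  classical
  have h := card_filter_cyclesOn hS hx fun _ => True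
  simp only [filter_true, sum_const, smul_eq_mul, card_erase_of_mem hx] at h
  exact h

/-- For a random cycle `R` on `S`, the cycle of `σ * R` through `x` has length `j` with probability
at most `1 / (|S| - j)`. -/
theorem card_filter_cycleCard_le (j : ℕ) : ∀ (S : Finset X) (x : X), x ∈ S → ∀ σ : Perm X,
    (∀ z ∉ S, σ z = z) →
    ((cyclesOn S).filter fun R => cycleCard (σ * R) x = j + 1).card * (S.card - (j + 1))
      ≤ (cyclesOn S).card := by
  induction j with
  | zero =>
    intro S x hx σ hσ
    -- For a smaller S the truncated difference on the left is zero.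
    by_cases hS : 2 ≤ S.card
    swap
    · rw [show S.card - (0 + 1) = 0 by omega, mul_zero]
      exact Nat.zero_le _
    rw [card_cyclesOn hS hx, mul_comm, zero_add]
    refine Nat.mul_le_mul_left _ ?_
    rw [card_filter_cyclesOn hS hx]
    -- The cycle closes at once for at most one of the |S| - 1 values y of R x.
    have hz : ∀ y ∈ S.erase x, y ≠ σ⁻¹ x → ((cyclesOn (S.erase x)).filter fun R =>
        cycleCard (σ * (swap x y * R)) x = 1).card = 0 := by
      intro y _ hyx
      rw [card_eq_zero, filter_eq_empty_iff]
      intro R hR h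
      rw [cycleCard_eq_one] at h
      have hRx := (mem_cyclesOn.mp hR).1 x (notMem_erase x S)
      rw [Perm.mul_apply, Perm.mul_apply, hRx, swap_apply_left] at h
      exact hyx (Perm.eq_inv_iff_eq.mpr h)
    by_cases hmem : σ⁻¹ x ∈ S.erase x
    · rw [sum_eq_single_of_mem _ hmem hz]
      exact card_filter_le _ _
    · rw [sum_eq_zero fun y hy => hz y hy fun h => hmem (h ▸ hy)]
      exact Nat.zero_le _
  | succ j ih =>
    intro S x hx σ hσ
    by_cases hS : 2 ≤ S.card
    swap
    · rw [show S.card - (j + 1 + 1) = 0 by omega, mul_zero]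
      exact Nat.zero_le _
    rw [card_cyclesOn hS hx, card_filter_cyclesOn hS hx, sum_mul, ← card_erase_of_mem hx,
      ← smul_eq_mul (a := (S.erase x).card), ← sum_const]
    refine sum_le_sum fun y hy => ?_
    obtain ⟨hyx, hyS⟩ := mem_erase.mp hy
    by_cases hσy : σ y = x
    · have : ((cyclesOn (S.erase x)).filter fun R =>
          cycleCard (σ * (swap x y * R)) x = j + 1 + 1) = ∅ := by
        rw [filter_eq_empty_iff]
        intro R hR h
        have hRx := (mem_cyclesOn.mp hR).1 x (notMem_erase x S)
        have h1 : cycleCard (σ * (swap x y * R)) x = 1 := by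
          rw [cycleCard_eq_one, Perm.mul_apply, Perm.mul_apply, hRx, swap_apply_left, hσy]
        omega
      rw [this, card_empty, zero_mul]
      exact Nat.zero_le _
    -- If it does not close, x is cut out of the product. What remains has the same shape on
    -- `S.erase x` with a modified σ, and the cycle, now followed from `σ y`, is shorter by one.
    · have hstep : ((cyclesOn (S.erase x)).filter fun R =>
          cycleCard (σ * (swap x y * R)) x = j + 1 + 1)
          = (cyclesOn (S.erase x)).filter fun R =>
            cycleCard ((swap x (σ y) * σ * swap x y) * R) (σ y) = j + 1 := by
        refine filter_congr fun R hR => ?_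
        have hRx := (mem_cyclesOn.mp hR).1 x (notMem_erase x S)
        have hval : (σ * (swap x y * R)) x = σ y := by
          rw [Perm.mul_apply, Perm.mul_apply, hRx, swap_apply_left]
        rw [cycleCard_eq_succ (by rw [hval]; exact hσy), hval]
        simp only [mul_assoc, Nat.add_right_cancel_iff]
      rw [hstep]
      have hσyS : σ y ∈ S.erase x := mem_erase.mpr ⟨hσy, apply_mem_of_fixes hσ hyS⟩
      have := ih (S.erase x) (σ y) hσyS (swap x (σ y) * σ * swap x y) ?_
      · rw [card_erase_of_mem hx] at this
        rwa [show S.card - (j + 1 + 1) = S.card - 1 - (j + 1) by omega]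
      · intro z hz
        by_cases hzx : z = x
        · subst hzx
          simp
        · have hzS : z ∉ S := fun h => hz (mem_erase.mpr ⟨hzx, h⟩)
          have hzy : z ≠ y := fun h => hzS (h ▸ hyS)
          have hzσy : z ≠ σ y := fun h => hz (h ▸ hσyS)
          rw [Perm.mul_apply, Perm.mul_apply, swap_apply_of_ne_of_ne hzx hzy, hσ z hzS,
            swap_apply_of_ne_of_ne hzx hzσy]

end Closing

/-! ### Short cycles and the number of cycles -/

section CycleLengths

open Finset

variable {X : Type*} [Fintype X] [DecidableEq X]

theorem sum_conj_cycleCard_eq_le [Nontrivial X] {R : Perm X} (hR : IsFullCycle R) (σ : Perm X)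
    (x : X) {j : ℕ} (hj : 0 < j) (hjd : j < Fintype.card X) :
    ∑ h : Perm X, (if cycleCard (σ * (h * R * h⁻¹)) x = j then (1 : ℝ) else 0)
      ≤ (Fintype.card (Perm X) : ℝ) / (Fintype.card X - j) := by
  classical
  have huniv : cyclesOn (univ : Finset X) = univ.filter fun C : Perm X => IsFullCycle C := by
    ext C
    rw [mem_cyclesOn, mem_filter]
    simp [IsFullCycle]
  obtain ⟨i, rfl⟩ : ∃ i, j = i + 1 := ⟨j - 1, by omega⟩
  have h1 := card_mul_sum_conj hR fun C => if cycleCard (σ * C) x = i + 1 then (1 : ℝ) else 0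
  have h2 := card_filter_cycleCard_le i univ x (mem_univ x) σ (by simp)
  rw [huniv, card_univ] at h2
  have h3 : (0 : ℝ) < ((univ.filter fun C : Perm X => IsFullCycle C).card : ℝ) := by
    have : R ∈ univ.filter fun C : Perm X => IsFullCycle C := mem_filter.mpr ⟨mem_univ _, hR⟩
    exact_mod_cast card_pos.mpr ⟨R, this⟩
  have h4 : (0 : ℝ) < (Fintype.card X : ℝ) - (i + 1 : ℕ) := by
    rw [sub_pos]; exact_mod_cast hjd
  have h5 : (((univ.filter fun C : Perm X => IsFullCycle C).filter
      fun C => cycleCard (σ * C) x = i + 1).card : ℝ) * ((Fintype.card X : ℝ) - (i + 1 : ℕ))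
      ≤ ((univ.filter fun C : Perm X => IsFullCycle C).card : ℝ) := by
    rw [← Nat.cast_sub hjd.le]
    exact_mod_cast h2
  rw [le_div_iff₀ h4]
  refine le_of_mul_le_mul_left ?_ h3
  rw [← mul_assoc, h1, sum_boole, mul_assoc, mul_comm]
  exact mul_le_mul_of_nonneg_right h5 (by positivity)

theorem sum_conj_cycleCard_le_le [Nontrivial X] {R : Perm X} (hR : IsFullCycle R) (σ : Perm X)
    (x : X) {J : ℕ} (hJ : J < Fintype.card X) :
    ∑ h : Perm X, (if cycleCard (σ * (h * R * h⁻¹)) x ≤ J then (1 : ℝ) else 0)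
      ≤ (Fintype.card (Perm X) : ℝ) * (J / (Fintype.card X - J)) := by
  have h1 : ∀ h : Perm X, (if cycleCard (σ * (h * R * h⁻¹)) x ≤ J then (1 : ℝ) else 0)
      = ∑ j ∈ Icc 1 J, if cycleCard (σ * (h * R * h⁻¹)) x = j then (1 : ℝ) else 0 := by
    intro h
    rw [sum_ite_eq]
    have := cycleCard_pos (σ * (h * R * h⁻¹)) x
    refine if_congr ?_ rfl rfl
    rw [mem_Icc]
    omega
  have hJ' : (J : ℝ) < Fintype.card X := by exact_mod_cast hJ
  rw [sum_congr rfl fun h _ => h1 h, sum_comm]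
  calc _ ≤ ∑ j ∈ Icc 1 J, (Fintype.card (Perm X) : ℝ) / (Fintype.card X - J) := by
        refine sum_le_sum fun j hj => ?_
        obtain ⟨hj1, hj2⟩ := mem_Icc.mp hj
        refine (sum_conj_cycleCard_eq_le hR σ x (by omega) (by omega)).trans ?_
        have : (j : ℝ) ≤ J := by exact_mod_cast hj2
        refine div_le_div_of_nonneg_left (by positivity) (by linarith) (by linarith)
    _ = _ := by
        rw [sum_const, Nat.card_Icc, nsmul_eq_mul]
        simp only [Nat.add_sub_cancel]
        ring

/-- The expected number of cycles of `σ * R` for a random full cycle `R`. -/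
theorem sum_conj_inv_cycleCard_le [Nontrivial X] {R : Perm X} (hR : IsFullCycle R) (σ : Perm X) :
    ∑ h : Perm X, ∑ x, (1 : ℝ) / cycleCard (σ * (h * R * h⁻¹)) x
      ≤ (Fintype.card (Perm X) : ℝ) * (2 * Real.log (Fintype.card X) + 4) := by
  have hd : 1 < Fintype.card X := Fintype.one_lt_card
  set d := Fintype.card X with hd'
  set N : ℝ := (Fintype.card (Perm X) : ℝ) with hN
  have hd0 : (0 : ℝ) < d := by exact_mod_cast (by omega : 0 < d)
  have hM : (2 : ℝ) * (d / 2 : ℕ) ≤ d := by exact_mod_cast (by omega : 2 * (d / 2) ≤ d)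
  have hM' : (d : ℝ) ≤ 2 * ((d / 2 : ℕ) + 1) := by
    exact_mod_cast (by omega : d ≤ 2 * (d / 2 + 1))
  -- The reciprocals of the cycle lengths, summed over points, count cycles. Lengths j up to d / 2
  -- have probability at most 1 / (d - j) ≤ 2 / d and give a harmonic sum; longer cycles contribute
  -- at most 2 / d per point.
  have hpt : ∀ (h : Perm X) (x : X), (1 : ℝ) / cycleCard (σ * (h * R * h⁻¹)) x
      ≤ ∑ j ∈ Icc 1 (d / 2), (1 / (j : ℝ)) *
        (if cycleCard (σ * (h * R * h⁻¹)) x = j then (1 : ℝ) else 0) + 2 / d := by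
    intro h x
    have hpos := cycleCard_pos (σ * (h * R * h⁻¹)) x
    set c := cycleCard (σ * (h * R * h⁻¹)) x
    simp only [mul_ite, mul_one, mul_zero]
    rw [sum_ite_eq]
    split_ifs with hc
    · have : (0 : ℝ) ≤ 2 / d := by positivity
      linarith
    · rw [zero_add, div_le_div_iff₀ (by exact_mod_cast hpos) hd0]
      rw [mem_Icc] at hc
      have : d / 2 + 1 ≤ c := by omega
      have : ((d / 2 : ℕ) : ℝ) + 1 ≤ c := by exact_mod_cast this
      linarith
  have hx : ∀ x : X, ∑ h : Perm X, (1 : ℝ) / cycleCard (σ * (h * R * h⁻¹)) x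
      ≤ N * (2 / d) * (harmonic (d / 2) + 1) := by
    intro x
    refine (sum_le_sum fun h _ => hpt h x).trans ?_
    rw [sum_add_distrib, sum_comm, sum_const, card_univ, nsmul_eq_mul, mul_add, mul_one,
      ← hN]
    refine add_le_add ?_ le_rfl
    have hH : ((harmonic (d / 2) : ℚ) : ℝ) = ∑ j ∈ Icc 1 (d / 2), 1 / (j : ℝ) := by
      rw [harmonic_eq_sum_Icc]
      push_cast
      simp
    rw [hH, mul_sum]
    refine sum_le_sum fun j hj => ?_
    obtain ⟨hj1, hj2⟩ := mem_Icc.mp hj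
    rw [← mul_sum, mul_comm]
    refine mul_le_mul_of_nonneg_right ?_ (by positivity)
    refine (sum_conj_cycleCard_eq_le hR σ x (by omega) (by omega)).trans ?_
    have hj' : (j : ℝ) ≤ (d / 2 : ℕ) := by exact_mod_cast hj2
    rw [div_eq_mul_one_div N]
    refine mul_le_mul_of_nonneg_left ?_ (by positivity)
    rw [div_le_div_iff₀ (by rw [← hd']; linarith) hd0, ← hd']
    linarith
  rw [sum_comm]
  refine (sum_le_sum fun x _ => hx x).trans ?_
  rw [sum_const, card_univ, nsmul_eq_mul, ← hd']
  have hlog : ((harmonic (d / 2) : ℚ) : ℝ) ≤ 1 + Real.log d := by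
    refine (harmonic_le_one_add_log (d / 2)).trans ?_
    have h2 : (0 : ℝ) < (d / 2 : ℕ) := by exact_mod_cast (by omega : 0 < d / 2)
    have := Real.log_le_log h2 (by linarith : ((d / 2 : ℕ) : ℝ) ≤ d)
    linarith
  have he : (d : ℝ) * (N * (2 / d) * (harmonic (d / 2) + 1))
      = N * (2 * (harmonic (d / 2) + 1)) := by
    field_simp
  rw [he]
  refine mul_le_mul_of_nonneg_left ?_ (by positivity)
  linarith

end CycleLengths

/-! ### Counting invariant sets -/

section InvariantSets

open Finset

variable {X : Type*} [Fintype X] [DecidableEq X]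

/-- The number of fixed points. -/
def fixCount (σ : Perm X) : ℕ := (univ.filter fun x => σ x = x).card

theorem fixCount_le (σ : Perm X) : fixCount σ ≤ Fintype.card X :=
  (card_filter_le _ _).trans_eq card_univ

theorem invCount_zero (σ : Perm X) : invCount 0 σ = 1 := by
  rw [invCount, powersetCard_zero, filter_true_of_mem, card_singleton]
  intro s hs
  rw [mem_singleton.mp hs]
  simp

theorem invCount_le_choose (k : ℕ) (σ : Perm X) : invCount k σ ≤ (Fintype.card X).choose k := by
  refine (card_filter_le _ _).trans_eq ?_
  rw [card_powersetCard, card_univ]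

theorem card_invariant_of_fixed {σ : Perm X} {x : X} (hx : σ x = x) (k : ℕ) :
    (((univ.powersetCard (k + 1)).filter fun s : Finset X => ∀ y ∈ s, σ y ∈ s).filter
      fun s => x ∈ s).card ≤ invCount k σ := by
  refine card_le_card_of_injOn (fun s => s.erase x) ?_ ?_
  · intro s hs
    obtain ⟨hs, hxs⟩ := mem_filter.mp (mem_coe.mp hs)
    obtain ⟨hs, hinv⟩ := mem_filter.mp hs
    refine mem_coe.mpr (mem_filter.mpr ⟨mem_powersetCard.mpr ⟨subset_univ _, ?_⟩, ?_⟩)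
    · rw [card_erase_of_mem hxs, (mem_powersetCard.mp hs).2, Nat.add_sub_cancel]
    · intro y hy
      obtain ⟨hyx, hys⟩ := mem_erase.mp hy
      refine mem_erase.mpr ⟨fun h => hyx (σ.injective (h.trans hx.symm)), hinv y hys⟩
  · intro s hs t ht hst
    have hxs := (mem_filter.mp (mem_coe.mp hs)).2
    have hxt := (mem_filter.mp (mem_coe.mp ht)).2
    rw [← insert_erase hxs, ← insert_erase hxt]
    exact congrArg _ hst

/-- An invariant set through x also contains `σ x`, so only k points are left to choose. -/
theorem card_invariant_of_not_fixed {σ : Perm X} {x : X} (hx : σ x ≠ x) (k : ℕ) :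
    (((univ.powersetCard (k + 2)).filter fun s : Finset X => ∀ y ∈ s, σ y ∈ s).filter
      fun s => x ∈ s).card ≤ (Fintype.card X - 2).choose k := by
  have hmem : σ x ∈ univ.erase x := mem_erase.mpr ⟨hx, mem_univ _⟩
  have hc : ((univ.erase x).erase (σ x)).card = Fintype.card X - 2 := by
    rw [card_erase_of_mem hmem, card_erase_of_mem (mem_univ x), card_univ]
    omega
  rw [← hc, ← card_powersetCard]
  refine card_le_card_of_injOn (fun s => (s.erase x).erase (σ x)) ?_ ?_
  · intro s hs
    obtain ⟨hs, hxs⟩ := mem_filter.mp (mem_coe.mp hs)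
    obtain ⟨hs, hinv⟩ := mem_filter.mp hs
    have h1 : σ x ∈ s.erase x := mem_erase.mpr ⟨hx, hinv x hxs⟩
    refine mem_coe.mpr (mem_powersetCard.mpr
      ⟨erase_subset_erase _ (erase_subset_erase _ (subset_univ _)), ?_⟩)
    rw [card_erase_of_mem h1, card_erase_of_mem hxs, (mem_powersetCard.mp hs).2]
    omega
  · intro s hs t ht hst
    obtain ⟨hs, hxs⟩ := mem_filter.mp (mem_coe.mp hs)
    obtain ⟨ht, hxt⟩ := mem_filter.mp (mem_coe.mp ht)
    have h1 : σ x ∈ s.erase x := mem_erase.mpr ⟨hx, (mem_filter.mp hs).2 x hxs⟩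
    have h2 : σ x ∈ t.erase x := mem_erase.mpr ⟨hx, (mem_filter.mp ht).2 x hxt⟩
    rw [← insert_erase hxs, ← insert_erase hxt, ← insert_erase h1, ← insert_erase h2]
    exact congrArg _ (congrArg _ hst)

theorem mul_invCount (k : ℕ) (σ : Perm X) :
    k * invCount k σ = ∑ x, (((univ.powersetCard k).filter
      fun s : Finset X => ∀ y ∈ s, σ y ∈ s).filter fun s => x ∈ s).card := by
  have h := sum_card_bipartiteAbove_eq_sum_card_bipartiteBelow (s := (univ : Finset X))
    (t := (univ.powersetCard k).filter fun s : Finset X => ∀ y ∈ s, σ y ∈ s)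
    (fun x s => x ∈ s)
  simp only [bipartiteAbove, bipartiteBelow] at h
  rw [h, sum_congr rfl (g := fun _ => k), sum_const, smul_eq_mul, mul_comm, invCount]
  intro s hs
  rw [← (mem_powersetCard.mp (mem_filter.mp hs).1).2]
  simp

theorem invCount_one_le (σ : Perm X) : invCount 1 σ ≤ fixCount σ := by
  have h := mul_invCount 1 σ
  rw [one_mul] at h
  rw [h, fixCount, card_filter]
  refine sum_le_sum fun x _ => ?_
  split_ifs with hx
  · exact (card_invariant_of_fixed hx 0).trans_eq (invCount_zero σ)
  · rw [Nat.le_zero, card_eq_zero, filter_eq_empty_iff]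
    intro s hs hxs
    obtain ⟨hs, hinv⟩ := mem_filter.mp hs
    obtain ⟨z, rfl⟩ := card_eq_one.mp (mem_powersetCard.mp hs).2
    rw [mem_singleton] at hxs
    subst hxs
    exact hx (mem_singleton.mp (hinv x (mem_singleton_self x)))

/-- Pairs of an invariant set and a point of it are counted, separately for fixed and for moved
points. The recursion turns fixed points into savings over the trivial binomial bound. -/
theorem mul_invCount_le (k : ℕ) (σ : Perm X) :
    (k + 2) * invCount (k + 2) σ
      ≤ fixCount σ * invCount (k + 1) σ + Fintype.card X * (Fintype.card X - 2).choose k := by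
  rw [mul_invCount, ← sum_filter_add_sum_filter_not univ (fun x => σ x = x)]
  refine add_le_add ?_ ?_
  · rw [fixCount, ← smul_eq_mul, ← sum_const]
    exact sum_le_sum fun x hx => card_invariant_of_fixed (mem_filter.mp hx).2 (k + 1)
  · refine (sum_le_sum fun x hx => card_invariant_of_not_fixed (mem_filter.mp hx).2 k).trans ?_
    rw [sum_const, smul_eq_mul]
    exact Nat.mul_le_mul_right _ ((card_filter_le _ _).trans_eq card_univ)

theorem pow_add_pow_le_pow {p q t : ℝ} (hp : 0 ≤ p) (hq : 0 ≤ q) (hpt : p ≤ t) (hqt : q ≤ t)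
    (h2 : p ^ 2 + q ^ 2 ≤ t ^ 2) (m : ℕ) : p ^ (m + 2) + q ^ (m + 2) ≤ t ^ (m + 2) := by
  have ht : 0 ≤ t := hp.trans hpt
  have h3 : p ^ m ≤ t ^ m := pow_le_pow_left₀ hp hpt m
  have h4 : q ^ m ≤ t ^ m := pow_le_pow_left₀ hq hqt m
  rw [pow_add, pow_add, pow_add]
  calc _ ≤ t ^ m * p ^ 2 + t ^ m * q ^ 2 := by gcongr
    _ = t ^ m * (p ^ 2 + q ^ 2) := by ring
    _ ≤ _ := by gcongr

/-- The probability that a random set, each point being chosen with probability `p`, is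
invariant. -/
theorem sum_invariant_weight_le (σ : Perm X) {p q t : ℝ} (hp : 0 ≤ p) (hq : 0 ≤ q)
    (hpq : p + q = 1) (hpt : p ≤ t) (hqt : q ≤ t) (h2 : p ^ 2 + q ^ 2 ≤ t ^ 2) :
    ∑ s ∈ univ.filter (fun s : Finset X => ∀ x ∈ s, σ x ∈ s),
      p ^ s.card * q ^ (Fintype.card X - s.card) ≤ t ^ (Fintype.card X - fixCount σ) := by
  classical
  let Qt := Quotient (Perm.SameCycle.setoid σ)
  let mk : X → Qt := fun x => Quotient.mk _ x
  have mk_eq : ∀ x y, mk x = mk y ↔ σ.SameCycle x y := fun x y => Quotient.eq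
  let cls : Qt → Finset X := fun Q => univ.filter fun x => mk x = Q
  have hmk : Function.Surjective mk := Quotient.mk_surjective
  -- Invariant sets are unions of cycles, so the sum is a product over the cycles.
  have e1 : ∑ s ∈ univ.filter (fun s : Finset X => ∀ x ∈ s, σ x ∈ s),
      p ^ s.card * q ^ (Fintype.card X - s.card)
      = ∏ Q : Qt, (p ^ (cls Q).card + q ^ (cls Q).card) := by
    rw [prod_add, powerset_univ]
    symm
    refine sum_bij (fun T _ => univ.filter fun x => mk x ∈ T) ?_ ?_ ?_ ?_
    · intro T _
      refine mem_filter.mpr ⟨mem_univ _, fun x hx => ?_⟩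
      rw [mem_filter] at hx ⊢
      refine ⟨mem_univ _, ?_⟩
      rw [← (mk_eq x (σ x)).mpr (Perm.sameCycle_apply_right.mpr (Perm.SameCycle.refl _ _))]
      exact hx.2
    · intro T _ T' _ h
      ext Q
      obtain ⟨x, rfl⟩ := hmk Q
      have := congrArg (fun s : Finset X => x ∈ s) h
      simpa using this
    · intro s hs
      have hinv := (mem_filter.mp hs).2
      refine ⟨s.image mk, mem_univ _, ?_⟩
      ext x
      simp only [mem_filter, mem_univ, true_and, mem_image]
      constructor
      · rintro ⟨y, hy, hyx⟩
        exact sameCycle_mem_of_invariant hinv ((mk_eq y x).mp hyx) hy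
      · intro hx
        exact ⟨x, hx, rfl⟩
    · intro T _
      have hc : ∀ T : Finset Qt, (univ.filter fun x => mk x ∈ T).card = ∑ Q ∈ T, (cls Q).card := by
        intro T
        rw [card_eq_sum_card_fiberwise (f := mk) (t := T)]
        · refine sum_congr rfl fun Q hQ => ?_
          congr 1
          ext x
          simp only [mem_filter, mem_univ, true_and, cls]
          exact ⟨fun h => h.2, fun h => ⟨h ▸ hQ, h⟩⟩
        · intro x hx
          exact (mem_filter.mp (mem_coe.mp hx)).2
      have hcompl : Fintype.card X - (univ.filter fun x => mk x ∈ T).card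
          = (univ.filter fun x => mk x ∈ univ \ T).card := by
        rw [← card_univ, ← card_sdiff_of_subset (subset_univ _)]
        congr 1
        ext x
        simp
      rw [hcompl, hc, hc, prod_pow_eq_pow_sum, prod_pow_eq_pow_sum]
  -- The bound is spread over the points to be compared cycle by cycle: p + q = 1 on a fixed point,
  -- and t per point on a longer cycle.
  have e2 : t ^ (Fintype.card X - fixCount σ) = ∏ Q : Qt, ∏ x ∈ cls Q,
      (if σ x = x then 1 else t) := by
    rw [prod_fiberwise, prod_ite, prod_const_one, one_mul, prod_const]
    congr 1
    have := card_filter_add_card_filter_not (s := (univ : Finset X)) (fun x => σ x = x)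
    rw [card_univ] at this
    rw [fixCount]
    omega
  rw [e1, e2]
  refine prod_le_prod (fun Q _ => by positivity) fun Q _ => ?_
  obtain ⟨x, rfl⟩ := hmk Q
  have hcc : (cls (mk x)).card = cycleCard σ x := by
    rw [cycleCard]
    congr 1
    ext y
    simp only [cls, mem_filter, mem_univ, true_and]
    rw [mk_eq]
    exact Perm.sameCycle_comm
  by_cases hx : σ x = x
  · have h1 : cls (mk x) = {x} := by
      ext y
      simp only [cls, mem_filter, mem_univ, true_and, mem_singleton]
      rw [mk_eq]
      exact ⟨fun h => h.eq_of_right hx, fun h => h ▸ Perm.SameCycle.refl _ _⟩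
    rw [h1]
    simp [hx, hpq]
  · have h1 : ∀ y ∈ cls (mk x), (if σ y = y then 1 else t) = t := by
      intro y hy
      rw [if_neg]
      intro h
      have hy := (mk_eq y x).mp (mem_filter.mp hy).2
      rw [← hy.eq_of_left h] at hx
      exact hx h
    rw [prod_congr rfl h1, prod_const, hcc]
    have h3 : cycleCard σ x ≠ 1 := fun h => hx (cycleCard_eq_one.mp h)
    have h4 := cycleCard_pos σ x
    obtain ⟨m, hm⟩ : ∃ m, cycleCard σ x = m + 2 := ⟨cycleCard σ x - 2, by omega⟩
    rw [hm]
    exact pow_add_pow_le_pow hp hq hpt hqt h2 m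

/-- The mode of the binomial distribution with parameters `d` and `k / d` is `k`. -/
theorem choose_mul_pow_mul_pow_le (d k j : ℕ) (hk : k ≤ d) (hj : j ≤ d) :
    d.choose j * k ^ j * (d - k) ^ (d - j) ≤ d.choose k * k ^ k * (d - k) ^ (d - k) := by
  -- For fixed a the quotient a^b / b! is largest at b = a. It is used for a = k and for a = d - k.
  have hfac : ∀ a b : ℕ, a.factorial * a ^ b ≤ b.factorial * a ^ a := by
    intro a b
    rcases le_total a b with h | h
    · obtain ⟨m, rfl⟩ := Nat.exists_eq_add_of_le h
      have : a.factorial * a ^ m ≤ (a + m).factorial :=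
        (Nat.mul_le_mul_left _ (Nat.pow_le_pow_left (Nat.le_succ a) m)).trans
          Nat.factorial_mul_pow_le_factorial
      calc a.factorial * a ^ (a + m) = (a.factorial * a ^ m) * a ^ a := by ring
        _ ≤ _ := Nat.mul_le_mul_right _ this
    · obtain ⟨m, rfl⟩ := Nat.exists_eq_add_of_le h
      have : (b + m).factorial ≤ b.factorial * (b + m) ^ m := by
        rw [← Nat.factorial_mul_descFactorial (Nat.le_add_left m b), Nat.add_sub_cancel]
        exact Nat.mul_le_mul_left _ (Nat.descFactorial_le_pow _ _)
      calc (b + m).factorial * (b + m) ^ b ≤ b.factorial * (b + m) ^ m * (b + m) ^ b :=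
            Nat.mul_le_mul_right _ this
        _ = _ := by ring
  have h1 := hfac k j
  have h2 := hfac (d - k) (d - j)
  have hcj := Nat.choose_mul_factorial_mul_factorial hj
  have hck := Nat.choose_mul_factorial_mul_factorial hk
  have hpos : 0 < j.factorial * (d - j).factorial * (k.factorial * (d - k).factorial) := by
    positivity
  refine Nat.le_of_mul_le_mul_left ?_ hpos
  calc j.factorial * (d - j).factorial * (k.factorial * (d - k).factorial) *
        (d.choose j * k ^ j * (d - k) ^ (d - j))
      = (d.choose j * j.factorial * (d - j).factorial) *
        ((k.factorial * k ^ j) * ((d - k).factorial * (d - k) ^ (d - j))) := by ring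
    _ ≤ (d.choose k * k.factorial * (d - k).factorial) *
        ((j.factorial * k ^ k) * ((d - j).factorial * (d - k) ^ (d - k))) := by
        rw [hcj, hck]
        exact Nat.mul_le_mul_left _ (Nat.mul_le_mul h1 h2)
    _ = _ := by ring

/-- The d + 1 binomial probabilities add up to one, so the one at the mode is at least their
average. -/
theorem one_le_choose_mul_pow_mul_pow {d k : ℕ} (hd : 0 < d) (hk : k ≤ d) :
    1 ≤ ((d : ℝ) + 1) * (d.choose k * ((k : ℝ) / d) ^ k * (1 - (k : ℝ) / d) ^ (d - k)) := by
  have hd' : (d : ℝ) ≠ 0 := by positivity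
  have hq : 1 - (k : ℝ) / d = ((d - k : ℕ) : ℝ) / d := by
    rw [Nat.cast_sub hk]
    field_simp
  have key : ∀ j ≤ d, (d.choose j : ℝ) * ((k : ℝ) / d) ^ j * (1 - (k : ℝ) / d) ^ (d - j)
      = (d.choose j * k ^ j * (d - k) ^ (d - j) : ℕ) / (d : ℝ) ^ d := by
    intro j hj
    rw [hq, div_pow, div_pow]
    push_cast
    rw [← pow_sub_mul_pow (d : ℝ) hj]
    field_simp
  have hsum : ∑ j ∈ range (d + 1),
      (d.choose j : ℝ) * ((k : ℝ) / d) ^ j * (1 - (k : ℝ) / d) ^ (d - j) = 1 := by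
    have := add_pow ((k : ℝ) / d) (1 - (k : ℝ) / d) d
    rw [add_sub_cancel, one_pow] at this
    refine Eq.trans (sum_congr rfl fun j _ => ?_) this.symm
    ring
  calc 1 = ∑ j ∈ range (d + 1),
      (d.choose j : ℝ) * ((k : ℝ) / d) ^ j * (1 - (k : ℝ) / d) ^ (d - j) := hsum.symm
    _ ≤ ∑ j ∈ range (d + 1),
      (d.choose k : ℝ) * ((k : ℝ) / d) ^ k * (1 - (k : ℝ) / d) ^ (d - k) := by
        refine sum_le_sum fun j hj => ?_
        have hj' : j ≤ d := by have := mem_range.mp hj; omega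
        rw [key j hj', key k hk]
        refine div_le_div_of_nonneg_right ?_ (by positivity)
        exact_mod_cast choose_mul_pow_mul_pow_le d k j hk hj'
    _ = _ := by
        rw [sum_const, card_range, nsmul_eq_mul]
        push_cast
        ring

end InvariantSets

/-! ### Estimates for binomial coefficients -/

section Choose

open Finset

theorem choose_mul_le_choose_succ {d m : ℕ} (h : 2 * (m + 1) ≤ d) :
    (d.choose m : ℝ) * d ≤ d.choose (m + 1) * (2 * (m + 1)) := by
  have h1 : (d.choose (m + 1) : ℝ) * (m + 1) = d.choose m * (d - m) := by
    rw [← Nat.cast_sub (by omega)]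
    exact_mod_cast Nat.choose_succ_right_eq d m
  have h2 : (2 : ℝ) * (m + 1) ≤ d := by exact_mod_cast h
  have h3 : (0 : ℝ) ≤ d.choose m := by positivity
  nlinarith

theorem choose_le_two_mul_choose_pred {d i : ℕ} (hd : 0 < d) (h : 2 * i ≤ d) :
    (d.choose i : ℝ) ≤ 2 * (d - 1).choose i := by
  have h1 : ((d - 1).choose i : ℝ) * d = d.choose i * (d - i) := by
    rw [← Nat.cast_sub (by omega)]
    have := Nat.choose_mul_succ_eq (d - 1) i
    rw [Nat.sub_add_cancel hd] at this
    exact_mod_cast this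
  have h2 : (2 : ℝ) * i ≤ d := by exact_mod_cast h
  have h3 : (0 : ℝ) ≤ d.choose i := by positivity
  have h4 : (0 : ℝ) < d := by exact_mod_cast hd
  refine le_of_mul_le_mul_right ?_ h4
  nlinarith

/-- From d (d - 1) C(d-2, m) = (m + 2)(m + 1) C(d, m+2); the factor 2 pays for replacing d - 1 by d.
-/
theorem mul_choose_sub_two_le {d m : ℕ} (hd : 2 ≤ d) :
    (d : ℝ) * (d * (d - 2).choose m) ≤ d.choose (m + 2) * (m + 2) * (2 * (m + 2)) := by
  obtain ⟨e, rfl⟩ := Nat.exists_eq_add_of_le' hd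
  have h1 : ((e : ℝ) + 1) * e.choose m = (e + 1).choose (m + 1) * (m + 1) := by
    exact_mod_cast Nat.add_one_mul_choose_eq e m
  have h2 : ((e : ℝ) + 2) * (e + 1).choose (m + 1) = (e + 2).choose (m + 2) * (m + 2) := by
    exact_mod_cast Nat.add_one_mul_choose_eq (e + 1) (m + 1)
  rw [Nat.add_sub_cancel]
  push_cast
  rw [← h2]
  have h3 : (0 : ℝ) ≤ e.choose m := by positivity
  have h4 : (0 : ℝ) ≤ (e + 1).choose (m + 1) := by positivity
  have h5 : ((e : ℝ) + 2) * e.choose m ≤ (e + 1).choose (m + 1) * (2 * (m + 2)) := by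
    have : ((e : ℝ) + 2) * e.choose m ≤ 2 * ((e + 1) * e.choose m) := by nlinarith
    rw [h1] at this
    nlinarith
  have h6 : (0 : ℝ) ≤ (e : ℝ) + 2 := by positivity
  nlinarith [mul_le_mul_of_nonneg_left h5 h6]

theorem choose_le_choose_of_le_half {d i j : ℕ} (hij : i ≤ j) (hj : 2 * j ≤ d) :
    d.choose i ≤ d.choose j := by
  induction j, hij using Nat.le_induction with
  | base => exact le_rfl
  | succ j _ ih =>
    exact (ih (by omega)).trans (Nat.choose_le_succ_of_lt_half_left (by omega))

end Choose

/-! ### Character ratios of permutations with few fixed points -/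

section CharacterRatios

open Finset

variable {X : Type*} [Fintype X] [DecidableEq X]

/-- One round of `mul_invCount_le`, with the trivial bound for the smaller sets. -/
theorem invCount_le_of_pos {m : ℕ} (hm : 0 < m) (hmd : 2 * m ≤ Fintype.card X) (σ : Perm X) :
    (invCount m σ : ℝ) * Fintype.card X
      ≤ (Fintype.card X).choose m * (2 * fixCount σ + 2 * m) := by
  set d := Fintype.card X with hd
  obtain _ | _ | l := m
  · omega
  · have h1 : (invCount 1 σ : ℝ) ≤ fixCount σ := by exact_mod_cast invCount_one_le σ
    have h2 : (0 : ℝ) ≤ d := by positivity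
    have h3 : (0 : ℝ) ≤ fixCount σ := by positivity
    simp only [zero_add, Nat.choose_one_right, Nat.cast_one]
    nlinarith
  · have h1 : ((l : ℝ) + 2) * invCount (l + 2) σ
        ≤ fixCount σ * invCount (l + 1) σ + d * (d - 2).choose l := by
      exact_mod_cast mul_invCount_le l σ
    have h2 : (invCount (l + 1) σ : ℝ) ≤ d.choose (l + 1) := by
      exact_mod_cast invCount_le_choose (l + 1) σ
    have h3 := choose_mul_le_choose_succ (d := d) (m := l + 1) (by omega)
    have h4 := mul_choose_sub_two_le (d := d) (m := l) (by omega)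
    push_cast at h3 ⊢
    have h5 : (0 : ℝ) ≤ fixCount σ := by positivity
    have h6 : (0 : ℝ) < (l : ℝ) + 2 := by positivity
    have h7 : (0 : ℝ) ≤ d := by positivity
    refine le_of_mul_le_mul_left ?_ h6
    calc ((l : ℝ) + 2) * (invCount (l + 2) σ * d)
        = (((l : ℝ) + 2) * invCount (l + 2) σ) * d := by ring
      _ ≤ (fixCount σ * d.choose (l + 1) + d * (d - 2).choose l) * d := by
          refine mul_le_mul_of_nonneg_right (h1.trans ?_) h7
          gcongr
      _ = fixCount σ * (d.choose (l + 1) * d) + d * (d * (d - 2).choose l) := by ring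
      _ ≤ fixCount σ * (d.choose (l + 1 + 1) * (2 * ((l : ℝ) + 1 + 1)))
          + d.choose (l + 2) * (l + 2) * (2 * (l + 2)) := by
          gcongr
      _ = _ := by
          rw [show l + 1 + 1 = l + 2 from rfl]
          ring

/-- The bound for `|χ_k| / χ_k(1)` that comes from counting invariant sets. -/
noncomputable def ratioBound (σ : Perm X) (k : ℕ) : ℝ :=
  (∑ j ∈ range (k + 1), (invCount j σ : ℝ)) / ((Fintype.card X - 1).choose k : ℝ)

theorem ratioBound_nonneg (σ : Perm X) (k : ℕ) : 0 ≤ ratioBound σ k := by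
  unfold ratioBound
  positivity

theorem ratioBound_one_le [Nontrivial X] (σ : Perm X) :
    ratioBound σ 1 ≤ (1 + fixCount σ) / ((Fintype.card X : ℝ) - 1) := by
  have hd : 1 < Fintype.card X := Fintype.one_lt_card
  have h1 : (invCount 1 σ : ℝ) ≤ fixCount σ := by exact_mod_cast invCount_one_le σ
  have h2 : (0 : ℝ) ≤ (Fintype.card X : ℝ) - 1 := by
    rw [sub_nonneg]; exact_mod_cast hd.le
  rw [ratioBound, sum_range_succ, sum_range_one, invCount_zero, Nat.choose_one_right,
    Nat.cast_sub hd.le]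
  push_cast
  gcongr

/-- Two rounds of the recursion give the square of the fixed-point density on the top layer of
invariant sets. The layers below are smaller by a factor of order K² / d already by the trivial
bound. -/
theorem ratioBound_le_of_le {K i : ℕ} (hi : 2 ≤ i) (hiK : i ≤ K) (hid : 2 * i ≤ Fintype.card X)
    (σ : Perm X) :
    ratioBound σ i ≤ 8 * ((fixCount σ : ℝ) / Fintype.card X) ^ 2 +
      16 * (K : ℝ) ^ 2 / Fintype.card X := by
  set d := Fintype.card X with hd
  obtain ⟨l, rfl⟩ := Nat.exists_eq_add_of_le' hi
  have hf : (fixCount σ : ℝ) ≤ d := by exact_mod_cast fixCount_le σ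
  have hf0 : (0 : ℝ) ≤ fixCount σ := by positivity
  have hd0 : (0 : ℝ) < d := by exact_mod_cast (by omega : 0 < d)
  have hl : (l : ℝ) + 2 ≤ K := by exact_mod_cast hiK
  have hl0 : (0 : ℝ) ≤ l := by positivity
  have hC := choose_le_two_mul_choose_pred (d := d) (by omega) hid
  have hCpos : (0 : ℝ) < (d - 1).choose (l + 2) := by
    exact_mod_cast Nat.choose_pos (by omega)
  set C : ℝ := (d.choose (l + 2) : ℝ) with hCdef
  have hC0 : 0 ≤ C := by positivity
  set F : ℝ := (fixCount σ : ℝ)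
  have h3 : (d.choose (l + 1) : ℝ) * d ≤ C * (2 * (l + 2)) := by
    have := choose_mul_le_choose_succ (d := d) (m := l + 1) (by omega)
    push_cast at this
    rw [show (l : ℝ) + 2 = l + 1 + 1 by ring]
    exact this
  have htop : (invCount (l + 2) σ : ℝ) * d ^ 2 ≤ C * (4 * F ^ 2 + 4 * F * K + 2 * K * d) := by
    have h1 : ((l : ℝ) + 2) * invCount (l + 2) σ
        ≤ F * invCount (l + 1) σ + d * (d - 2).choose l := by
      have h := (Nat.cast_le (α := ℝ)).mpr (mul_invCount_le l σ)
      push_cast at h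
      exact h
    have h2 := invCount_le_of_pos (m := l + 1) (by omega) (by omega) σ
    rw [← hd] at h2
    push_cast at h2
    have h4 := mul_choose_sub_two_le (d := d) (m := l) (by omega)
    have h6 : (0 : ℝ) < (l : ℝ) + 2 := by positivity
    refine le_of_mul_le_mul_left ?_ h6
    calc ((l : ℝ) + 2) * (invCount (l + 2) σ * d ^ 2)
        = (((l : ℝ) + 2) * invCount (l + 2) σ) * d ^ 2 := by ring
      _ ≤ (F * invCount (l + 1) σ + d * (d - 2).choose l) * d ^ 2 := by gcongr
      _ = F * (invCount (l + 1) σ * d) * d + d * (d * (d - 2).choose l) * d := by ring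
      _ ≤ F * (d.choose (l + 1) * (2 * F + 2 * (l + 1))) * d
          + C * (l + 2) * (2 * (l + 2)) * d := by gcongr
      _ = F * (2 * F + 2 * (l + 1)) * (d.choose (l + 1) * d)
          + C * (l + 2) * (2 * (l + 2)) * d := by ring
      _ ≤ F * (2 * F + 2 * K) * (C * (2 * (l + 2)))
          + C * (l + 2) * (2 * K) * d := by
          gcongr
          linarith
      _ = _ := by ring
  have hlow : (∑ j ∈ range (l + 2), (invCount j σ : ℝ)) * d ≤ C * (2 * (K : ℝ) ^ 2) := by
    have h1 : (∑ j ∈ range (l + 2), (invCount j σ : ℝ)) ≤ (l + 2) * d.choose (l + 1) := by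
      calc _ ≤ ∑ j ∈ range (l + 2), (d.choose (l + 1) : ℝ) := by
            refine sum_le_sum fun j hj => ?_
            have hj := mem_range.mp hj
            exact_mod_cast (invCount_le_choose j σ).trans
              (choose_le_choose_of_le_half (by omega) (by omega))
        _ = _ := by
            rw [sum_const, card_range, nsmul_eq_mul]
            push_cast
            ring
    calc _ ≤ ((l + 2) * (d.choose (l + 1) : ℝ)) * d := by gcongr
      _ = (l + 2) * (d.choose (l + 1) * d) := by ring
      _ ≤ (l + 2) * (C * (2 * (l + 2))) := by gcongr
      _ = C * (2 * ((l : ℝ) + 2) ^ 2) := by ring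
      _ ≤ _ := by gcongr
  rw [ratioBound, ← hd, div_le_iff₀ hCpos, sum_range_succ]
  have hd2 : (0 : ℝ) < (d : ℝ) ^ 2 := by positivity
  refine le_of_mul_le_mul_right ?_ hd2
  have hK1 : (1 : ℝ) ≤ K := by linarith
  calc _ = (∑ j ∈ range (l + 2), (invCount j σ : ℝ)) * d * d + invCount (l + 2) σ * d ^ 2 := by
        ring
    _ ≤ C * (2 * (K : ℝ) ^ 2) * d + C * (4 * F ^ 2 + 4 * F * K + 2 * K * d) := by gcongr
    _ = C * (2 * (K : ℝ) ^ 2 * d + 4 * F ^ 2 + 4 * F * K + 2 * K * d) := by ring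
    _ ≤ C * (4 * F ^ 2 + 8 * K ^ 2 * d) := by
        refine mul_le_mul_of_nonneg_left ?_ hC0
        have h1 : F * K ≤ K ^ 2 * d := by
          calc F * K ≤ d * K ^ 2 := by
                refine mul_le_mul hf ?_ (by positivity) hd0.le
                nlinarith
            _ = _ := by ring
        have h2 : (K : ℝ) * d ≤ K ^ 2 * d := by
          refine mul_le_mul_of_nonneg_right ?_ hd0.le
          nlinarith
        nlinarith
    _ ≤ (2 * (d - 1).choose (l + 2)) * (4 * F ^ 2 + 8 * K ^ 2 * d) := by gcongr
    _ = _ := by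
        field_simp
        ring

/-- Let each point be chosen with probability p = i / d. The random set has exactly i points with
probability at least 1 / (d + 1), but is invariant with probability at most exp (-p q (d - fixCount
σ)) ≤ exp (-i / 4). This handles all i beyond a multiple of log d. -/
theorem ratioBound_le_exp {i : ℕ} (hi : 0 < i) (hid : 2 * i ≤ Fintype.card X) (σ : Perm X)
    (hf : 2 * fixCount σ ≤ Fintype.card X) :
    ratioBound σ i ≤ 2 * ((Fintype.card X : ℝ) + 1) * Real.exp (-(i / 4 : ℝ)) := by
  set d := Fintype.card X with hd
  have hd0 : (0 : ℝ) < d := by exact_mod_cast (by omega : 0 < d)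
  have hi0 : (0 : ℝ) < i := by exact_mod_cast hi
  have hid' : (2 : ℝ) * i ≤ d := by exact_mod_cast hid
  have hf' : (2 : ℝ) * fixCount σ ≤ d := by exact_mod_cast hf
  have hC := choose_le_two_mul_choose_pred (d := d) (by omega) hid
  have hCpos : (0 : ℝ) < (d - 1).choose i := by
    exact_mod_cast Nat.choose_pos (by omega)
  set p : ℝ := (i : ℝ) / d with hp
  set q : ℝ := 1 - p with hq
  have hp0 : 0 ≤ p := by positivity
  have hp2 : p ≤ 1 / 2 := by
    rw [hp, div_le_iff₀ hd0]; linarith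
  have hpq : p ≤ q := by linarith
  have hq0 : 0 ≤ q := by linarith
  -- Chosen so that p² + q² = 1 - 2 p q ≤ t².
  set t : ℝ := Real.exp (-(p * q)) with ht
  have ht0 : 0 < t := Real.exp_pos _
  have h2 : p ^ 2 + q ^ 2 ≤ t ^ 2 := by
    have h3 : t ^ 2 = Real.exp (-(2 * (p * q))) := by
      rw [ht, ← Real.exp_nat_mul]
      congr 1
      push_cast
      ring
    have h4 := Real.add_one_le_exp (-(2 * (p * q)))
    rw [h3]
    have : p ^ 2 + q ^ 2 = -(2 * (p * q)) + 1 := by rw [hq]; ring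
    linarith
  have hqt : q ≤ t := by
    refine le_of_sq_le_sq ?_ ht0.le
    nlinarith [sq_nonneg p]
  have hsum := sum_invariant_weight_le σ hp0 hq0 (by rw [hq]; ring) (hpq.trans hqt) hqt h2
  rw [← hd] at hsum
  have hmode := one_le_choose_mul_pow_mul_pow (d := d) (k := i) (by omega) (by omega)
  rw [← hp, ← hq] at hmode
  -- Since p ≤ q, sets with fewer than i points weigh at least as much as those with i points.
  have hweight : (∑ j ∈ range (i + 1), (invCount j σ : ℝ)) * (p ^ i * q ^ (d - i))
      ≤ t ^ (d - fixCount σ) := by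
    refine le_trans ?_ hsum
    rw [sum_mul]
    calc _ ≤ ∑ j ∈ range (i + 1), ∑ s ∈ (univ.powersetCard j).filter
            (fun s : Finset X => ∀ x ∈ s, σ x ∈ s), p ^ s.card * q ^ (d - s.card) := by
          refine sum_le_sum fun j hj => ?_
          have hj : j ≤ i := Nat.lt_succ_iff.mp (mem_range.mp hj)
          rw [invCount, ← nsmul_eq_mul, ← sum_const]
          refine sum_le_sum fun s hs => ?_
          rw [(mem_powersetCard.mp (mem_filter.mp hs).1).2]
          obtain ⟨m, rfl⟩ := Nat.exists_eq_add_of_le hj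
          rw [show d - j = (d - (j + m)) + m by omega, pow_add, pow_add]
          have : p ^ m ≤ q ^ m := pow_le_pow_left₀ hp0 hpq m
          calc p ^ j * p ^ m * q ^ (d - (j + m)) ≤ p ^ j * q ^ m * q ^ (d - (j + m)) := by gcongr
            _ = _ := by ring
      _ = ∑ s ∈ univ.filter (fun s : Finset X => (∀ x ∈ s, σ x ∈ s) ∧ s.card ∈ range (i + 1)),
            p ^ s.card * q ^ (d - s.card) := by
          rw [← sum_fiberwise_of_maps_to (t := range (i + 1)) (g := fun s : Finset X => s.card)]
          · refine sum_congr rfl fun j hj => ?_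
            refine sum_congr ?_ fun _ _ => rfl
            ext s
            simp only [mem_filter, mem_powersetCard, subset_univ, true_and, mem_univ]
            constructor
            · rintro ⟨rfl, h⟩
              exact ⟨⟨h, hj⟩, rfl⟩
            · rintro ⟨⟨h, _⟩, h'⟩
              exact ⟨h', h⟩
          · intro s hs
            exact (mem_filter.mp hs).2.2
      _ ≤ _ := by
          refine sum_le_sum_of_subset_of_nonneg ?_ fun _ _ _ => by positivity
          intro s hs
          rw [mem_filter] at hs ⊢
          exact ⟨hs.1, hs.2.1⟩
  have hexp : t ^ (d - fixCount σ) ≤ Real.exp (-(i / 4 : ℝ)) := by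
    rw [ht, ← Real.exp_nat_mul, Real.exp_le_exp, Nat.cast_sub (by omega)]
    have h5 : (i : ℝ) = p * d := by rw [hp]; field_simp
    have h6 : p * (1 / 2) * (d / 2) ≤ p * q * ((d : ℝ) - fixCount σ) := by
      refine mul_le_mul (mul_le_mul_of_nonneg_left (by linarith) hp0) (by linarith)
        (by positivity) (by positivity)
    rw [h5]
    linarith
  rw [ratioBound, ← hd, div_le_iff₀ hCpos]
  set B := ∑ j ∈ range (i + 1), (invCount j σ : ℝ)
  have hB : 0 ≤ B := by positivity
  calc B = B * 1 := (mul_one B).symm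
    _ ≤ B * (((d : ℝ) + 1) * (d.choose i * p ^ i * q ^ (d - i))) := by gcongr
    _ = ((d : ℝ) + 1) * d.choose i * (B * (p ^ i * q ^ (d - i))) := by ring
    _ ≤ ((d : ℝ) + 1) * (2 * (d - 1).choose i) * Real.exp (-(i / 4 : ℝ)) := by
        gcongr
        exact hweight.trans hexp
    _ = _ := by ring

/-- The squared `L²` norm of the nontrivial part of `mixDist σ`. -/
theorem sum_sq_ratio_le [Nontrivial X] (σ : Perm X) (hf : 2 * fixCount σ ≤ Fintype.card X)
    {K : ℕ} :
    ∑ k ∈ Ico 1 (Fintype.card X - 1),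
        (hookChar k σ / ((Fintype.card X - 1).choose k : ℝ)) ^ 2
      ≤ 2 * (((1 + fixCount σ) / ((Fintype.card X : ℝ) - 1)) ^ 2
        + K * (8 * ((fixCount σ : ℝ) / Fintype.card X) ^ 2 +
          16 * (K : ℝ) ^ 2 / Fintype.card X) ^ 2
        + Fintype.card X *
          (2 * ((Fintype.card X : ℝ) + 1) * Real.exp (-(K / 4 : ℝ))) ^ 2) := by
  set d := Fintype.card X with hd
  set A : ℝ := (1 + fixCount σ) / ((d : ℝ) - 1)
  set M : ℝ := 8 * ((fixCount σ : ℝ) / d) ^ 2 + 16 * (K : ℝ) ^ 2 / d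
  set T : ℝ := 2 * ((d : ℝ) + 1) * Real.exp (-(K / 4 : ℝ))
  have hd1 : 1 < d := Fintype.one_lt_card
  -- One majorant for the three ranges i = 1, 2 ≤ i ≤ K and i > K.
  let β : ℕ → ℝ := fun i => (if i = 1 then A ^ 2 else 0) + (if i ≤ K then M ^ 2 else 0) + T ^ 2
  have hβ0 : ∀ i, 0 ≤ β i := by
    intro i
    simp only [β]
    split_ifs <;> positivity
  have hb : ∀ i, 1 ≤ i → 2 * i ≤ d → ratioBound σ i ^ 2 ≤ β i := by
    intro i hi hid
    have h0 := ratioBound_nonneg σ i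
    simp only [β]
    by_cases h1 : i = 1
    · subst h1
      have := pow_le_pow_left₀ h0 (ratioBound_one_le σ) 2
      rw [if_pos rfl]
      split_ifs <;> nlinarith [sq_nonneg M, sq_nonneg T]
    · rw [if_neg h1]
      by_cases h2 : i ≤ K
      · rw [if_pos h2]
        have := pow_le_pow_left₀ h0 (ratioBound_le_of_le (by omega) h2 hid σ) 2
        nlinarith [sq_nonneg T]
      · rw [if_neg h2]
        have h3 := ratioBound_le_exp hi hid σ hf
        have h4 : Real.exp (-(i / 4 : ℝ)) ≤ Real.exp (-(K / 4 : ℝ)) := by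
          rw [Real.exp_le_exp]
          have : (K : ℝ) ≤ i := by exact_mod_cast (not_le.mp h2).le
          linarith
        have h5 : ratioBound σ i ≤ T := h3.trans (mul_le_mul_of_nonneg_left h4 (by positivity))
        have := pow_le_pow_left₀ h0 h5 2
        linarith
  -- The binomial coefficients at k and d - 1 - k agree, so beyond d / 2 the bound
  -- `abs_hookChar_le'` becomes `ratioBound σ (d - 1 - k)`.
  have hterm : ∀ k ∈ Ico 1 (d - 1),
      (hookChar k σ / ((d - 1).choose k : ℝ)) ^ 2 ≤ β k + β (d - 1 - k) := by
    intro k hk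
    obtain ⟨hk1, hk2⟩ := mem_Ico.mp hk
    rw [← sq_abs, abs_div, Nat.abs_cast]
    by_cases h : 2 * k ≤ d
    · have h1 : |hookChar k σ| / ((d - 1).choose k : ℝ) ≤ ratioBound σ k :=
        div_le_div_of_nonneg_right (abs_hookChar_le k σ) (by positivity)
      have h2 := pow_le_pow_left₀ (by positivity) h1 2
      have := hb k hk1 h
      have := hβ0 (d - 1 - k)
      linarith
    · have h1 : |hookChar k σ| / ((d - 1).choose k : ℝ) ≤ ratioBound σ (d - 1 - k) := by
        rw [ratioBound, ← hd, Nat.choose_symm (by omega)]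
        refine div_le_div_of_nonneg_right ?_ (by positivity)
        have := abs_hookChar_le' (d - k) (by omega) σ
        rw [← hd, show d - (d - k) = k by omega] at this
        rwa [show d - 1 - k + 1 = d - k by omega]
      have h2 := pow_le_pow_left₀ (by positivity) h1 2
      have := hb (d - 1 - k) (by omega) (by omega)
      have := hβ0 k
      linarith
  have hreflect : ∑ k ∈ Ico 1 (d - 1), β (d - 1 - k) = ∑ k ∈ Ico 1 (d - 1), β k := by
    refine sum_bij' (fun k _ => d - 1 - k) (fun k _ => d - 1 - k) ?_ ?_ ?_ ?_ ?_
    all_goals intro k hk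
    all_goals have hk := mem_Ico.mp hk
    · rw [mem_Ico]; omega
    · rw [mem_Ico]; omega
    · omega
    · omega
    · rfl
  have hsumβ : ∑ k ∈ Ico 1 (d - 1), β k ≤ A ^ 2 + K * M ^ 2 + d * T ^ 2 := by
    simp only [β, sum_add_distrib]
    refine add_le_add (add_le_add ?_ ?_) ?_
    · rw [sum_ite_eq']
      split_ifs
      · exact le_rfl
      · positivity
    · rw [← sum_filter, sum_const, nsmul_eq_mul]
      refine mul_le_mul_of_nonneg_right ?_ (sq_nonneg M)
      have : ((Ico 1 (d - 1)).filter fun i => i ≤ K) ⊆ Icc 1 K := by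
        intro i hi
        have := mem_Ico.mp (mem_filter.mp hi).1
        exact mem_Icc.mpr ⟨this.1, (mem_filter.mp hi).2⟩
      have := card_le_card this
      rw [Nat.card_Icc, Nat.add_sub_cancel] at this
      exact_mod_cast this
    · rw [sum_const, Nat.card_Ico, nsmul_eq_mul]
      refine mul_le_mul_of_nonneg_right ?_ (sq_nonneg T)
      exact_mod_cast (by omega : d - 1 - 1 ≤ d)
  calc _ ≤ ∑ k ∈ Ico 1 (d - 1), (β k + β (d - 1 - k)) := sum_le_sum hterm
    _ = 2 * ∑ k ∈ Ico 1 (d - 1), β k := by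
        rw [sum_add_distrib, hreflect]
        ring
    _ ≤ _ := mul_le_mul_of_nonneg_left hsumβ (by norm_num)

end CharacterRatios

theorem perm_apply_inv {α : Type*} (e : Perm α) (x : α) : e (e⁻¹ x) = x := e.apply_symm_apply x

theorem perm_inv_apply {α : Type*} (e : Perm α) (x : α) : e⁻¹ (e x) = x := e.symm_apply_apply x

/-! ### Induced permutations of products and conjugates -/

section InducedPerm

variable {X : Type*} [Finite X]

theorem coe_inducedPerm_apply (α : Perm X) (Y : Set X) (y : Y) :
    (inducedPerm α Y y : X) = (α ^ returnTime α Y y) (y : X) := rfl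

theorem not_mem_of_lt_returnTime {α : Perm X} {Y : Set X} {y : Y} {i : ℕ} (hi : 0 < i)
    (h : i < returnTime α Y y) : (α ^ i) (y : X) ∉ Y := fun hm =>
  absurd (returnTime_le α Y y hi hm) (not_le.mpr h)

theorem coe_inducedPerm_eq {α : Perm X} {Y : Set X} {y : Y} {k : ℕ} (hk : 0 < k)
    (hmem : (α ^ k) (y : X) ∈ Y) (hlt : ∀ i, 0 < i → i < k → (α ^ i) (y : X) ∉ Y) :
    (inducedPerm α Y y : X) = (α ^ k) (y : X) := by
  have h1 := returnTime_le α Y y hk hmem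
  have h2 : ¬ returnTime α Y y < k := fun h =>
    hlt _ (returnTime_pos α Y y) h (returnTime_mem α Y y)
  rw [coe_inducedPerm_apply, show returnTime α Y y = k by omega]

theorem coe_inducedPerm_of_invariant {α : Perm X} {Y : Set X} (h : ∀ y ∈ Y, α y ∈ Y) (y : Y) :
    (inducedPerm α Y y : X) = α y := by
  rw [coe_inducedPerm_eq one_pos (by simpa using h y y.2) (by omega), pow_one]

/-- Between two visits to Y the orbit stays where ρ acts trivially, so ρ acts only once, at the
start. -/
theorem inducedPerm_mul_ofSubtype (α : Perm X) (Y : Set X) [DecidablePred (· ∈ Y)] (ρ : Perm Y) :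
    inducedPerm (α * Perm.ofSubtype ρ) Y = inducedPerm α Y * ρ := by
  ext y
  have hpow : ∀ i, 0 < i → i ≤ returnTime α Y (ρ y) →
      ((α * Perm.ofSubtype ρ) ^ i) (y : X) = (α ^ i) (ρ y : X) := by
    intro i hi
    induction i, hi using Nat.le_induction with
    | base =>
      intro _
      rw [pow_one, pow_one, Perm.mul_apply, Perm.ofSubtype_apply_coe]
    | succ i hi ih =>
      intro hle
      have hnot := not_mem_of_lt_returnTime (α := α) (Y := Y) (y := ρ y) hi (by omega)
      rw [pow_succ', Perm.mul_apply, ih (by omega), Perm.mul_apply,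
        Perm.ofSubtype_apply_of_not_mem ρ hnot, pow_succ', Perm.mul_apply]
  have hpos := returnTime_pos α Y (ρ y)
  rw [Perm.mul_apply, coe_inducedPerm_apply α Y (ρ y), ← hpow _ hpos le_rfl]
  refine coe_inducedPerm_eq hpos ?_ ?_
  · rw [hpow _ hpos le_rfl]
    exact returnTime_mem α Y (ρ y)
  · intro i hi hlt
    rw [hpow i hi hlt.le]
    exact not_mem_of_lt_returnTime hi hlt

theorem ofSubtype_apply_mem_iff (Y : Set X) [DecidablePred (· ∈ Y)] (h : Perm Y) (x : X) :
    Perm.ofSubtype h x ∈ Y ↔ x ∈ Y := by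
  by_cases hx : x ∈ Y
  · rw [Perm.ofSubtype_apply_of_mem h hx]
    exact ⟨fun _ => hx, fun _ => Subtype.coe_prop _⟩
  · rw [Perm.ofSubtype_apply_of_not_mem h hx]

theorem inducedPerm_conj (α : Perm X) (Y : Set X) [DecidablePred (· ∈ Y)] (h : Perm Y) :
    inducedPerm (Perm.ofSubtype h * α * (Perm.ofSubtype h)⁻¹) Y
      = h * inducedPerm α Y * h⁻¹ := by
  ext y
  have hpow : ∀ i, ((Perm.ofSubtype h * α * (Perm.ofSubtype h)⁻¹) ^ i) (y : X)
      = Perm.ofSubtype h ((α ^ i) ((h⁻¹ y : Y) : X)) := by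
    intro i
    rw [conj_pow, Perm.mul_apply, Perm.mul_apply, ← map_inv, Perm.ofSubtype_apply_coe]
  rw [Perm.mul_apply, Perm.mul_apply]
  have hpos := returnTime_pos α Y (h⁻¹ y)
  rw [coe_inducedPerm_eq (k := returnTime α Y (h⁻¹ y)) hpos, hpow, ← coe_inducedPerm_apply,
    Perm.ofSubtype_apply_coe]
  · rw [hpow, ofSubtype_apply_mem_iff]
    exact returnTime_mem α Y (h⁻¹ y)
  · intro i hi hlt
    rw [hpow, ofSubtype_apply_mem_iff]
    exact not_mem_of_lt_returnTime hi hlt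

theorem sameCycle_inducedPerm {α : Perm X} {Y : Set X} {y z : Y} :
    (inducedPerm α Y).SameCycle y z ↔ α.SameCycle (y : X) (z : X) := by
  constructor
  · intro h
    obtain ⟨k, rfl⟩ := h.exists_nat_pow_eq
    induction k with
    | zero => exact Perm.SameCycle.refl _ _
    | succ k ih =>
      rw [pow_succ', Perm.mul_apply, coe_inducedPerm_apply]
      exact (ih ⟨k, by simp⟩).trans ⟨(returnTime α Y _ : ℕ), by rw [zpow_natCast]⟩
  · intro h
    obtain ⟨k, hk⟩ := h.exists_nat_pow_eq
    induction k using Nat.strong_induction_on generalizing y with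
    | _ k ih =>
      rcases Nat.eq_zero_or_pos k with rfl | hpos
      · rw [pow_zero, Perm.one_apply] at hk
        rw [Subtype.ext hk]
      · have hle := returnTime_le α Y y hpos (by rw [hk]; exact z.2)
        have hr := returnTime_pos α Y y
        rw [← Perm.sameCycle_apply_left]
        have hk' : (α ^ (k - returnTime α Y y)) (inducedPerm α Y y : X) = z := by
          rw [coe_inducedPerm_apply, ← Perm.mul_apply, ← pow_add, Nat.sub_add_cancel hle, hk]
        exact ih _ (by omega) ⟨(k - returnTime α Y y : ℕ), by rw [zpow_natCast]; exact hk'⟩ hk'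

/-- The part of `Q` away from the invariant set `Y`. -/
noncomputable def eraseOn (Y : Set X) [DecidablePred (· ∈ Y)] (Q : Perm X) : Perm X :=
  Q * (Perm.ofSubtype (inducedPerm Q Y))⁻¹

theorem eraseOn_mul (Y : Set X) [DecidablePred (· ∈ Y)] (Q : Perm X) :
    eraseOn Y Q * Perm.ofSubtype (inducedPerm Q Y) = Q := by
  rw [eraseOn, inv_mul_cancel_right]

theorem eraseOn_apply_of_mem {Y : Set X} [DecidablePred (· ∈ Y)] {Q : Perm X}
    (hQ : ∀ y ∈ Y, Q y ∈ Y) {x : X} (hx : x ∈ Y) : eraseOn Y Q x = x := by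
  rw [eraseOn, Perm.mul_apply, ← map_inv]
  have := coe_inducedPerm_of_invariant hQ ((inducedPerm Q Y)⁻¹ ⟨x, hx⟩)
  rw [perm_apply_inv] at this
  rw [Perm.ofSubtype_apply_of_mem _ hx]
  exact this.symm

theorem eraseOn_apply_of_not_mem {Y : Set X} [DecidablePred (· ∈ Y)] {Q : Perm X} {x : X}
    (hx : x ∉ Y) : eraseOn Y Q x = Q x := by
  rw [eraseOn, Perm.mul_apply, ← map_inv, Perm.ofSubtype_apply_of_not_mem _ hx]

theorem commute_ofSubtype_of_fixes {Y : Set X} [DecidablePred (· ∈ Y)] {Q : Perm X}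
    (hQ : ∀ y ∈ Y, Q y = y) (h : Perm Y) : Perm.ofSubtype h * Q = Q * Perm.ofSubtype h := by
  refine Perm.Disjoint.commute fun x => ?_
  by_cases hx : x ∈ Y
  · exact Or.inr (hQ x hx)
  · exact Or.inl (Perm.ofSubtype_apply_of_not_mem h hx)

/-- Conjugating the part of `Q` on `Y` conjugates one factor of the induced permutation. -/
theorem inducedPerm_mul_conj {Y : Set X} [DecidablePred (· ∈ Y)] {Q : Perm X}
    (hQ : ∀ y ∈ Y, Q y ∈ Y) (E : Perm X) (h : Perm Y) :
    inducedPerm (E * (Perm.ofSubtype h * Q * (Perm.ofSubtype h)⁻¹)) Y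
      = inducedPerm (E * eraseOn Y Q) Y * (h * inducedPerm Q Y * h⁻¹) := by
  have hc := commute_ofSubtype_of_fixes (fun y hy => eraseOn_apply_of_mem hQ hy) h
  have : E * (Perm.ofSubtype h * Q * (Perm.ofSubtype h)⁻¹)
      = (E * eraseOn Y Q) * Perm.ofSubtype (h * inducedPerm Q Y * h⁻¹) := by
    conv_lhs => rw [← eraseOn_mul Y Q]
    rw [← mul_assoc (Perm.ofSubtype h), hc, map_mul, map_mul, map_inv]
    simp only [mul_assoc]
  rw [this, inducedPerm_mul_ofSubtype]

theorem inducedPerm_mul_eq {Y : Set X} [DecidablePred (· ∈ Y)] (Q E : Perm X) :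
    inducedPerm (E * Q) Y = inducedPerm (E * eraseOn Y Q) Y * inducedPerm Q Y := by
  rw [← inducedPerm_mul_ofSubtype, mul_assoc, eraseOn_mul]

end InducedPerm

/-! ### Symmetries of the uniform law on maps -/

section Symmetry

open Finset

variable {V : Type*} [Fintype V] [DecidableEq V] {G : SimpleGraph V} [DecidableRel G.Adj]

theorem ofSubtype_apply_fst {w : V} (h : Perm (dartsAt G w)) (x : DartSet G) :
    (Perm.ofSubtype h x).1 = x.1 := by
  by_cases hx : x ∈ dartsAt G w
  · have h1 := (ofSubtype_apply_mem_iff (dartsAt G w) h x).mpr hx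
    exact (show (Perm.ofSubtype h x).1 = w from h1).trans (show x.1 = w from hx).symm
  · rw [Perm.ofSubtype_apply_of_not_mem h hx]

theorem inv_ofSubtype_apply_fst {w : V} (h : Perm (dartsAt G w)) (x : DartSet G) :
    ((Perm.ofSubtype h)⁻¹ x).1 = x.1 := by
  rw [← map_inv]
  exact ofSubtype_apply_fst _ _

theorem localRotation_apply_fst {R : Perm (DartSet G)} (hR : R ∈ localRotations G)
    (x : DartSet G) : (R x).1 = x.1 :=
  ((hR x (R x)).mp (Perm.sameCycle_apply_right.mpr (Perm.SameCycle.refl _ _))).symm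

theorem localRotation_invariant {R : Perm (DartSet G)} (hR : R ∈ localRotations G) (w : V) :
    ∀ y ∈ dartsAt G w, R y ∈ dartsAt G w := fun y hy =>
  (localRotation_apply_fst hR y).trans hy

theorem isFullCycle_rotation {R : Perm (DartSet G)} (hR : R ∈ localRotations G) (w : V) :
    IsFullCycle (inducedPerm R (dartsAt G w)) := fun x y => by
  rw [sameCycle_inducedPerm, hR]
  exact (show (x : DartSet G).1 = w from x.2).trans (show (y : DartSet G).1 = w from y.2).symm

theorem localRotation_conj {R : Perm (DartSet G)} (hR : R ∈ localRotations G) {w : V}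
    (h : Perm (dartsAt G w)) :
    Perm.ofSubtype h * R * (Perm.ofSubtype h)⁻¹ ∈ localRotations G := fun x y => by
  rw [Perm.sameCycle_conj, hR, inv_ofSubtype_apply_fst, inv_ofSubtype_apply_fst]

theorem edgeScheme_conj {E : Perm (DartSet G)} (hE : E ∈ edgeSchemes G) {w : V}
    (h : Perm (dartsAt G w)) :
    Perm.ofSubtype h * E * (Perm.ofSubtype h)⁻¹ ∈ edgeSchemes G := by
  obtain ⟨h1, h2, h3⟩ := hE
  refine ⟨fun x => ?_, fun x hx => ?_, fun u v huv => ?_⟩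
  · simp [Perm.mul_apply, h1]
  · apply h2 ((Perm.ofSubtype h)⁻¹ x)
    rw [Perm.mul_apply, Perm.mul_apply] at hx
    rw [Perm.eq_inv_iff_eq, hx]
  · obtain ⟨x, ⟨hx1, hx2⟩, hx3⟩ := h3 u v huv
    refine ⟨Perm.ofSubtype h x, ⟨?_, ?_⟩, ?_⟩
    · rw [ofSubtype_apply_fst, hx1]
    · rw [Perm.mul_apply, Perm.mul_apply, perm_inv_apply, ofSubtype_apply_fst, hx2]
    · rintro y ⟨hy1, hy2⟩
      rw [Perm.mul_apply, Perm.mul_apply, ofSubtype_apply_fst] at hy2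
      rw [← hx3 ((Perm.ofSubtype h)⁻¹ y) ⟨by rw [inv_ofSubtype_apply_fst, hy1], hy2⟩,
        perm_apply_inv]

theorem mem_maps {m : Perm (DartSet G) × Perm (DartSet G)} :
    m ∈ maps G ↔ m.1 ∈ localRotations G ∧ m.2 ∈ edgeSchemes G := by
  simp [maps]

/-- The cycle at w may be resampled with everything else kept. By contrast, `sum_maps_conj` relabels
the darts at w in both coordinates, which conjugates ω_w. -/
theorem sum_maps_conj_fst {w : V} (h : Perm (dartsAt G w))
    (Φ : Perm (DartSet G) × Perm (DartSet G) → ℝ) :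
    ∑ m ∈ maps G, Φ (Perm.ofSubtype h * m.1 * (Perm.ofSubtype h)⁻¹, m.2) = ∑ m ∈ maps G, Φ m := by
  refine sum_bij' (fun m _ => (Perm.ofSubtype h * m.1 * (Perm.ofSubtype h)⁻¹, m.2))
    (fun m _ => (Perm.ofSubtype h⁻¹ * m.1 * (Perm.ofSubtype h⁻¹)⁻¹, m.2)) ?_ ?_ ?_ ?_ ?_
  · intro m hm
    obtain ⟨h1, h2⟩ := mem_maps.mp hm
    exact mem_maps.mpr ⟨localRotation_conj h1 h, h2⟩
  · intro m hm
    obtain ⟨h1, h2⟩ := mem_maps.mp hm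
    exact mem_maps.mpr ⟨localRotation_conj h1 h⁻¹, h2⟩
  · intro m _
    refine Prod.ext ?_ rfl
    simp only [map_inv]
    group
  · intro m _
    refine Prod.ext ?_ rfl
    simp only [map_inv]
    group
  · intro m _
    rfl

theorem sum_maps_conj {w : V} (h : Perm (dartsAt G w))
    (Φ : Perm (DartSet G) × Perm (DartSet G) → ℝ) :
    ∑ m ∈ maps G, Φ (Perm.ofSubtype h * m.1 * (Perm.ofSubtype h)⁻¹,
        Perm.ofSubtype h * m.2 * (Perm.ofSubtype h)⁻¹) = ∑ m ∈ maps G, Φ m := by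
  refine sum_bij' (fun m _ => (Perm.ofSubtype h * m.1 * (Perm.ofSubtype h)⁻¹,
      Perm.ofSubtype h * m.2 * (Perm.ofSubtype h)⁻¹))
    (fun m _ => (Perm.ofSubtype h⁻¹ * m.1 * (Perm.ofSubtype h⁻¹)⁻¹,
      Perm.ofSubtype h⁻¹ * m.2 * (Perm.ofSubtype h⁻¹)⁻¹)) ?_ ?_ ?_ ?_ ?_
  · intro m hm
    obtain ⟨h1, h2⟩ := mem_maps.mp hm
    exact mem_maps.mpr ⟨localRotation_conj h1 h, edgeScheme_conj h2 h⟩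
  · intro m hm
    obtain ⟨h1, h2⟩ := mem_maps.mp hm
    exact mem_maps.mpr ⟨localRotation_conj h1 h⁻¹, edgeScheme_conj h2 h⁻¹⟩
  · intro m _
    refine Prod.ext ?_ ?_ <;> simp only [map_inv] <;> group
  · intro m _
    refine Prod.ext ?_ ?_ <;> simp only [map_inv] <;> group
  · intro m _
    rfl

/-- The permutation of the darts at `v` that describes the walks along faces from `v` back to
`v`. -/
noncomputable def returnPerm (v : V) (m : Perm (DartSet G) × Perm (DartSet G)) :
    Perm (dartsAt G v) :=
  inducedPerm (m.2 * eraseOn (dartsAt G v) m.1) (dartsAt G v)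

theorem localFacePerm_eq (v : V) (m : Perm (DartSet G) × Perm (DartSet G)) :
    localFacePerm v m = returnPerm v m * inducedPerm m.1 (dartsAt G v) :=
  inducedPerm_mul_eq _ _

theorem localFacePerm_conj_fst {v : V} {m : Perm (DartSet G) × Perm (DartSet G)} (hm : m ∈ maps G)
    (h : Perm (dartsAt G v)) :
    localFacePerm v (Perm.ofSubtype h * m.1 * (Perm.ofSubtype h)⁻¹, m.2)
      = returnPerm v m * (h * inducedPerm m.1 (dartsAt G v) * h⁻¹) :=
  inducedPerm_mul_conj (localRotation_invariant (mem_maps.mp hm).1 v) _ _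

theorem localFacePerm_conj {v : V} (m : Perm (DartSet G) × Perm (DartSet G))
    (h : Perm (dartsAt G v)) :
    localFacePerm v (Perm.ofSubtype h * m.1 * (Perm.ofSubtype h)⁻¹,
        Perm.ofSubtype h * m.2 * (Perm.ofSubtype h)⁻¹) = h * localFacePerm v m * h⁻¹ := by
  rw [localFacePerm, localFacePerm, ← inducedPerm_conj, facePerm, facePerm]
  congr 1
  group

/-- The probability of `ω_v = τ` is the average of `mixDist (returnPerm v m) τ`. -/
theorem card_filter_localFacePerm_eq {v : V} [Nontrivial (dartsAt G v)] (τ : Perm (dartsAt G v)) :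
    ∑ m ∈ maps G, (if localFacePerm v m = τ then (1 : ℝ) else 0)
      = ∑ m ∈ maps G, mixDist (returnPerm v m) τ := by
  have hN : (Fintype.card (Perm (dartsAt G v)) : ℝ) ≠ 0 := by positivity
  -- Conjugating the whole map by g⁻¹ replaces τ by its conjugate under g, and conjugating R alone
  -- by h randomises its full cycle at v.
  have key : ∀ g h : Perm (dartsAt G v),
      ∑ m ∈ maps G, (if localFacePerm v m = τ then (1 : ℝ) else 0)
        = ∑ m ∈ maps G, (if returnPerm v m * (h * inducedPerm m.1 (dartsAt G v) * h⁻¹)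
            = g * τ * g⁻¹ then (1 : ℝ) else 0) := by
    intro g h
    rw [← sum_maps_conj g⁻¹]
    simp only [localFacePerm_conj]
    rw [← sum_maps_conj_fst h]
    refine sum_congr rfl fun m hm => ?_
    rw [localFacePerm_conj_fst hm]
    refine if_congr ?_ rfl rfl
    constructor
    · intro h'
      rw [← h']
      group
    · intro h'
      rw [h']
      group
  apply mul_left_cancel₀ (pow_ne_zero 2 hN)
  calc _ = ∑ g : Perm (dartsAt G v), ∑ h : Perm (dartsAt G v),
        ∑ m ∈ maps G, (if localFacePerm v m = τ then (1 : ℝ) else 0) := by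
        simp only [sum_const, card_univ, nsmul_eq_mul]
        ring
    _ = ∑ m ∈ maps G, ∑ g : Perm (dartsAt G v), ∑ h : Perm (dartsAt G v),
        (if returnPerm v m * (h * inducedPerm m.1 (dartsAt G v) * h⁻¹)
            = g * τ * g⁻¹ then (1 : ℝ) else 0) := by
        rw [sum_congr rfl fun g _ => sum_congr rfl fun h _ => key g h,
          sum_congr rfl fun g _ => sum_comm, sum_comm]
    _ = _ := by
        rw [mul_sum]
        exact sum_congr rfl fun m hm =>
          sum_sum_indicator_eq_mixDist (isFullCycle_rotation (mem_maps.mp hm).1 v) _ _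

/-- All full cycles have the same sign, so `parityDist (returnPerm v m)` is uniform on the
permutations with the parity of ω_v(m), and only p survives the averaging. -/
theorem parityUniform_oddProb_eq {v : V} [Nontrivial (dartsAt G v)] (hne : (maps G).Nonempty)
    (τ : Perm (dartsAt G v)) :
    parityUniform (dartsAt G v) (oddProb G v) τ
      = (∑ m ∈ maps G, parityDist (returnPerm v m) τ) / ((maps G).card : ℝ) := by
  classical
  have hc : ((maps G).card : ℝ) ≠ 0 := by exact_mod_cast (card_pos.mpr hne).ne'
  have hN : ((Fintype.card (dartsAt G v)).factorial : ℝ) ≠ 0 := by positivity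
  have hpt : ∀ m ∈ maps G, parityDist (returnPerm v m) τ
      = (1 / ((Fintype.card (dartsAt G v)).factorial : ℝ)) *
        (1 + (Perm.sign τ : ℤ) *
          (1 - 2 * (if Perm.sign (localFacePerm v m) = -1 then (1 : ℝ) else 0))) := by
    intro m hm
    have h1 : ((Perm.sign (localFacePerm v m) : ℤ) : ℝ)
        = (-1) ^ (Fintype.card (dartsAt G v) - 1) * (Perm.sign (returnPerm v m) : ℤ) := by
      rw [localFacePerm_eq, map_mul, Units.val_mul, Int.cast_mul,
        (isFullCycle_rotation (mem_maps.mp hm).1 v).sign_eq, mul_comm]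
    have h2 : (1 - 2 * (if Perm.sign (localFacePerm v m) = -1 then (1 : ℝ) else 0))
        = ((Perm.sign (localFacePerm v m) : ℤ) : ℝ) := by
      rcases Int.units_eq_one_or (Perm.sign (localFacePerm v m)) with h | h
      · rw [h, if_neg (by decide)]; simp
      · rw [h, if_pos rfl]; norm_num
    rw [parityDist, h2, h1, Fintype.card_perm]
    ring
  have hsum : ∑ m ∈ maps G, (if Perm.sign (localFacePerm v m) = -1 then (1 : ℝ) else 0)
      = oddProb G v * (maps G).card := by
    rw [oddProb, prob, div_mul_cancel₀ _ hc, sum_boole]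
    congr
  rw [sum_congr rfl hpt, ← mul_sum, sum_add_distrib, ← mul_sum, sum_sub_distrib, ← mul_sum, hsum,
    sum_const, nsmul_eq_mul, mul_one, parityUniform]
  rcases Int.units_eq_one_or (Perm.sign τ) with h | h
  · rw [h, if_neg (by decide)]
    simp only [Units.val_one, Int.cast_one]
    field_simp
    ring
  · rw [h, if_pos rfl]
    simp only [Units.val_neg, Units.val_one, Int.cast_neg, Int.cast_one]
    field_simp
    ring

theorem tvDist_le_average {v : V} [Nontrivial (dartsAt G v)] (hne : (maps G).Nonempty) :
    tvDist (localFaceDist G v) (parityUniform (dartsAt G v) (oddProb G v))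
      ≤ (∑ m ∈ maps G, (1 / 2) * ∑ τ, |mixDist (returnPerm v m) τ - parityDist (returnPerm v m) τ|)
        / ((maps G).card : ℝ) := by
  classical
  have hc : (0 : ℝ) < ((maps G).card : ℝ) := by exact_mod_cast card_pos.mpr hne
  have h1 : ∀ τ, |localFaceDist G v τ - parityUniform (dartsAt G v) (oddProb G v) τ|
      ≤ (∑ m ∈ maps G, |mixDist (returnPerm v m) τ - parityDist (returnPerm v m) τ|)
        / ((maps G).card : ℝ) := by
    intro τ
    have h2 : localFaceDist G v τ
        = (∑ m ∈ maps G, mixDist (returnPerm v m) τ) / ((maps G).card : ℝ) := by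
      rw [← card_filter_localFacePerm_eq, localFaceDist, prob, sum_boole]
      congr
    rw [h2, parityUniform_oddProb_eq hne, ← sub_div, ← sum_sub_distrib, abs_div,
      abs_of_pos hc]
    exact div_le_div_of_nonneg_right (abs_sum_le_sum_abs _ _) hc.le
  rw [tvDist, ← mul_sum, sum_comm, mul_div_assoc, sum_div]
  exact mul_le_mul_of_nonneg_left (sum_le_sum fun τ _ => h1 τ) (by norm_num)

end Symmetry

/-! ### The expected number of fixed points of the return permutation -/

section FixedPoints

open Finset

variable {V : Type*} [Fintype V] [DecidableEq V] {G : SimpleGraph V} [DecidableRel G.Adj]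

theorem card_dartsAt (v : V) : Fintype.card (dartsAt G v) = G.degree v := by
  have e : {x : DartSet G // x.1 = v} ≃ Fin (G.degree v) := Equiv.sigmaSubtype v
  rw [← Fintype.card_fin (G.degree v)]
  exact Fintype.card_congr e

/-- The definition only supplies one dart for each neighbour. As a vertex has exactly as many darts
as neighbours, these are all its darts. -/
theorem edgeScheme_adj {E : Perm (DartSet G)} (hE : E ∈ edgeSchemes G) (x : DartSet G) :
    G.Adj x.1 (E x).1 := by
  obtain ⟨-, -, h⟩ := hE
  have hex : ∀ u : G.neighborSet x.1, ∃ y : DartSet G, y.1 = x.1 ∧ (E y).1 = u := fun u =>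
    (h x.1 u u.2).exists
  choose c hc1 hc2 using hex
  let c' : G.neighborSet x.1 → dartsAt G x.1 := fun u => ⟨c u, hc1 u⟩
  have hinj : Function.Injective c' := by
    intro u u' huu
    have : c u = c u' := congrArg Subtype.val huu
    exact Subtype.ext (by rw [← hc2 u, ← hc2 u', this])
  have hcard : Fintype.card (G.neighborSet x.1) = Fintype.card (dartsAt G x.1) := by
    rw [card_dartsAt, G.card_neighborSet_eq_degree]
  obtain ⟨u, hu⟩ := ((Fintype.bijective_iff_injective_and_card c').mpr ⟨hinj, hcard⟩).2 ⟨x, rfl⟩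
  have hu' : c u = x := congrArg Subtype.val hu
  have := hc2 u
  rw [hu'] at this
  rw [this]
  exact u.2

theorem edgeScheme_inj {E : Perm (DartSet G)} (hE : E ∈ edgeSchemes G) {x y : DartSet G}
    (h1 : x.1 = y.1) (h2 : (E x).1 = (E y).1) : x = y :=
  (hE.2.2 x.1 (E x).1 (edgeScheme_adj hE x)).unique ⟨rfl, rfl⟩ ⟨h1.symm, h2.symm⟩

/-- The face permutation after the rotation at `v` has been replaced by the identity. -/
noncomputable def splitPerm (v : V) (m : Perm (DartSet G) × Perm (DartSet G)) :
    Perm (DartSet G) :=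
  m.2 * eraseOn (dartsAt G v) m.1

open Classical in
/-- The number of darts at the vertex of `x` on the cycle of `φ` through `x`. -/
noncomputable def dartCycleCard (φ : Perm (DartSet G)) (x : DartSet G) : ℕ :=
  (univ.filter fun y : DartSet G => y.1 = x.1 ∧ φ.SameCycle x y).card

theorem cycleCard_inducedPerm (φ : Perm (DartSet G)) {w : V} (z : dartsAt G w) :
    cycleCard (inducedPerm φ (dartsAt G w)) z = dartCycleCard φ (z : DartSet G) := by
  classical
  rw [cycleCard, dartCycleCard]
  refine card_bij (fun y _ => (y : DartSet G)) ?_ ?_ ?_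
  · intro y hy
    have hy := (mem_filter.mp hy).2
    refine mem_filter.mpr ⟨mem_univ _, ?_, sameCycle_inducedPerm.mp hy⟩
    exact (show (y : DartSet G).1 = w from y.2).trans (show (z : DartSet G).1 = w from z.2).symm
  · intro y _ y' _ h
    exact Subtype.ext h
  · intro y hy
    obtain ⟨-, hy1, hy2⟩ := mem_filter.mp hy
    have hyw : y ∈ dartsAt G w := hy1.trans (show (z : DartSet G).1 = w from z.2)
    exact ⟨⟨y, hyw⟩, mem_filter.mpr ⟨mem_univ _, sameCycle_inducedPerm.mpr hy2⟩, rfl⟩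

theorem eraseOn_conj_of_ne {v w : V} (hvw : w ≠ v) (Q : Perm (DartSet G))
    (hQ : Q ∈ localRotations G) (h : Perm (dartsAt G w)) :
    eraseOn (dartsAt G v) (Perm.ofSubtype h * Q * (Perm.ofSubtype h)⁻¹)
      = Perm.ofSubtype h * eraseOn (dartsAt G v) Q * (Perm.ofSubtype h)⁻¹ := by
  have hfix : ∀ x : DartSet G, x.1 = v → Perm.ofSubtype h x = x := by
    intro x hx
    refine Perm.ofSubtype_apply_of_not_mem h ?_
    rintro (rfl : x.1 = w)
    exact hvw hx
  have hfix' : ∀ x : DartSet G, x.1 = v → (Perm.ofSubtype h)⁻¹ x = x := by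
    intro x hx
    rw [Perm.inv_eq_iff_eq, hfix x hx]
  ext1 x
  by_cases hx : x ∈ dartsAt G v
  · have hx' : x.1 = v := hx
    rw [eraseOn_apply_of_mem (localRotation_invariant (localRotation_conj hQ h) v) hx,
      Perm.mul_apply, Perm.mul_apply, hfix' x hx',
      eraseOn_apply_of_mem (localRotation_invariant hQ v) hx, hfix x hx']
  · rw [eraseOn_apply_of_not_mem hx, Perm.mul_apply, Perm.mul_apply, Perm.mul_apply,
      Perm.mul_apply, eraseOn_apply_of_not_mem]
    intro h'
    exact hx ((inv_ofSubtype_apply_fst h x).symm.trans h')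

theorem eraseOn_apply_fst {R : Perm (DartSet G)} (hR : R ∈ localRotations G) (v : V)
    (x : DartSet G) : (eraseOn (dartsAt G v) R x).1 = x.1 := by
  by_cases hx : x ∈ dartsAt G v
  · rw [eraseOn_apply_of_mem (localRotation_invariant hR v) hx]
  · rw [eraseOn_apply_of_not_mem hx, localRotation_apply_fst hR]

theorem inducedPerm_eraseOn_of_ne {v w : V} (hvw : w ≠ v) {R : Perm (DartSet G)}
    (hR : R ∈ localRotations G) :
    inducedPerm (eraseOn (dartsAt G v) R) (dartsAt G w) = inducedPerm R (dartsAt G w) := by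
  ext1 y
  apply Subtype.ext
  have hy : (y : DartSet G).1 = w := y.2
  have h2 := coe_inducedPerm_of_invariant (Y := dartsAt G w) (α := eraseOn (dartsAt G v) R)
    (fun z hz => (eraseOn_apply_fst hR v z).trans hz) y
  rw [coe_inducedPerm_of_invariant (localRotation_invariant hR w), h2,
    eraseOn_apply_of_not_mem]
  intro h'
  exact hvw (hy.symm.trans h')

/-- Resampling the rotation at `w` in the graph that is split at `v`. -/
theorem sum_maps_resample {v w : V} (hvw : w ≠ v)
    (Φ : Perm (DartSet G) → Perm (dartsAt G w) → ℝ) (B : Perm (DartSet G) → ℝ)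
    (hΦ : ∀ E (σ ρ : Perm (dartsAt G w)), IsFullCycle ρ →
      ∑ h : Perm (dartsAt G w), Φ E (σ * (h * ρ * h⁻¹))
        ≤ (Fintype.card (Perm (dartsAt G w)) : ℝ) * B E) :
    ∑ m ∈ maps G, Φ m.2 (inducedPerm (splitPerm v m) (dartsAt G w)) ≤ ∑ m ∈ maps G, B m.2 := by
  have hN : (0 : ℝ) < (Fintype.card (Perm (dartsAt G w)) : ℝ) := by
    exact_mod_cast Fintype.card_pos
  refine le_of_mul_le_mul_left ?_ hN
  calc _ = ∑ h : Perm (dartsAt G w), ∑ m ∈ maps G,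
        Φ m.2 (inducedPerm (splitPerm v m) (dartsAt G w)) := by
        rw [sum_const, card_univ, nsmul_eq_mul]
    _ = ∑ m ∈ maps G, ∑ h : Perm (dartsAt G w), Φ m.2 (inducedPerm
          (splitPerm v (Perm.ofSubtype h * m.1 * (Perm.ofSubtype h)⁻¹, m.2)) (dartsAt G w)) := by
        rw [sum_comm (s := maps G)]
        exact sum_congr rfl fun h _ => (sum_maps_conj_fst h
          fun m => Φ m.2 (inducedPerm (splitPerm v m) (dartsAt G w))).symm
    _ ≤ ∑ m ∈ maps G, (Fintype.card (Perm (dartsAt G w)) : ℝ) * B m.2 := by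
        refine sum_le_sum fun m hm => ?_
        have hR := (mem_maps.mp hm).1
        -- The factor in front of the conjugated cycle does not involve h; it is the σ to which `hΦ`
        -- is applied.
        have h1 : ∀ h : Perm (dartsAt G w), inducedPerm
            (splitPerm v (Perm.ofSubtype h * m.1 * (Perm.ofSubtype h)⁻¹, m.2)) (dartsAt G w)
            = inducedPerm (m.2 * eraseOn (dartsAt G w) (eraseOn (dartsAt G v) m.1))
                (dartsAt G w) * (h * inducedPerm m.1 (dartsAt G w) * h⁻¹) := by
          intro h
          rw [splitPerm, eraseOn_conj_of_ne hvw m.1 hR, inducedPerm_mul_conj,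
            inducedPerm_eraseOn_of_ne hvw hR]
          exact fun z hz => (eraseOn_apply_fst hR v z).trans hz
        rw [sum_congr rfl fun h _ => by rw [h1 h]]
        exact hΦ _ _ _ (isFullCycle_rotation hR w)
    _ = _ := by rw [mul_sum]

theorem sum_dartsAt {w : V} (g : DartSet G → ℝ) :
    ∑ z : dartsAt G w, g z = ∑ x ∈ univ.filter (fun x : DartSet G => x.1 = w), g x :=
  (sum_subtype _ (by simp) g).symm

theorem sum_sum_dartsAt_ne {v : V} (g : DartSet G → ℝ) :
    ∑ w ∈ univ.erase v, ∑ z : dartsAt G w, g z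
      = ∑ x ∈ univ.filter (fun x : DartSet G => x.1 ≠ v), g x := by
  rw [← sum_fiberwise_of_maps_to (t := univ.erase v) (g := fun x : DartSet G => x.1)]
  · refine sum_congr rfl fun w hw => ?_
    rw [sum_dartsAt, filter_filter]
    refine sum_congr ?_ fun _ _ => rfl
    ext x
    simp only [mem_filter, mem_univ, true_and]
    exact ⟨fun h => ⟨h ▸ (mem_erase.mp hw).1, h⟩, fun h => h.2⟩
  · intro x hx
    exact mem_erase.mpr ⟨(mem_filter.mp hx).2, mem_univ _⟩

/-- The inner sum counts the pairs of a vertex w ≠ v and a cycle of the split permutation through w.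
-/
theorem sum_maps_inv_dartCycleCard_le {d : ℕ} (hd : 2 ≤ d) (hdeg : ∀ w, G.degree w = d) (v : V) :
    ∑ m ∈ maps G, ∑ x ∈ univ.filter (fun x : DartSet G => x.1 ≠ v),
        (1 : ℝ) / dartCycleCard (splitPerm v m) x
      ≤ ((maps G).card : ℝ) * ((Fintype.card V - 1 : ℕ) * (2 * Real.log d + 4)) := by
  have hw : ∀ w ∈ univ.erase v, ∑ m ∈ maps G, ∑ z : dartsAt G w,
      (1 : ℝ) / dartCycleCard (splitPerm v m) (z : DartSet G)
      ≤ ((maps G).card : ℝ) * (2 * Real.log d + 4) := by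
    intro w hw
    have hcard : Fintype.card (dartsAt G w) = d := (card_dartsAt w).trans (hdeg w)
    have : Nontrivial (dartsAt G w) := Fintype.one_lt_card_iff_nontrivial.mp (by omega)
    have := sum_maps_resample (G := G) (mem_erase.mp hw).1
      (fun _ ω => ∑ z : dartsAt G w, (1 : ℝ) / cycleCard ω z) (fun _ => 2 * Real.log d + 4)
      (fun E σ ρ hρ => by
        have := sum_conj_inv_cycleCard_le hρ σ
        rwa [hcard] at this)
    simp only [cycleCard_inducedPerm] at this
    rwa [sum_const, nsmul_eq_mul] at this
  rw [sum_congr rfl fun m _ => (sum_sum_dartsAt_ne _).symm, sum_comm]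
  refine (sum_le_sum hw).trans (le_of_eq ?_)
  rw [sum_const, card_erase_of_mem (mem_univ v), card_univ, nsmul_eq_mul]
  ring

/-- Resampling a rotation leaves E alone, so the event that x is joined to v is a fixed weight on
the probability of a short cycle, and at most d darts have this weight. -/
theorem sum_maps_short_le {d J : ℕ} (hd : 2 ≤ d) (hJ : J < d) (hdeg : ∀ w, G.degree w = d)
    (v : V) :
    ∑ m ∈ maps G, ∑ x ∈ univ.filter (fun x : DartSet G => x.1 ≠ v),
        (if (m.2 x).1 = v then (1 : ℝ) else 0) *
          (if dartCycleCard (splitPerm v m) x ≤ J then (1 : ℝ) else 0)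
      ≤ ((maps G).card : ℝ) * (d * (J / (d - J))) := by
  have hJ' : (J : ℝ) < d := by exact_mod_cast hJ
  have hq : (0 : ℝ) ≤ J / (d - J) := div_nonneg (by positivity) (by linarith)
  have hw : ∀ w ∈ univ.erase v, ∑ m ∈ maps G, ∑ z : dartsAt G w,
      (if (m.2 z).1 = v then (1 : ℝ) else 0) *
        (if dartCycleCard (splitPerm v m) z ≤ J then (1 : ℝ) else 0)
      ≤ ∑ m ∈ maps G, ∑ z : dartsAt G w, (if (m.2 z).1 = v then (1 : ℝ) else 0) *
        (J / (d - J)) := by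
    intro w hw
    have hcard : Fintype.card (dartsAt G w) = d := (card_dartsAt w).trans (hdeg w)
    have : Nontrivial (dartsAt G w) := Fintype.one_lt_card_iff_nontrivial.mp (by omega)
    have := sum_maps_resample (mem_erase.mp hw).1
      (fun E ω => ∑ z : dartsAt G w, (if (E z).1 = v then (1 : ℝ) else 0) *
        (if cycleCard ω z ≤ J then (1 : ℝ) else 0))
      (fun E => ∑ z : dartsAt G w, (if (E z).1 = v then (1 : ℝ) else 0) * (J / (d - J)))
      (fun E σ ρ hρ => by
        rw [sum_comm, mul_sum]
        refine sum_le_sum fun z _ => ?_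
        have h1 := sum_conj_cycleCard_le_le hρ σ z (J := J) (by omega)
        rw [hcard] at h1
        rw [← mul_sum, mul_left_comm]
        exact mul_le_mul_of_nonneg_left h1 (by split_ifs <;> norm_num))
    simp only [cycleCard_inducedPerm] at this
    exact this
  rw [sum_congr rfl fun m _ => (sum_sum_dartsAt_ne (v := v) fun x =>
    (if (m.2 x).1 = v then (1 : ℝ) else 0) *
          (if dartCycleCard (splitPerm v m) x ≤ J then (1 : ℝ) else 0)).symm, sum_comm]
  refine (sum_le_sum hw).trans ?_
  rw [sum_comm, ← nsmul_eq_mul, ← sum_const]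
  refine sum_le_sum fun m _ => ?_
  rw [sum_sum_dartsAt_ne (v := v) fun x => (if (m.2 x).1 = v then (1 : ℝ) else 0) *
    ((J : ℝ) / (d - J)), ← sum_mul]
  refine mul_le_mul_of_nonneg_right ?_ hq
  rw [sum_boole]
  have h1 : ((univ.filter fun x : DartSet G => x.1 ≠ v).filter fun x => (m.2 x).1 = v).card
      ≤ (univ.filter fun x : DartSet G => x.1 = v).card := by
    refine card_le_card_of_injOn m.2 ?_ m.2.injective.injOn
    intro x hx
    exact mem_coe.mpr (mem_filter.mpr ⟨mem_univ _, (mem_filter.mp (mem_coe.mp hx)).2⟩)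
  have h2 : (univ.filter fun x : DartSet G => x.1 = v).card = d := by
    rw [← hdeg v, ← card_dartsAt v]
    exact (Fintype.card_subtype _).symm
  exact_mod_cast h1.trans_eq h2

theorem inv_dartCycleCard_sum (φ : Perm (DartSet G)) {w : V} {y : DartSet G}
    [DecidableRel φ.SameCycle] (hw : ∃ x : DartSet G, x.1 = w ∧ φ.SameCycle y x) :
    ∑ x ∈ univ.filter (fun x : DartSet G => x.1 = w ∧ φ.SameCycle y x),
      (1 : ℝ) / dartCycleCard φ x = 1 := by
  classical
  have h1 : ∀ x ∈ univ.filter (fun x : DartSet G => x.1 = w ∧ φ.SameCycle y x),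
      (1 : ℝ) / dartCycleCard φ x
        = 1 / (univ.filter (fun x : DartSet G => x.1 = w ∧ φ.SameCycle y x)).card := by
    intro x hx
    obtain ⟨-, hxw, hxy⟩ := mem_filter.mp hx
    have : dartCycleCard φ x
        = (univ.filter (fun x : DartSet G => x.1 = w ∧ φ.SameCycle y x)).card := by
      rw [dartCycleCard]
      congr 1
      ext z
      simp only [mem_filter, mem_univ, true_and, hxw]
      exact and_congr_right fun _ => ⟨fun h => hxy.trans h, fun h => hxy.symm.trans h⟩
    rw [this]
  obtain ⟨x, hx⟩ := hw
  have hpos : 0 < (univ.filter (fun x : DartSet G => x.1 = w ∧ φ.SameCycle y x)).card :=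
    card_pos.mpr ⟨x, mem_filter.mpr ⟨mem_univ _, hx⟩⟩
  rw [sum_congr rfl h1, sum_const, nsmul_eq_mul, mul_one_div_cancel]
  exact_mod_cast hpos.ne'

/-- A fixed point y is the only dart of v on its cycle of the split permutation, which goes from y
to the dart E y at another vertex. Cycles with at most J darts at that vertex are counted by the
first sum. Any other cycle leaves that vertex towards more than J distinct vertices, so it meets at
least J vertices besides v. As distinct fixed points have distinct cycles, J times the number of
these long cycles is at most the number of pairs of a vertex and a cycle through it, which is the
second sum. -/
theorem fixCount_returnPerm_le {v : V} {m : Perm (DartSet G) × Perm (DartSet G)}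
    (hm : m ∈ maps G) {J : ℕ} (hJ : 0 < J) :
    (fixCount (returnPerm v m) : ℝ)
      ≤ ∑ x ∈ univ.filter (fun x : DartSet G => x.1 ≠ v),
          (if (m.2 x).1 = v then (1 : ℝ) else 0) *
            (if dartCycleCard (splitPerm v m) x ≤ J then (1 : ℝ) else 0)
        + (∑ x ∈ univ.filter (fun x : DartSet G => x.1 ≠ v),
            (1 : ℝ) / dartCycleCard (splitPerm v m) x) / J := by
  classical
  obtain ⟨hR, hE⟩ := mem_maps.mp hm
  set φ := splitPerm v m with hφ
  let F : Finset (dartsAt G v) := univ.filter fun y => returnPerm v m y = y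
  have hEy : ∀ y : dartsAt G v, (m.2 y).1 ≠ v := by
    intro y h
    have hadj := edgeScheme_adj hE (y : DartSet G)
    rw [h, show (y : DartSet G).1 = v from y.2] at hadj
    exact G.loopless.irrefl v hadj
  have hφy : ∀ y : dartsAt G v, φ y = m.2 y := by
    intro y
    rw [hφ, splitPerm, Perm.mul_apply, eraseOn_apply_of_mem (localRotation_invariant hR v) y.2]
  have hshort : ((F.filter fun y : dartsAt G v => dartCycleCard φ (m.2 (y : DartSet G)) ≤ J).card : ℝ)
      ≤ ∑ x ∈ univ.filter (fun x : DartSet G => x.1 ≠ v),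
          (if (m.2 x).1 = v then (1 : ℝ) else 0) *
            (if dartCycleCard φ x ≤ J then (1 : ℝ) else 0) := by
    have h1 : ∀ x : DartSet G, (if (m.2 x).1 = v then (1 : ℝ) else 0) *
        (if dartCycleCard φ x ≤ J then (1 : ℝ) else 0)
        = if (m.2 x).1 = v ∧ dartCycleCard φ x ≤ J then 1 else 0 := by
      intro x
      by_cases h1 : (m.2 x).1 = v <;> by_cases h2 : dartCycleCard φ x ≤ J <;> simp [h1, h2]
    rw [sum_congr rfl fun x _ => h1 x, sum_boole]
    have : (F.filter fun y : dartsAt G v => dartCycleCard φ (m.2 (y : DartSet G)) ≤ J).card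
        ≤ ((univ.filter fun x : DartSet G => x.1 ≠ v).filter
          fun x => (m.2 x).1 = v ∧ dartCycleCard φ x ≤ J).card := by
      refine card_le_card_of_injOn (fun y : dartsAt G v => m.2 (y : DartSet G)) ?_ ?_
      · intro y hy
        have hy := (mem_filter.mp (mem_coe.mp hy)).2
        refine mem_coe.mpr (mem_filter.mpr ⟨mem_filter.mpr ⟨mem_univ _, hEy y⟩, ?_, hy⟩)
        rw [hE.1]
        exact y.2
      · intro y _ y' _ h
        exact Subtype.ext (m.2.injective h)
    exact_mod_cast this
  let B : Finset (dartsAt G v) := F.filter fun y : dartsAt G v => ¬ dartCycleCard φ (m.2 (y : DartSet G)) ≤ J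
  let W : dartsAt G v → V → Prop := fun y w => ∃ x : DartSet G, x.1 = w ∧ φ.SameCycle y x
  have hW : ∀ y ∈ B, J ≤ ((univ.erase v).filter fun w => W y w).card := by
    intro y hy
    have hlong := not_le.mp (mem_filter.mp hy).2
    have hsub : ((univ.filter fun x : DartSet G => x.1 = (m.2 y).1 ∧ φ.SameCycle (m.2 y) x).image
        fun x => (φ x).1).erase v ⊆ (univ.erase v).filter fun w => W y w := by
      intro w hw
      obtain ⟨hwv, hw⟩ := mem_erase.mp hw
      obtain ⟨x, hx, rfl⟩ := mem_image.mp hw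
      have hx2 := (mem_filter.mp hx).2.2
      refine mem_filter.mpr ⟨mem_erase.mpr ⟨hwv, mem_univ _⟩, φ x, rfl, ?_⟩
      rw [Perm.sameCycle_apply_right]
      rw [← hφy, Perm.sameCycle_apply_left] at hx2
      exact hx2
    -- Simplicity of the graph enters here: distinct darts at one vertex are joined to distinct
    -- vertices.
    have hinj : Set.InjOn (fun x : DartSet G => (φ x).1)
        (univ.filter fun x : DartSet G => x.1 = (m.2 y).1 ∧ φ.SameCycle (m.2 y) x) := by
      intro x hx x' hx' h
      have hx1 := (mem_filter.mp (mem_coe.mp hx)).2.1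
      have hx1' := (mem_filter.mp (mem_coe.mp hx')).2.1
      apply (eraseOn (dartsAt G v) m.1).injective
      refine edgeScheme_inj hE ?_ h
      rw [eraseOn_apply_fst hR, eraseOn_apply_fst hR, hx1, hx1']
    refine le_trans ?_ (card_le_card hsub)
    -- Discarding v loses at most one vertex, which the strict inequality in `hlong` makes up for.
    refine le_trans ?_ pred_card_le_card_erase
    rw [card_image_of_injOn hinj]
    have : J < (univ.filter fun x : DartSet G =>
        x.1 = (m.2 y).1 ∧ φ.SameCycle (m.2 y) x).card := hlong
    omega
  have hlong : (J : ℝ) * B.card ≤ ∑ x ∈ univ.filter (fun x : DartSet G => x.1 ≠ v),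
      (1 : ℝ) / dartCycleCard φ x := by
    rw [← sum_sum_dartsAt_ne]
    have hw : ∀ w ∈ univ.erase v, ((B.filter fun y => W y w).card : ℝ)
        ≤ ∑ z : dartsAt G w, (1 : ℝ) / dartCycleCard φ (z : DartSet G) := by
      intro w _
      rw [sum_dartsAt fun x => (1 : ℝ) / dartCycleCard φ x]
      have h1 : ((B.filter fun y => W y w).card : ℝ) = ∑ y ∈ B.filter fun y => W y w,
          ∑ x ∈ univ.filter (fun x : DartSet G => x.1 = w ∧ φ.SameCycle y x),
            (1 : ℝ) / dartCycleCard φ x := by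
        rw [card_eq_sum_ones]
        push_cast
        refine sum_congr rfl fun y hy => ?_
        exact (inv_dartCycleCard_sum φ (mem_filter.mp hy).2).symm
      rw [h1, ← sum_biUnion]
      · refine sum_le_sum_of_subset_of_nonneg ?_ fun _ _ _ => by positivity
        intro x hx
        obtain ⟨y, -, hx⟩ := mem_biUnion.mp hx
        exact mem_filter.mpr ⟨mem_univ _, (mem_filter.mp hx).2.1⟩
      -- Two fixed points of the induced permutation on one cycle of φ would lie on one cycle of the
      -- induced permutation, hence coincide.
      · intro y hy y' hy' hne
        refine disjoint_left.mpr fun x hx hx' => hne ?_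
        have h2 := (mem_filter.mp hx).2.2.trans (mem_filter.mp hx').2.2.symm
        have hy := (mem_filter.mp (mem_filter.mp (mem_filter.mp (mem_coe.mp hy)).1).1).2
        exact (sameCycle_inducedPerm.mpr h2).eq_of_left hy
    refine le_trans ?_ (sum_le_sum hw)
    have hdc := sum_card_bipartiteAbove_eq_sum_card_bipartiteBelow (s := B)
      (t := univ.erase v) W
    simp only [bipartiteAbove, bipartiteBelow] at hdc
    have h3 : J * B.card ≤ ∑ w ∈ univ.erase v, (B.filter fun y => W y w).card := by
      rw [← hdc, mul_comm, ← smul_eq_mul, ← sum_const]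
      exact sum_le_sum hW
    exact_mod_cast h3
  have hsplit : (fixCount (returnPerm v m) : ℝ)
      = (F.filter fun y : dartsAt G v => dartCycleCard φ (m.2 (y : DartSet G)) ≤ J).card + B.card := by
    have := card_filter_add_card_filter_not (s := F) fun y : dartsAt G v => dartCycleCard φ (m.2 y) ≤ J
    rw [fixCount]
    exact_mod_cast this.symm
  rw [hsplit]
  refine add_le_add hshort ?_
  rw [le_div_iff₀ (by exact_mod_cast hJ), mul_comm]
  exact hlong

/-- The expected number of fixed points of `returnPerm v m`. -/
theorem sum_maps_fixCount_le {d J : ℕ} (hd : 2 ≤ d) (hJ0 : 0 < J) (hJ : J < d)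
    (hdeg : ∀ w, G.degree w = d) (v : V) :
    ∑ m ∈ maps G, (fixCount (returnPerm v m) : ℝ)
      ≤ ((maps G).card : ℝ) * (d * (J / (d - J)) +
        (Fintype.card V - 1 : ℕ) * (2 * Real.log d + 4) / J) := by
  refine (sum_le_sum fun m hm => fixCount_returnPerm_le hm hJ0).trans ?_
  rw [sum_add_distrib, ← sum_div, mul_add]
  refine add_le_add (sum_maps_short_le hd hJ hdeg v) ?_
  exact (div_le_div_of_nonneg_right (sum_maps_inv_dartCycleCard_le hd hdeg v)
    (Nat.cast_nonneg J)).trans_eq (by ring)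

end FixedPoints

/-! ### Existence of maps, so that the averages make sense -/

section Existence

open Finset

variable {V : Type*} [Fintype V] [DecidableEq V] (G : SimpleGraph V) [DecidableRel G.Adj]

theorem sameCycle_finRotate {n : ℕ} (i j : Fin n) : (finRotate n).SameCycle i j := by
  match n, i, j with
  | 0, i, _ => exact i.elim0
  | 1, i, j => rw [Subsingleton.elim i j]
  | n + 2, i, j =>
    have h : ∀ k : Fin (n + 2), finRotate (n + 2) k ≠ k := fun k =>
      Perm.mem_support.mp (by rw [support_finRotate]; exact mem_univ k)
    exact isCycle_finRotate.sameCycle (h i) (h j)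

theorem localRotations_nonempty : (localRotations G).Nonempty := by
  let R : Perm (DartSet G) := Perm.sigmaCongrRightHom _ fun v => finRotate (G.degree v)
  have hz : ∀ (k : ℤ) (v : V) (i : Fin (G.degree v)),
      (R ^ k) ⟨v, i⟩ = ⟨v, (finRotate (G.degree v) ^ k) i⟩ := by
    intro k v i
    rw [← map_zpow]
    rfl
  refine ⟨R, fun x y => ⟨?_, ?_⟩⟩
  · obtain ⟨v, i⟩ := x
    rintro ⟨k, rfl⟩
    rw [hz]
  · obtain ⟨v, i⟩ := x
    obtain ⟨w, j⟩ := y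
    rintro (rfl : v = w)
    obtain ⟨k, hk⟩ := sameCycle_finRotate i j
    exact ⟨k, by rw [hz, hk]⟩

/-- Reversal of the pairs consisting of a vertex and one of its neighbours. -/
def neighborSwap (x : Σ v : V, G.neighborSet v) : Σ v : V, G.neighborSet v :=
  ⟨x.2, ⟨x.1, x.2.2.symm⟩⟩

theorem edgeSchemes_nonempty : (edgeSchemes G).Nonempty := by
  have e : ∀ v : V, Fin (G.degree v) ≃ G.neighborSet v := fun v =>
    (Fintype.equivFinOfCardEq (G.card_neighborSet_eq_degree v)).symm
  let T : DartSet G ≃ Σ v : V, G.neighborSet v := Equiv.sigmaCongrRight e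
  have hT : ∀ x, (T x).1 = x.1 := fun _ => rfl
  have hT' : ∀ x, (T.symm x).1 = x.1 := fun _ => rfl
  have hinv : Function.Involutive fun x : DartSet G => T.symm (neighborSwap G (T x)) := by
    intro x
    simp only [Equiv.apply_symm_apply]
    exact T.symm_apply_apply x
  have hfst : ∀ x : DartSet G, (hinv.toPerm _ x).1 = ((T x).2 : V) := fun _ => rfl
  refine ⟨hinv.toPerm _, hinv, fun x h => ?_, fun u v huv => ?_⟩
  · have h1 := (T x).2.2
    rw [← hfst, h] at h1
    exact G.loopless.irrefl _ h1
  · refine ⟨T.symm ⟨u, ⟨v, huv⟩⟩, ⟨rfl, ?_⟩, ?_⟩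
    · rw [hfst, Equiv.apply_symm_apply]
    · rintro y ⟨rfl, rfl⟩
      rw [Equiv.eq_symm_apply]
      rfl

theorem maps_nonempty : (maps G).Nonempty := by
  obtain ⟨R, hR⟩ := localRotations_nonempty G
  obtain ⟨E, hE⟩ := edgeSchemes_nonempty G
  exact ⟨(R, E), mem_maps.mpr ⟨hR, hE⟩⟩

end Existence

/-! ### Distance bound with free parameters -/

section Bound

open Finset

/-- The bound on the sum of the squared normalised hook characters of a permutation of a set of
`d` elements with at most `F` fixed points. -/
noncomputable def hookBound (d F : ℝ) (K : ℕ) : ℝ :=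
  2 * (((1 + F) / (d - 1)) ^ 2 + K * (8 * (F / d) ^ 2 + 16 * (K : ℝ) ^ 2 / d) ^ 2
    + d * (2 * (d + 1) * Real.exp (-(K / 4))) ^ 2)

theorem hookBound_mono {d F F' : ℝ} (hd : 1 ≤ d) (hF : 0 ≤ F) (h : F ≤ F') (K : ℕ) :
    hookBound d F K ≤ hookBound d F' K := by
  have hd1 : 0 ≤ d - 1 := by linarith
  have hd0 : 0 ≤ d := by linarith
  unfold hookBound
  gcongr

theorem fixCount_inv {X : Type*} [Fintype X] [DecidableEq X] (σ : Perm X) :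
    fixCount σ⁻¹ = fixCount σ := by
  unfold fixCount
  congr 1
  ext x
  simp only [mem_filter, mem_univ, true_and]
  rw [Perm.inv_eq_iff_eq, eq_comm]

theorem half_sum_abs_mixDist_le {X : Type*} [Fintype X] [DecidableEq X] [Nontrivial X]
    (σ : Perm X) {F : ℝ} (hf : fixCount σ ≤ F) (hF : 2 * F ≤ Fintype.card X) (K : ℕ) :
    (1 / 2) * ∑ τ, |mixDist σ τ - parityDist σ τ| ≤ √(hookBound (Fintype.card X) F K) / 2 := by
  have h1 := sum_abs_mixDist_sub_parityDist_sq_le σ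
  have hf' : 2 * fixCount σ⁻¹ ≤ Fintype.card X := by
    rw [fixCount_inv]
    have : (2 : ℝ) * fixCount σ ≤ Fintype.card X := by linarith
    exact_mod_cast this
  have h2 := sum_sq_ratio_le σ⁻¹ hf' (K := K)
  rw [fixCount_inv] at h2
  have h3 := hookBound_mono (d := Fintype.card X) (by exact_mod_cast Fintype.card_pos)
    (Nat.cast_nonneg (fixCount σ)) hf K
  have := Real.le_sqrt_of_sq_le ((h1.trans h2).trans h3)
  linarith

variable {V : Type*} [Fintype V] [DecidableEq V] {G : SimpleGraph V} [DecidableRel G.Adj]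

/-- Markov's inequality: maps with at most F fixed points are handled by the L² bound, and for the
others the distance is at most 1, which is below the number of fixed points divided by F. -/
theorem tvDist_le {d J : ℕ} (hd : 2 ≤ d) (hJ0 : 0 < J) (hJ : J < d) (hdeg : ∀ w, G.degree w = d)
    {F : ℝ} (hF0 : 0 < F) (hF : 2 * F ≤ d) (K : ℕ) (v : V) :
    tvDist (localFaceDist G v) (parityUniform (dartsAt G v) (oddProb G v))
      ≤ (d * (J / (d - J)) + (Fintype.card V - 1 : ℕ) * (2 * Real.log d + 4) / J) / F
        + √(hookBound d F K) / 2 := by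
  have hcard : Fintype.card (dartsAt G v) = d := (card_dartsAt v).trans (hdeg v)
  have : Nontrivial (dartsAt G v) := Fintype.one_lt_card_iff_nontrivial.mp (by omega)
  have hne := maps_nonempty G
  have hpos : (0 : ℝ) < (maps G).card := by exact_mod_cast card_pos.mpr hne
  refine (tvDist_le_average hne).trans ?_
  rw [div_le_iff₀ hpos]
  have hm : ∀ m ∈ maps G,
      (1 / 2) * ∑ τ, |mixDist (returnPerm v m) τ - parityDist (returnPerm v m) τ|
        ≤ (fixCount (returnPerm v m) : ℝ) / F + √(hookBound d F K) / 2 := by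
    intro m hm
    by_cases hf : (fixCount (returnPerm v m) : ℝ) ≤ F
    · have h1 := half_sum_abs_mixDist_le (returnPerm v m) hf (by rw [hcard]; exact hF) K
      rw [hcard] at h1
      have : 0 ≤ (fixCount (returnPerm v m) : ℝ) / F := by positivity
      linarith
    · have h1 := sum_abs_mixDist_sub_parityDist_le_two
        (isFullCycle_rotation (mem_maps.mp hm).1 v) (returnPerm v m)
      have h2 : 1 ≤ (fixCount (returnPerm v m) : ℝ) / F := by
        rw [le_div_iff₀ hF0]
        linarith
      have := Real.sqrt_nonneg (hookBound d F K)
      linarith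
  refine (sum_le_sum hm).trans ?_
  rw [sum_add_distrib, ← sum_div, sum_const, nsmul_eq_mul, add_mul, mul_comm (√_ / 2)]
  refine add_le_add_left ?_ _
  rw [div_mul_eq_mul_div, mul_comm _ ((maps G).card : ℝ)]
  exact div_le_div_of_nonneg_right (sum_maps_fixCount_le hd hJ0 hJ hdeg v) hF0.le

end Bound

/-! ### Choice of parameters for the complete graph -/

section Asymptotics

/-- With t = d^(1/4) and u = √(log d), the summands are about J and 2 t⁴ u² / J; taking J near t² u
brings both to the order t² u. -/
theorem expectation_bound {t u J : ℝ} (hu : 5 ≤ u) (hut : 68 * u ^ 2 ≤ t)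
    (hJ1 : t ^ 2 * u ≤ J) (hJ2 : J ≤ t ^ 2 * u + 1) :
    t ^ 4 * (J / (t ^ 4 - J)) + t ^ 4 * (2 * u ^ 2 + 4) / J ≤ 4 * t ^ 2 * u
      ∧ J ≤ t ^ 4 / 5 := by
  have ht : 1000 ≤ t := by nlinarith
  have hut' : 100 * u ≤ t := by nlinarith
  have ht2 : 1000000 ≤ t ^ 2 := by nlinarith
  have htu : 100 * (t ^ 2 * u) ≤ t ^ 3 := by nlinarith
  have ht4 : 1000 * t ^ 3 ≤ t ^ 4 := by nlinarith [pow_pos (by linarith : (0 : ℝ) < t) 3]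
  have hA : 5 ≤ t ^ 2 * u := by nlinarith
  have hJ5 : J ≤ t ^ 4 / 5 := by nlinarith
  have hJ0 : 0 < J := by linarith
  have h4 : 0 < t ^ 4 := by positivity
  refine ⟨?_, hJ5⟩
  have h1 : t ^ 4 * (J / (t ^ 4 - J)) ≤ 3 / 2 * (t ^ 2 * u) := by
    rw [← mul_div_assoc, div_le_iff₀ (by linarith)]
    have : t ^ 4 * J ≤ t ^ 4 * (6 / 5 * (t ^ 2 * u)) :=
      mul_le_mul_of_nonneg_left (by linarith) h4.le
    have : 3 / 2 * (t ^ 2 * u) * (4 / 5 * t ^ 4) ≤ 3 / 2 * (t ^ 2 * u) * (t ^ 4 - J) :=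
      mul_le_mul_of_nonneg_left (by linarith) (by linarith)
    nlinarith
  have h2 : t ^ 4 * (2 * u ^ 2 + 4) / J ≤ 5 / 2 * (t ^ 2 * u) := by
    rw [div_le_iff₀ hJ0]
    have h3 : 5 / 2 * (t ^ 2 * u) * (t ^ 2 * u) ≤ 5 / 2 * (t ^ 2 * u) * J :=
      mul_le_mul_of_nonneg_left hJ1 (by linarith)
    have h5 : t ^ 4 * (2 * u ^ 2 + 4) ≤ t ^ 4 * (5 / 2 * u ^ 2) :=
      mul_le_mul_of_nonneg_left (by nlinarith) h4.le
    nlinarith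
  linarith

/-- The fixed-point density is 3 / t, so the term k = 1 costs (4 / t)² and each of the K middle
terms (73 / t²)². The choice K ≥ 16 L gives exp (-K / 4) ≤ d⁻⁴, which makes the tail negligible. -/
theorem hookBound_le {t L : ℝ} {K : ℕ} (hL : 32 ≤ L) (hLt : 68 * L ≤ t)
    (hexp : Real.exp L = t ^ 4) (hK1 : 16 * L ≤ K) (hK2 : (K : ℝ) ≤ 17 * L) :
    hookBound (t ^ 4) (3 * t ^ 3) K ≤ 4 * L / t ^ 2 := by
  have ht : 2000 ≤ t := by linarith
  have ht0 : 0 < t := by linarith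
  have ht2 : 1000000 ≤ t ^ 2 := by nlinarith
  have ht4 : 1000000 ≤ t ^ 4 := by nlinarith [sq_nonneg (t ^ 2)]
  have h1 : ((1 + 3 * t ^ 3) / (t ^ 4 - 1)) ^ 2 ≤ 16 / t ^ 2 := by
    have : (1 + 3 * t ^ 3) / (t ^ 4 - 1) ≤ 4 / t := by
      rw [div_le_div_iff₀ (by linarith) ht0]
      nlinarith [mul_pos ht0 (pow_pos ht0 2)]
    calc _ ≤ (4 / t) ^ 2 := by
          refine pow_le_pow_left₀ (div_nonneg (by positivity) (by linarith)) this 2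
      _ = _ := by rw [div_pow]; norm_num
  have h2 : K * (8 * (3 * t ^ 3 / t ^ 4) ^ 2 + 16 * (K : ℝ) ^ 2 / t ^ 4) ^ 2 ≤ L / (2 * t ^ 2) := by
    have h3 : 3 * t ^ 3 / t ^ 4 = 3 / t := by
      field_simp
    have h4 : 16 * (K : ℝ) ^ 2 / t ^ 4 ≤ 1 / t ^ 2 := by
      rw [div_le_div_iff₀ (by positivity) (by positivity)]
      -- From K ≤ 17 L; this is where the constant 68 = 4 · 17 comes from.
      have h5 : 4 * (K : ℝ) ≤ t := by linarith
      have h6 : (4 * (K : ℝ)) ^ 2 ≤ t ^ 2 := pow_le_pow_left₀ (by positivity) h5 2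
      nlinarith
    have h5 : 8 * (3 * t ^ 3 / t ^ 4) ^ 2 + 16 * (K : ℝ) ^ 2 / t ^ 4 ≤ 73 / t ^ 2 := by
      rw [h3]
      calc _ ≤ 8 * (3 / t) ^ 2 + 1 / t ^ 2 := by linarith
        _ = _ := by field_simp; norm_num
    calc _ ≤ 17 * L * (73 / t ^ 2) ^ 2 := by gcongr
      _ ≤ _ := by
        rw [div_pow, mul_div_assoc', div_le_div_iff₀ (by positivity) (by positivity)]
        have : L * t ^ 2 * 181186 ≤ L * t ^ 2 * t ^ 2 :=
          mul_le_mul_of_nonneg_left (by linarith) (by positivity)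
        nlinarith
  have h3 : t ^ 4 * (2 * (t ^ 4 + 1) * Real.exp (-(K / 4))) ^ 2 ≤ 1 / t ^ 2 := by
    have h4 : Real.exp (-(K / 4 : ℝ)) ≤ 1 / (t ^ 4) ^ 4 := by
      rw [← hexp, ← Real.exp_nat_mul, one_div, ← Real.exp_neg]
      refine Real.exp_le_exp.mpr ?_
      push_cast
      linarith
    calc _ ≤ t ^ 4 * (2 * (2 * t ^ 4) * (1 / (t ^ 4) ^ 4)) ^ 2 := by
          gcongr
          linarith
      _ = 16 / t ^ 18 * (1 / t ^ 2) := by field_simp; norm_num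
      _ ≤ 1 * (1 / t ^ 2) := by
        refine mul_le_mul_of_nonneg_right ?_ (by positivity)
        rw [div_le_one (by positivity)]
        calc (16 : ℝ) ≤ t := by linarith
          _ ≤ t ^ 18 := le_self_pow₀ (by linarith) (by norm_num)
      _ = _ := one_mul _
  have h4 : 2 * (16 / t ^ 2 + L / (2 * t ^ 2) + 1 / t ^ 2) = (34 + L) / t ^ 2 := by
    field_simp
    ring
  calc hookBound (t ^ 4) (3 * t ^ 3) K
      ≤ 2 * (16 / t ^ 2 + L / (2 * t ^ 2) + 1 / t ^ 2) := by
        unfold hookBound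
        linarith
    _ = (34 + L) / t ^ 2 := h4
    _ ≤ _ := by
      gcongr
      linarith

theorem tvDist_nonneg {Ω : Type*} [Fintype Ω] (P Q : Ω → ℝ) : 0 ≤ tvDist P Q :=
  mul_nonneg (by norm_num) (Finset.sum_nonneg fun _ _ => abs_nonneg _)

/-- The parameters are J = ⌈t² √L⌉, F = 3 t³ and K = ⌈16 L⌉. Markov's inequality costs (4/3) √L / t
and the L² bound √L / t, and (7/3)² = 49/9 < 8. -/
theorem tvDist_complete_sq_le {n d : ℕ} (hn : n = d + 1) {t L : ℝ} (ht : t ^ 4 = d)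
    (hLd : L = Real.log d) (hL : 32 ≤ L) (hLt : 68 * L ≤ t) (v : Fin n) :
    tvDist (localFaceDist (⊤ : SimpleGraph (Fin n)) v)
        (parityUniform (dartsAt (⊤ : SimpleGraph (Fin n)) v)
          (oddProb (⊤ : SimpleGraph (Fin n)) v)) ^ 2 ≤ 8 * L / t ^ 2 := by
  have ht0 : 2000 ≤ t := by linarith
  have htpos : 0 < t := by linarith
  have ht2 : 0 < t ^ 2 := by positivity
  have hd0 : (0 : ℝ) < d := by rw [← ht]; positivity
  have hd2 : 2 ≤ d := by
    have : (2 : ℝ) ≤ d := by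
      rw [← ht]
      linarith [le_self_pow₀ (show 1 ≤ t by linarith) (show 4 ≠ 0 by norm_num)]
    exact_mod_cast this
  have hexp : Real.exp L = t ^ 4 := by rw [hLd, Real.exp_log hd0, ht]
  have hdeg : ∀ w : Fin n, (⊤ : SimpleGraph (Fin n)).degree w = d := by
    intro w
    rw [SimpleGraph.complete_graph_degree, Fintype.card_fin, hn, Nat.add_sub_cancel]
  have hu0 : 0 ≤ √L := Real.sqrt_nonneg L
  have hu2 : √L ^ 2 = L := Real.sq_sqrt (by linarith)
  have hu5 : 5 ≤ √L := Real.le_sqrt_of_sq_le (by linarith)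
  have hA : 0 ≤ t ^ 2 * √L := by positivity
  obtain ⟨hE, hJ5⟩ := expectation_bound hu5 (by rw [hu2]; exact hLt)
    (Nat.le_ceil (t ^ 2 * √L)) (Nat.ceil_lt_add_one hA).le
  have hJd : ⌈t ^ 2 * √L⌉₊ < d := by
    have : ((⌈t ^ 2 * √L⌉₊ : ℕ) : ℝ) < d := by
      rw [← ht] at hd0 ⊢
      linarith
    exact_mod_cast this
  have hF : 2 * (3 * t ^ 3) ≤ (d : ℝ) := by
    rw [← ht]
    nlinarith [pow_pos htpos 3]
  have hK : ((⌈16 * L⌉₊ : ℕ) : ℝ) ≤ 17 * L :=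
    (Nat.ceil_lt_add_one (by linarith)).le.trans (by linarith)
  have hB := hookBound_le hL hLt hexp (Nat.le_ceil (16 * L)) hK
  have htv := tvDist_le hd2 (Nat.ceil_pos.mpr (by positivity)) hJd hdeg
    (by positivity : 0 < 3 * t ^ 3) hF ⌈16 * L⌉₊ v
  rw [Fintype.card_fin, show n - 1 = d by omega, ← hLd, ← ht] at htv
  rw [hu2] at hE
  have h1 : (4 * t ^ 2 * √L) / (3 * t ^ 3) = 4 / 3 * (√L / t) := by
    field_simp
  have h2 : √(hookBound (t ^ 4) (3 * t ^ 3) ⌈16 * L⌉₊) ≤ 2 * (√L / t) := by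
    refine Real.sqrt_le_iff.mpr ⟨by positivity, hB.trans_eq ?_⟩
    rw [mul_pow, div_pow, hu2]
    ring
  have h3 := (div_le_div_of_nonneg_right hE (by positivity : 0 ≤ 3 * t ^ 3)).trans_eq h1
  have h4 := htv.trans (add_le_add h3 (div_le_div_of_nonneg_right h2 (by norm_num : (0 : ℝ) ≤ 2)))
  have hX : (√L / t) ^ 2 = L / t ^ 2 := by rw [div_pow, hu2]
  have hL0 : 0 ≤ L / t ^ 2 := div_nonneg (by linarith) ht2.le
  calc _ ≤ (7 / 3 * (√L / t)) ^ 2 :=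
        pow_le_pow_left₀ (tvDist_nonneg _ _) (h4.trans_eq (by ring)) 2
    _ = 49 / 9 * (L / t ^ 2) := by rw [mul_pow, hX]; norm_num
    _ ≤ _ := by
      rw [mul_div_assoc]
      linarith

theorem tendsto_sub_atTop (c : ℝ) : Tendsto (fun n : ℕ => (n : ℝ) - c) atTop atTop :=
  tendsto_atTop_add_const_right _ (-c) tendsto_natCast_atTop_atTop

theorem tendsto_log_div_sqrt :
    Tendsto (fun n : ℕ => 8 * Real.log ((n : ℝ) - 1) / √((n : ℝ) - 2)) atTop (𝓝 0) := by
  have h1 : Tendsto (fun x : ℝ => Real.log x / x ^ (1 / 2 : ℝ)) atTop (𝓝 0) :=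
    (isLittleO_log_rpow_atTop (by norm_num)).tendsto_div_nhds_zero
  -- Twice 8, because √(n - 1) ≤ 2 √(n - 2) for n ≥ 3.
  have h2 := (h1.comp (tendsto_sub_atTop 1)).const_mul 16
  rw [mul_zero] at h2
  refine squeeze_zero' ?_ ?_ h2
  · filter_upwards [eventually_ge_atTop 3] with n hn
    have : (3 : ℝ) ≤ n := by exact_mod_cast hn
    exact div_nonneg (mul_nonneg (by norm_num) (Real.log_nonneg (by linarith)))
      (Real.sqrt_nonneg _)
  · filter_upwards [eventually_ge_atTop 3] with n hn
    have hn' : (3 : ℝ) ≤ n := by exact_mod_cast hn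
    have hlog : 0 ≤ Real.log ((n : ℝ) - 1) := Real.log_nonneg (by linarith)
    simp only [Function.comp_apply]
    rw [← Real.sqrt_eq_rpow, mul_div_assoc', div_le_div_iff₀
      (Real.sqrt_pos.mpr (by linarith)) (Real.sqrt_pos.mpr (by linarith))]
    have h3 : √((n : ℝ) - 1) ≤ 2 * √((n : ℝ) - 2) := by
      refine Real.sqrt_le_iff.mpr ⟨by positivity, ?_⟩
      rw [mul_pow, Real.sq_sqrt (by linarith)]
      linarith
    calc _ ≤ 8 * Real.log ((n : ℝ) - 1) * (2 * √((n : ℝ) - 2)) :=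
          mul_le_mul_of_nonneg_left h3 (by linarith)
      _ = _ := by ring

theorem eventually_tvDist_complete_sq_le : ∀ᶠ n : ℕ in atTop, ∀ v : Fin n,
    tvDist (localFaceDist (⊤ : SimpleGraph (Fin n)) v)
        (parityUniform (dartsAt (⊤ : SimpleGraph (Fin n)) v)
          (oddProb (⊤ : SimpleGraph (Fin n)) v)) ^ 2
      ≤ 8 * Real.log ((n : ℝ) - 1) / √((n : ℝ) - 2) := by
  have h1 : ∀ᶠ x : ℝ in atTop, 68 * Real.log x ≤ x ^ (1 / 4 : ℝ) := by
    have h := (isLittleO_log_rpow_atTop (by norm_num : (0 : ℝ) < 1 / 4)).bound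
      (by norm_num : (0 : ℝ) < 1 / 68)
    filter_upwards [h, eventually_ge_atTop 1] with x hx hx1
    rw [Real.norm_of_nonneg (Real.log_nonneg hx1),
      Real.norm_of_nonneg (Real.rpow_nonneg (by linarith) _)] at hx
    linarith
  have h2 := (tendsto_sub_atTop 1).eventually
    (h1.and (Real.tendsto_log_atTop.eventually_ge_atTop 32))
  filter_upwards [h2, eventually_ge_atTop 3] with n hn hn3 v
  have hn' : (3 : ℝ) ≤ n := by exact_mod_cast hn3
  have hd : ((n - 1 : ℕ) : ℝ) = (n : ℝ) - 1 := by
    rw [Nat.cast_sub (by omega), Nat.cast_one]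
  have ht : (((n : ℝ) - 1) ^ (1 / 4 : ℝ)) ^ 4 = ((n - 1 : ℕ) : ℝ) := by
    rw [hd, ← Real.rpow_natCast, ← Real.rpow_mul (by linarith)]
    norm_num
  have hs : (((n : ℝ) - 1) ^ (1 / 4 : ℝ)) ^ 2 = √((n : ℝ) - 1) := by
    rw [Real.sqrt_eq_rpow, ← Real.rpow_natCast, ← Real.rpow_mul (by linarith)]
    norm_num
  have h3 := tvDist_complete_sq_le (n := n) (d := n - 1) (by omega) ht (by rw [hd])
    hn.2 hn.1 v
  rw [hs] at h3
  refine h3.trans (div_le_div_of_nonneg_left ?_ (Real.sqrt_pos.mpr (by linarith))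
    (Real.sqrt_le_sqrt (by linarith)))
  exact mul_nonneg (by norm_num) (Real.log_nonneg (by linarith))

end Asymptotics

end RandomEmbedding

theorem mainTheorem5 :
    (∀ᶠ n : ℕ in atTop, ∀ v : Fin n,
      tvDist (localFaceDist (⊤ : SimpleGraph (Fin n)) v)
          (parityUniform (dartsAt (⊤ : SimpleGraph (Fin n)) v)
            (oddProb (⊤ : SimpleGraph (Fin n)) v)) ^ 2
        ≤ 8 * Real.log ((n : ℝ) - 1) / √((n : ℝ) - 2)) ∧
    Tendsto (fun n : ℕ => 8 * Real.log ((n : ℝ) - 1) / √((n : ℝ) - 2)) atTop (𝓝 0) :=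
  ⟨eventually_tvDist_complete_sq_le, tendsto_log_div_sqrt⟩
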